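/- **Setting.** Let $(X_i,Y_i)_{i\ge 1}$ be independent random pairs in $\mathbb R^2$ and let $C$ be a fixed finite set of indices (the fixed waypoints). For $i\in C$ the pair is deterministic and lies on the regression curve, $Y_i=m(X_i)$. For $i\notin C$ the pairs are identically distributed like $(X,Y)$, where $X$ has density $f$, $E Y^2<\infty$, $m(u)=E[Y\mid X=u]$ and $\sigma^2(u)=\operatorname{Var}(Y\mid X=u)$. Put $w_i(x)=h^{-1}K((x-X_i)/h)$. For tuning parameters $\lambda=\lambda_n$ and bandwidths $h=h_n>0$, the adaptive Nadaraya–Watson (ANW) estimator of $m(x)$ from the first $n$ pairs is $$\hat m_{\mathrm{ANW}}(x)=\frac{\sum_{i\le n,\,i\notin C}w_i(x)Y_i+\sum_{i\le n,\,i\in C}\lambda w_i(x)Y_i}{\sum_{i\le n,\,i\notin C}w_i(x)+\sum_{i\le n,\,i\in C}\lambda w_i(x)}$$ (with value $0$ if the denominator vanishes), and $\hat m_{\mathrm{NW}}(x)$ is the same expression with $\lambda=1$. **Assumptions.** 1. $h\to0$ and $nh\to\infty$ as $n\to\infty$. 2. $K$ is measurable, nonnegative and symmetric, $\int K=1$,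 $\sigma_K^2=\int u^2K(u)\,du<\infty$, $R(K)=\int K^2<\infty$, and $|u|^3K(u)$ is bounded (automatic if $K$ is nonincreasing in $|u|$). 3. $m$ and $f$ are twice continuously differentiable in a neighborhood of $x$, and $f(x)>0$. 4. $\sigma^2$ is continuous (hence locally bounded) near $x$, and the squared errors $\varepsilon^2$, $\varepsilon=Y-m(X)$, are conditionally uniformly integrable near $x$: for every $\eta>0$ there are $M$ and $\delta>0$ with $E[\varepsilon^2\mathbf 1\{|\varepsilon|>M\}\mid X=u]\le\eta$ for almost every $u$ (with respect to the law of $X$) with $|u-x|<\delta$. 5. $\lambda\to\infty$ and $\lambda/(nh^4)\to0$ as $n\to\infty$. **Theorem.** Let $x\notin\{X_j:j\in C\}$. Then, for all large $n$, $\hat m_{\mathrm{ANW}}(x)$ is square integrable, and, writing $\operatorname{Bias}\{\hat m\}=E\,\hat m-m(x)$, $$\operatorname{Bias}\{\hat m_{\mathrm{ANW}}(x)\}=\tfrac12h^2\sigma_K^2\Bigl(m''(x)+\frac{2m'(x)f'(x)}{f(x)}\Bigr)+o(h^2),$$ $$\operatorname{Var}\{\hat m_{\mathrm{ANW}}(x)\}=\frac{\sigma^2(x)R(K)}{nhf(x)}+o\Bigl(\frac1{nh}\Bigr),$$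 $$\sqrt{nh}\,\bigl(\hat m_{\mathrm{ANW}}(x)-m(x)-\operatorname{Bias}\{\hat m_{\mathrm{ANW}}(x)\}\bigr)\xrightarrow{d}N\Bigl(0,\frac{\sigma^2(x)R(K)}{f(x)}\Bigr).$$ Moreover $\hat m_{\mathrm{ANW}}(x)$ is asymptotically equivalent to $\hat m_{\mathrm{NW}}(x)$: the latter satisfies the same statements (square integrability, bias and variance expansions, limit law), and $$\sqrt{nh}\,\bigl\{(\hat m_{\mathrm{ANW}}(x)-E\,\hat m_{\mathrm{ANW}}(x))-(\hat m_{\mathrm{NW}}(x)-E\,\hat m_{\mathrm{NW}}(x))\bigr\}\to0\quad\text{in probability}.$$ -/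

import Mathlib

open MeasureTheory ProbabilityTheory Filter Topology Asymptotics
open scoped NNReal ENNReal

namespace WaypointRegression

/-- A smoothing kernel `K : ℝ → ℝ`: symmetric, with integral one, finite second moment and finite
roughness. As its values serve as the weights of a weighted average (of a weighted least squares
criterion), it is nonnegative; `|u|³ K(u)` is bounded, which for a kernel that is nonincreasing in
`|u|` follows from the finite second moment. -/
structure IsSmoothingKernel (K : ℝ → ℝ) : Prop where
  measurable : Measurable K
  nonneg : ∀ u, 0 ≤ K u
  symm : ∀ u, K (-u) = K u
  integral_eq_one : ∫ u, K u = 1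
  integrable_sq_mul : Integrable (fun u => u ^ 2 * K u)
  integrable_sq : Integrable (fun u => K u ^ 2)
  tail : ∃ B : ℝ, ∀ u, |u| ^ 3 * K u ≤ B

/-- The second moment `σ_K² = ∫ u² K(u) du` of the kernel. -/
noncomputable def kernelSecondMoment (K : ℝ → ℝ) : ℝ := ∫ u, u ^ 2 * K u

/-- The roughness `R(K) = ∫ K(u)² du` of the kernel. -/
noncomputable def kernelRoughness (K : ℝ → ℝ) : ℝ := ∫ u, K u ^ 2

/-- The kernel weight `h⁻¹ K((x - u) / h)` that a design point `u` gets at the point `x`. -/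
noncomputable def kernelWeight (K : ℝ → ℝ) (h x u : ℝ) : ℝ := h⁻¹ * K ((x - u) / h)

/-- The Nadaraya-Watson estimate at `x` from the data `(X i, Y i)`, `i < n`. -/
noncomputable def nw (K : ℝ → ℝ) (h : ℝ) (n : ℕ) (X Y : ℕ → ℝ) (x : ℝ) : ℝ :=
  (∑ i ∈ Finset.range n, kernelWeight K h x (X i) * Y i) /
    ∑ i ∈ Finset.range n, kernelWeight K h x (X i)

/-- The adaptive Nadaraya-Watson estimate at `x` from the data `(X i, Y i)`, `i < n`: the
observations whose index lies in the set `C` of waypoints have their kernel weights multiplied by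
the tuning parameter `lam`. -/
noncomputable def anw (K : ℝ → ℝ) (h lam : ℝ) (C : Finset ℕ) (n : ℕ) (X Y : ℕ → ℝ) (x : ℝ) : ℝ :=
  ((∑ i ∈ Finset.range n \ C, kernelWeight K h x (X i) * Y i) +
      ∑ i ∈ Finset.range n ∩ C, lam * kernelWeight K h x (X i) * Y i) /
    ((∑ i ∈ Finset.range n \ C, kernelWeight K h x (X i)) +
      ∑ i ∈ Finset.range n ∩ C, lam * kernelWeight K h x (X i))

/-- The σ-algebra on `ℝ × ℝ` generated by the first coordinate, the covariate. -/
abbrev covariateSigma : MeasurableSpace (ℝ × ℝ) :=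
  MeasurableSpace.comap Prod.fst inferInstance

/-- The law `ν` on `ℝ × ℝ` of a stochastic observation `(X, Y)` has design density `f`, regression
function `m(x) = E[Y | X = x]` and conditional variance `σ²(x) = Var(Y | X = x)`, where `Y` has a
finite second moment. -/
structure IsRegressionLaw (ν : Measure (ℝ × ℝ)) (m f σ2 : ℝ → ℝ) : Prop where
  measurable_m : Measurable m
  measurable_f : Measurable f
  measurable_σ2 : Measurable σ2
  f_nonneg : ∀ u, 0 ≤ f u
  map_fst : ν.map Prod.fst = volume.withDensity (fun u => ENNReal.ofReal (f u))
  memLp_snd : MemLp (fun p : ℝ × ℝ => p.2) 2 ν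
  condExp_snd : ν[fun p : ℝ × ℝ => p.2 | covariateSigma] =ᵐ[ν] fun p => m p.1
  condVar_snd : Var[fun p : ℝ × ℝ => p.2; ν | covariateSigma] =ᵐ[ν] fun p => σ2 p.1

/-- The errors `ε = Y - m(X)` have conditionally uniformly integrable squares near `x`: for every
`η > 0` there is `M` with `E[ε² 1{|ε| > M} | X = u] ≤ η` for almost all `u` near `x`. -/
def LocallyUniformlyIntegrableErrors (ν : Measure (ℝ × ℝ)) (m : ℝ → ℝ) (x : ℝ) : Prop :=
  ∀ η : ℝ, 0 < η → ∃ M δ : ℝ, 0 < δ ∧ ∀ᵐ p ∂ν, |p.1 - x| < δ →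
    (ν[{q : ℝ × ℝ | M < |q.2 - m q.1|}.indicator (fun q => (q.2 - m q.1) ^ 2)
      | covariateSigma]) p ≤ η

/-- The data: independent pairs `(X i, Y i)`, those with `i ∉ C` having the common law `ν`, and
those with `i ∈ C`, the fixed waypoints, being deterministic points on the regression curve. -/
structure IsWaypointSample {Ω : Type*} [MeasurableSpace Ω] (μ : Measure Ω) (X Y : ℕ → Ω → ℝ)
    (ν : Measure (ℝ × ℝ)) (m : ℝ → ℝ) (C : Finset ℕ) (t : ℕ → ℝ) : Prop where
  indep : iIndepFun (fun i ω => (X i ω, Y i ω)) μ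
  hasLaw : ∀ i, i ∉ C → HasLaw (fun ω => (X i ω, Y i ω)) ν μ
  waypoint : ∀ i ∈ C, ∀ ω, X i ω = t i ∧ Y i ω = m (t i)

/-- The bias `E[T] - θ` of an estimator `T` of the number `θ`. -/
noncomputable def bias {Ω : Type*} [MeasurableSpace Ω] (μ : Measure Ω) (T : Ω → ℝ) (θ : ℝ) : ℝ :=
  (∫ ω, T ω ∂μ) - θ

/-- The classical interior asymptotics at `x` of a sequence `T n` of estimators of `m x`, with the
bandwidths `h n`: bias expansion, variance expansion and asymptotic normality (the first clause says
that mean and variance exist). -/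
structure HasInteriorAsymptotics {Ω : Type*} [MeasurableSpace Ω] (μ : Measure Ω)
    [IsProbabilityMeasure μ] (T : ℕ → Ω → ℝ) (h : ℕ → ℝ) (K m f σ2 : ℝ → ℝ) (x : ℝ) : Prop where
  memLp : ∀ᶠ n in atTop, MemLp (T n) 2 μ
  bias_expansion :
    (fun n => bias μ (T n) (m x) - 1 / 2 * h n ^ 2 * kernelSecondMoment K *
        (deriv (deriv m) x + 2 * deriv m x * deriv f x / f x))
      =o[atTop] fun n => h n ^ 2
  variance_expansion :
    (fun n => Var[T n; μ] - σ2 x * kernelRoughness K / (n * h n * f x))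
      =o[atTop] fun n => 1 / (n * h n)
  clt :
    TendstoInDistribution
      (fun (n : ℕ) ω => √(n * h n) * (T n ω - m x - bias μ (T n) (m x)))
      atTop (id : ℝ → ℝ) (fun _ => μ)
      (gaussianReal 0 (σ2 x * kernelRoughness K / f x).toNNReal)

end WaypointRegression

set_option linter.unusedSectionVars false

/-! Both estimators are weighted averages, so subtracting `m x` from every response gives `T - m x =
N / D`. After division by `n`, `N = S + η + G`: `S` averages the kernel weighted errors, `G`
averages `w(X) (m(X) - m x)`, and `η` is the share of the waypoints. `D` is the averaged weight; its
waypoint share is `δ`. As `|u|³ K(u)` is bounded, a point at a fixed distance from `x` has weight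
`O(h²)`, so `η = O(λ h² / n) = o(h²)` and `δ → 0`: the waypoints drop out of all leading terms.

The core is the linearization `n h E(T - E T - S / f x)² → 0` together with the limit of `(E T - m
x) / h²` (`hasInteriorAsymptotics_anw`). Variance and limit law are then those of `S / f x`, and
since this linear term is the same for every admissible sequence of tuning parameters, the case `λ =
1`, which is Nadaraya-Watson, is asymptotically equivalent.

To control the quotient, `1 / D` is replaced by `truncInv (f x / 2) D`, which is bounded and
Lipschitz. Errors are centered given the covariates, and `D` depends on covariates only, so the
product of `S` with the truncated inverse has mean zero. The bias comes from `η + G`, whose mean is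
expanded to second order by `tendsto_integral_kernelWeight_mul_div_sq`. The interaction of `S` with
the fluctuations of `D` is bounded by a leave-one-out argument in
`integral_sum_error_sq_mul_truncInv_le`.

Truncation changes the estimator only where `D < f x / 2`. A Chernoff bound makes this event
exponentially unlikely in `n h`; on it the squared estimate is at most the sum of the squared
responses, and leaving out one observation decouples its response from the event. The two conditions
on `λ` force `n h⁴ → ∞`, so the exponential beats every power of `n` and `1 / h`.

The limit law of `S` is a Lindeberg theorem proved with characteristic functions
(`tendstoInDistribution_sum`); its condition, `tendsto_integral_lindeberg`, rests on the conditional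
uniform integrability of the squared errors near `x`. -/

namespace WaypointRegression

/-! ### Approximate identities with slowly decaying kernels. -/

section ApproximateIdentity

theorem integral_rescaled (L : ℝ → ℝ) {h : ℝ} (hh : 0 < h) (x : ℝ) :
    ∫ u, h⁻¹ * L ((x - u) / h) = ∫ u, L u := by
  have h1 := integral_sub_left_eq_self (fun v => h⁻¹ * L (v / h)) volume x
  rw [h1, integral_const_mul, Measure.integral_comp_div, abs_of_pos hh, smul_eq_mul,
    inv_mul_cancel_left₀ hh.ne']

theorem integrable_rescaled {L : ℝ → ℝ} (hL : Integrable L) {h : ℝ} (hh : 0 < h) (x : ℝ) :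
    Integrable fun u => h⁻¹ * L ((x - u) / h) := by
  have h1 : Integrable fun v => h⁻¹ * L (v / h) := (hL.comp_div hh.ne').const_mul _
  exact h1.comp_sub_left x

/-- The bound `|v / h| L(v / h) ≤ B` is divided by `|v| ≥ δ`, and `h` cancels. This uniform bound
away from the center is what admits functions `q` that are only integrable there; `h ≤ δ` puts `v /
h` in the range of the tail bound. -/
theorem rescaled_le_of_far {L : ℝ → ℝ} {B δ h v : ℝ} (hL0 : ∀ u, 0 ≤ L u)
    (hLB : ∀ u, 1 ≤ |u| → |u| * L u ≤ B) (hh : 0 < h) (hhδ : h ≤ δ) (hv : δ ≤ |v|) :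
    h⁻¹ * L (v / h) ≤ B / δ := by
  have hδ : 0 < δ := hh.trans_le hhδ
  have habs : |v / h| = |v| / h := by rw [abs_div, abs_of_pos hh]
  have h2 := hLB (v / h) (by rw [habs, le_div_iff₀ hh]; linarith)
  rw [le_div_iff₀ hδ]
  have hw : 0 ≤ h⁻¹ * L (v / h) := mul_nonneg (by positivity) (hL0 _)
  calc h⁻¹ * L (v / h) * δ ≤ h⁻¹ * L (v / h) * |v| := by gcongr
    _ = |v / h| * L (v / h) := by rw [habs]; ring
    _ ≤ B := h2

/-- A function bounded near `x` and integrable is integrable against a rescaled kernel with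
decaying tails. -/
theorem integrable_rescaled_mul {L q : ℝ → ℝ} {B M δ h x : ℝ} (hLm : Measurable L)
    (hL0 : ∀ u, 0 ≤ L u) (hLi : Integrable L) (hLB : ∀ u, 1 ≤ |u| → |u| * L u ≤ B)
    (hqm : Measurable q) (hq : Integrable q) (hqM : ∀ u, |u - x| < δ → |q u| ≤ M)
    (hh : 0 < h) (hhδ : h ≤ δ) :
    Integrable fun u => h⁻¹ * L ((x - u) / h) * q u := by
  have hδ : 0 < δ := hh.trans_le hhδ
  have hB : 0 ≤ B := le_trans (by have := hL0 1; positivity) (hLB 1 (by simp))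
  have h1 : Integrable fun u => M * (h⁻¹ * L ((x - u) / h)) + B / δ * |q u| :=
    ((integrable_rescaled hLi hh x).const_mul M).add (hq.abs.const_mul _)
  have hM : 0 ≤ M := (abs_nonneg _).trans (hqM x (by simpa using hδ))
  refine h1.mono' (by fun_prop) (ae_of_all _ fun u => ?_)
  have hw : 0 ≤ h⁻¹ * L ((x - u) / h) := mul_nonneg (by positivity) (hL0 _)
  rw [Real.norm_eq_abs, abs_mul, abs_of_nonneg hw]
  by_cases hu : |u - x| < δ
  · have := mul_le_mul_of_nonneg_left (hqM u hu) hw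
    have : 0 ≤ B / δ * |q u| := by positivity
    linarith
  · have h3 := rescaled_le_of_far hL0 hLB hh hhδ (v := x - u)
      (by rw [abs_sub_comm]; exact not_lt.1 hu)
    have := mul_le_mul_of_nonneg_right h3 (abs_nonneg (q u))
    have : 0 ≤ M * (h⁻¹ * L ((x - u) / h)) := by positivity
    linarith

theorem eventually_integrable_rescaled_mul {L q : ℝ → ℝ} {B x : ℝ} {h : ℕ → ℝ}
    (hLm : Measurable L) (hL0 : ∀ u, 0 ≤ L u) (hLi : Integrable L)
    (hLB : ∀ u, 1 ≤ |u| → |u| * L u ≤ B)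
    (hqm : Measurable q) (hq : Integrable q) (hqx : ContinuousAt q x)
    (h_pos : ∀ n, 0 < h n) (h_zero : Tendsto h atTop (𝓝 0)) :
    ∀ᶠ n in atTop, Integrable fun u => (h n)⁻¹ * L ((x - u) / h n) * q u := by
  obtain ⟨δ, hδ, hδq⟩ := Metric.continuousAt_iff.1 hqx 1 one_pos
  filter_upwards [h_zero.eventually_le_const hδ] with n hn
  refine integrable_rescaled_mul hLm hL0 hLi hLB hqm hq (M := |q x| + 1) (fun u hu => ?_)
    (h_pos n) hn
  have h1 := hδq (x := u) (by simpa [Real.dist_eq] using hu)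
  rw [Real.dist_eq] at h1
  have := abs_sub_abs_le_abs_sub (q u) (q x)
  linarith

/-- Approximate identities `h⁻¹ L((x - u) / h)` whose kernel `L` has tails of order `1 / |u|`. -/
theorem tendsto_integral_rescaled_mul {L q : ℝ → ℝ} {B x : ℝ} {h : ℕ → ℝ} (hLm : Measurable L)
    (hL0 : ∀ u, 0 ≤ L u) (hLi : Integrable L) (hLB : ∀ u, 1 ≤ |u| → |u| * L u ≤ B)
    (hqm : Measurable q) (hq : Integrable q) (hqx : ContinuousAt q x)
    (h_pos : ∀ n, 0 < h n) (h_zero : Tendsto h atTop (𝓝 0)) :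
    Tendsto (fun n => ∫ u, (h n)⁻¹ * L ((x - u) / h n) * q u) atTop (𝓝 (q x * ∫ u, L u)) := by
  have hB : 0 ≤ B := le_trans (by have := hL0 1; positivity) (hLB 1 (by simp))
  obtain ⟨δ, hδ, hδq⟩ := Metric.continuousAt_iff.1 hqx 1 one_pos
  have hqM : ∀ u, |u - x| < δ → |q u| ≤ |q x| + 1 := fun u hu => by
    have h1 := hδq (x := u) (by simpa [Real.dist_eq] using hu)
    rw [Real.dist_eq] at h1
    have := abs_sub_abs_le_abs_sub (q u) (q x)
    linarith
  -- the truncations of `q`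
  have hsmall : Tendsto (fun k : ℕ => ∫ u, {u | (k : ℝ) < |q u|}.indicator (fun u => |q u|) u)
      atTop (𝓝 (∫ _ : ℝ, (0 : ℝ))) := by
    refine tendsto_integral_of_dominated_convergence (fun u => |q u|) (fun k => ?_) hq.abs
      (fun k => ae_of_all _ fun u => ?_) (ae_of_all _ fun u => ?_)
    · exact ((hqm.abs).indicator (measurableSet_lt measurable_const hqm.abs)).aestronglyMeasurable
    · by_cases hu : (k : ℝ) < |q u| <;> simp [Set.indicator, hu]
    · refine tendsto_const_nhds.congr' ?_
      obtain ⟨k₀, hk₀⟩ := exists_nat_ge |q u|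
      filter_upwards [eventually_ge_atTop k₀] with k hk
      have : ¬ (k : ℝ) < |q u| := not_lt.2 (hk₀.trans (by exact_mod_cast hk))
      simp [Set.indicator, this]
  rw [integral_zero] at hsmall
  rw [Metric.tendsto_atTop]
  intro ε hε
  have hsmall' := (hsmall.const_mul (B / δ))
  rw [mul_zero] at hsmall'
  -- The level `k` has two duties: the mass of `|q|` above it is small even after multiplication by
  -- `B / δ`, and it exceeds `|q|` on the `δ`-ball, so the unbounded part `q2` vanishes near `x`.
  obtain ⟨k, hk1, hk2⟩ := ((hsmall'.eventually_lt_const (half_pos hε)).and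
    (eventually_ge_atTop ⌈|q x| + 1⌉₊)).exists
  have hk : |q x| + 1 ≤ k := (Nat.le_ceil _).trans (by exact_mod_cast hk2)
  set q2 : ℝ → ℝ := {u | (k : ℝ) < |q u|}.indicator q with hq2
  set q1 : ℝ → ℝ := fun u => q u - q2 u with hq1
  have hset : MeasurableSet {u | (k : ℝ) < |q u|} := measurableSet_lt measurable_const hqm.abs
  have hq2m : Measurable q2 := hqm.indicator hset
  have hq1m : Measurable q1 := hqm.sub hq2m
  have hq2near : ∀ u, |u - x| < δ → q2 u = 0 := fun u hu => by
    have : ¬ (k : ℝ) < |q u| := not_lt.2 ((hqM u hu).trans hk)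
    simp [hq2, this]
  have hq2i : Integrable q2 := hq.indicator hset
  have hq1b : ∀ u, |q1 u| ≤ k := fun u => by
    by_cases hu : (k : ℝ) < |q u|
    · simp [hq1, hq2, Set.indicator, hu]
    · simpa [hq1, hq2, Set.indicator, hu] using not_lt.1 hu
  have hq1x : q1 x = q x := by simp [hq1, hq2near x (by simpa using hδ)]
  have hq1c : ContinuousAt q1 x := by
    refine hqx.congr ?_
    filter_upwards [Metric.ball_mem_nhds x hδ] with u hu
    simp [hq1, hq2near u (by simpa [Real.dist_eq] using hu)]
  -- The bounded part converges by the substitution `u = x - h v` and dominated convergence.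
  have hlim1 : Tendsto (fun n => ∫ u, (h n)⁻¹ * L ((x - u) / h n) * q1 u) atTop
      (𝓝 (q x * ∫ u, L u)) := by
    have heq : ∀ n, ∫ u, (h n)⁻¹ * L ((x - u) / h n) * q1 u = ∫ v, L v * q1 (x - h n * v) := by
      intro n
      rw [← integral_rescaled (fun v => L v * q1 (x - h n * v)) (h_pos n) x]
      refine integral_congr_ae (ae_of_all _ fun u => ?_)
      have : x - h n * ((x - u) / h n) = u := by have := (h_pos n).ne'; field_simp; ring
      simp only [this]; ring
    simp_rw [heq]
    rw [← integral_const_mul]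
    refine tendsto_integral_of_dominated_convergence (fun v => L v * k) (fun n => ?_)
      (hLi.mul_const _) (fun n => ae_of_all _ fun v => ?_) (ae_of_all _ fun v => ?_)
    · exact (hLm.mul (hq1m.comp (by fun_prop))).aestronglyMeasurable
    · rw [Real.norm_eq_abs, abs_mul, abs_of_nonneg (hL0 v)]
      exact mul_le_mul_of_nonneg_left (hq1b _) (hL0 v)
    · rw [mul_comm, ← hq1x]
      refine tendsto_const_nhds.mul (hq1c.tendsto.comp ?_)
      have : Tendsto (fun n => x - h n * v) atTop (𝓝 (x - 0 * v)) :=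
        tendsto_const_nhds.sub (h_zero.mul_const v)
      simpa using this
  obtain ⟨N1, hN1⟩ := Metric.tendsto_atTop.1 hlim1 (ε / 2) (half_pos hε)
  obtain ⟨N2, hN2⟩ := eventually_atTop.1 (h_zero.eventually_le_const hδ)
  refine ⟨max N1 N2, fun n hn => ?_⟩
  have hn1 := hN1 n (le_of_max_le_left hn)
  have hn2 := hN2 n (le_of_max_le_right hn)
  have hi1 : Integrable fun u => (h n)⁻¹ * L ((x - u) / h n) * q1 u :=
    integrable_rescaled_mul hLm hL0 hLi hLB hq1m (hq.sub hq2i) (fun u _ => hq1b u) (h_pos n) hn2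
  have hi2 : Integrable fun u => (h n)⁻¹ * L ((x - u) / h n) * q2 u :=
    integrable_rescaled_mul (M := 0) hLm hL0 hLi hLB hq2m hq2i
      (fun u hu => by simp [hq2near u hu]) (h_pos n) hn2
  have hsplit : ∫ u, (h n)⁻¹ * L ((x - u) / h n) * q u =
      (∫ u, (h n)⁻¹ * L ((x - u) / h n) * q1 u) + ∫ u, (h n)⁻¹ * L ((x - u) / h n) * q2 u := by
    rw [← integral_add hi1 hi2]
    refine integral_congr_ae (ae_of_all _ fun u => ?_)
    simp only [hq1]; ring
  -- `q2` lives at distance at least `δ` from `x`, where the rescaled kernel is at most `B / δ`.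
  have hbound : |∫ u, (h n)⁻¹ * L ((x - u) / h n) * q2 u| < ε / 2 := by
    refine lt_of_le_of_lt ?_ hk1
    rw [← integral_const_mul, ← Real.norm_eq_abs]
    refine norm_integral_le_of_norm_le ((hq.abs.indicator hset).const_mul (B / δ))
      (ae_of_all _ fun u => ?_)
    have hw : 0 ≤ (h n)⁻¹ * L ((x - u) / h n) :=
      mul_nonneg (inv_nonneg.2 (h_pos n).le) (hL0 _)
    have hq2abs : |q2 u| = {u | (k : ℝ) < |q u|}.indicator (fun u => |q u|) u := by
      by_cases hu : (k : ℝ) < |q u| <;> simp [hq2, Set.indicator, hu]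
    rw [Real.norm_eq_abs, abs_mul, abs_of_nonneg hw, ← hq2abs]
    by_cases hu : |u - x| < δ
    · simp [hq2near u hu]
    · refine mul_le_mul_of_nonneg_right ?_ (abs_nonneg _)
      exact rescaled_le_of_far hL0 hLB (h_pos n) hn2 (by rw [abs_sub_comm]; exact not_lt.1 hu)
  rw [Real.dist_eq] at hn1 ⊢
  rw [hsplit]
  calc _ = |(∫ u, (h n)⁻¹ * L ((x - u) / h n) * q1 u) - q x * (∫ u, L u) +
        ∫ u, (h n)⁻¹ * L ((x - u) / h n) * q2 u| := by congr 1; ring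
    _ ≤ _ := abs_add_le _ _
    _ < ε := by linarith

end ApproximateIdentity

/-! ### Second order Taylor expansion with Peano remainder. -/

section Taylor

theorem taylor_two_isLittleO {q : ℝ → ℝ} {x : ℝ} (hq : ContDiffAt ℝ 2 q x) :
    (fun u => q u - q x - deriv q x * (u - x) - deriv (deriv q) x / 2 * (u - x) ^ 2)
      =o[𝓝 x] fun u => (u - x) ^ 2 := by
  obtain ⟨s, hs, hqs⟩ := hq.contDiffOn le_rfl (by simp)
  obtain ⟨δ, hδ, hball⟩ := Metric.mem_nhds_iff.1 hs
  have h1 := taylor_isLittleO (n := 2) (convex_ball x δ) (Metric.mem_ball_self hδ)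
    (hqs.mono hball)
  rw [Metric.isOpen_ball.nhdsWithin_eq (Metric.mem_ball_self hδ)] at h1
  refine h1.congr_left fun u => ?_
  rw [taylorWithinEval_succ, taylorWithinEval_succ, taylor_within_zero_eval,
    iteratedDerivWithin_of_isOpen Metric.isOpen_ball (Metric.mem_ball_self hδ),
    iteratedDerivWithin_of_isOpen Metric.isOpen_ball (Metric.mem_ball_self hδ),
    iteratedDeriv_one, iteratedDeriv_succ, iteratedDeriv_one]
  simp
  ring

theorem deriv_sub_const_mul_eventuallyEq {m f : ℝ → ℝ} {x : ℝ} (hm : ContDiffAt ℝ 2 m x)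
    (hf : ContDiffAt ℝ 2 f x) :
    deriv (fun u => (m u - m x) * f u) =ᶠ[𝓝 x]
      fun u => deriv m u * f u + (m u - m x) * deriv f u := by
  filter_upwards [hm.eventually (by simp), hf.eventually (by simp)] with u hu hv
  have h1 := (hu.differentiableAt (by simp)).hasDerivAt
  have h2 := (hv.differentiableAt (by simp)).hasDerivAt
  exact ((h1.sub_const (m x)).mul h2).deriv

/-- The Leibniz term with the second derivative of `f` carries the factor `m x - m x`, which is why
`f''` is absent from the bias. -/
theorem deriv_deriv_sub_const_mul {m f : ℝ → ℝ} {x : ℝ} (hm : ContDiffAt ℝ 2 m x)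
    (hf : ContDiffAt ℝ 2 f x) :
    deriv (deriv fun u => (m u - m x) * f u) x =
      deriv (deriv m) x * f x + 2 * deriv m x * deriv f x := by
  rw [(deriv_sub_const_mul_eventuallyEq hm hf).deriv_eq]
  have h1 := (hm.differentiableAt (by simp)).hasDerivAt
  have h2 := (hf.differentiableAt (by simp)).hasDerivAt
  have h3 := ((hm.derivWithin (m := 1) (by norm_num)).differentiableAt (by simp)).hasDerivAt
  have h4 := ((hf.derivWithin (m := 1) (by norm_num)).differentiableAt (by simp)).hasDerivAt
  have := ((h3.mul h2).add ((h1.sub_const (m x)).mul h4)).deriv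
  refine this.trans ?_
  ring

end Taylor

/-! ### The second order expansion of kernel smooths. -/

section Kernel

variable {K : ℝ → ℝ}

theorem IsSmoothingKernel.integrable (hK : IsSmoothingKernel K) : Integrable K := by
  by_contra h
  have := hK.integral_eq_one
  rw [integral_undef h] at this
  exact zero_ne_one this

theorem kernelWeight_nonneg (hK : IsSmoothingKernel K) {h : ℝ} (hh : 0 < h) (x u : ℝ) :
    0 ≤ kernelWeight K h x u :=
  mul_nonneg (inv_nonneg.2 hh.le) (hK.nonneg _)

theorem measurable_kernelWeight (hK : IsSmoothingKernel K) (h x : ℝ) :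
    Measurable (kernelWeight K h x) := by
  have := hK.measurable
  unfold kernelWeight
  fun_prop

theorem IsSmoothingKernel.exists_tail (hK : IsSmoothingKernel K) :
    ∃ B : ℝ, 0 ≤ B ∧ ∀ u, |u| ^ 3 * K u ≤ B := by
  obtain ⟨B, hB⟩ := hK.tail
  exact ⟨B, by simpa using hB 0, hB⟩

theorem IsSmoothingKernel.abs_mul_le (hK : IsSmoothingKernel K) {B : ℝ}
    (hB : ∀ u, |u| ^ 3 * K u ≤ B) (u : ℝ) (hu : 1 ≤ |u|) : |u| * K u ≤ B := by
  refine le_trans ?_ (hB u)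
  exact mul_le_mul_of_nonneg_right (le_self_pow₀ hu (by norm_num)) (hK.nonneg u)

/-- The first moment of the weights over a symmetric neighbourhood vanishes. -/
theorem integral_kernelWeight_mul_indicator (hK : IsSmoothingKernel K) (h x δ : ℝ) :
    ∫ u, kernelWeight K h x u * {u | |u - x| < δ}.indicator (fun u => u - x) u = 0 := by
  -- Reflection `u ↦ 2 x - u` preserves the weight and the neighbourhood and changes the sign of `u
  -- - x`.
  have h1 := integral_sub_left_eq_self
    (fun u => kernelWeight K h x u * {u | |u - x| < δ}.indicator (fun u => u - x) u) volume (2 * x)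
  have h2 : ∀ u, kernelWeight K h x (2 * x - u) *
      {u | |u - x| < δ}.indicator (fun u => u - x) (2 * x - u) =
      -(kernelWeight K h x u * {u | |u - x| < δ}.indicator (fun u => u - x) u) := fun u => by
    have h3 : kernelWeight K h x (2 * x - u) = kernelWeight K h x u := by
      unfold kernelWeight
      rw [← hK.symm ((x - u) / h)]
      congr 2; ring
    have h4 : |2 * x - u - x| = |u - x| := by rw [abs_sub_comm]; congr 1; ring
    rw [h3]
    by_cases hu : |u - x| < δ
    · simp only [Set.indicator, Set.mem_ofPred_eq, h4, hu, if_true]; ring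
    · simp [Set.indicator, h4, hu]
  simp_rw [h2, integral_neg] at h1
  linarith

/-- The second order expansion of kernel smooths of a function vanishing at `x`. -/
theorem tendsto_integral_kernelWeight_mul_div_sq (hK : IsSmoothingKernel K) {q : ℝ → ℝ} {x : ℝ}
    {h : ℕ → ℝ} (hqm : Measurable q) (hqi : Integrable q) (hq : ContDiffAt ℝ 2 q x) (hq0 : q x = 0)
    (h_pos : ∀ n, 0 < h n) (h_zero : Tendsto h atTop (𝓝 0)) :
    Tendsto (fun n => (∫ u, kernelWeight K (h n) x u * q u) / h n ^ 2) atTop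
      (𝓝 (deriv (deriv q) x / 2 * kernelSecondMoment K)) := by
  obtain ⟨B, hB0, hB⟩ := hK.exists_tail
  set b := deriv q x
  set b2 := deriv (deriv q) x / 2
  have hT := taylor_two_isLittleO hq
  simp only [hq0, sub_zero] at hT
  set r : ℝ → ℝ := fun u => q u - b * (u - x) - b2 * (u - x) ^ 2 with hr
  have hr2 : Tendsto (fun u => r u / (u - x) ^ 2) (𝓝 x) (𝓝 0) := hT.tendsto_div_nhds_zero
  set s : Set ℝ := {u | |u - x| < 1} with hs
  have hsm : MeasurableSet s := measurableSet_lt (by fun_prop) measurable_const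
  -- Cutting the linear Taylor term off at distance 1 leaves its kernel integral zero by symmetry
  -- and makes `φ` below integrable; uncut, the quotient `(u - x) / (u - x) ^ 2` would decay only
  -- like `1 / |u|`.
  set ℓ : ℝ → ℝ := s.indicator (fun u => u - x) with hℓ
  have hℓm : Measurable ℓ := Measurable.indicator (by fun_prop) hsm
  -- Now `q - b ℓ = (u - x)² φ` off `x`, and the value `b2` at `x` makes `φ` continuous there. The
  -- expansion becomes an approximate identity for `φ` with the kernel `u² K(u)`.
  set φ : ℝ → ℝ := fun u => if u = x then b2 else (q u - b * ℓ u) / (u - x) ^ 2 with hφ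
  have hφm : Measurable φ := Measurable.ite (measurableSet_singleton x) measurable_const (by fun_prop)
  have hsx : s ∈ 𝓝 x := Metric.ball_mem_nhds x one_pos
  have hφx : φ x = b2 := by simp [hφ]
  have hφeq : ∀ u ∈ s, φ u = b2 + r u / (u - x) ^ 2 := fun u hu => by
    by_cases hux : u = x
    · simp [hφ, hux]
    · have : (u - x) ^ 2 ≠ 0 := pow_ne_zero _ (sub_ne_zero.2 hux)
      simp only [hφ, hux, if_false, hr, hℓ, Set.indicator_of_mem hu]
      field_simp; ring
  have hφc : ContinuousAt φ x := by
    have h1 : Tendsto (fun u => b2 + r u / (u - x) ^ 2) (𝓝 x) (𝓝 (φ x)) := by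
      rw [hφx]; simpa using hr2.const_add b2
    refine h1.congr' ?_
    filter_upwards [hsx] with u hu using (hφeq u hu).symm
  have hφi : Integrable φ := by
    obtain ⟨δ, hδ, hδφ⟩ := Metric.continuousAt_iff.1 hφc 1 one_pos
    have hnear : IntegrableOn φ (Metric.ball x δ) := by
      refine Measure.integrableOn_of_bounded (M := |φ x| + 1) measure_ball_lt_top.ne hφm.aestronglyMeasurable
        ?_
      filter_upwards [ae_restrict_mem measurableSet_ball] with u hu
      have h1 := hδφ hu
      rw [Real.dist_eq] at h1
      have := abs_sub_abs_le_abs_sub (φ u) (φ x)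
      rw [Real.norm_eq_abs]; linarith
    have hℓi : Integrable ℓ := by
      have : IntegrableOn (fun u : ℝ => u - x) s := by
        refine Measure.integrableOn_of_bounded (M := 1) ?_
          (by fun_prop : Measurable fun u : ℝ => u - x).aestronglyMeasurable ?_
        · have : s = Metric.ball x 1 := rfl
          simp [this]
        · filter_upwards [ae_restrict_mem hsm] with u hu
          exact le_of_lt hu
      exact this.integrable_indicator hsm
    have hfar : IntegrableOn φ (Metric.ball x δ)ᶜ := by
      have h2 : Integrable fun u => (|q u| + |b| * |ℓ u|) / δ ^ 2 :=
        (hqi.abs.add (hℓi.abs.const_mul _)).div_const _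
      refine h2.integrableOn.mono' hφm.aestronglyMeasurable ?_
      filter_upwards [ae_restrict_mem measurableSet_ball.compl] with u hu
      have hu' : δ ≤ |u - x| := by simpa [Real.dist_eq] using hu
      have hux : u ≠ x := fun h => by simp [h] at hu'; linarith
      simp only [hφ, hux, if_false]
      rw [Real.norm_eq_abs, abs_div, abs_of_nonneg (sq_nonneg (u - x)), ← sq_abs (u - x)]
      have : |q u - b * ℓ u| ≤ |q u| + |b| * |ℓ u| := by
        rw [← abs_mul]; exact abs_sub _ _
      gcongr
    rw [← integrableOn_univ, ← Set.union_compl_self (Metric.ball x δ)]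
    exact hnear.union hfar
  -- Boundedness of `|u|³ K(u)` is exactly the `1 / |u|` tail required of `u² K(u)`.
  have hmain := tendsto_integral_rescaled_mul (L := fun u => u ^ 2 * K u) (B := B)
    (by have := hK.measurable; fun_prop) (fun u => mul_nonneg (sq_nonneg u) (hK.nonneg u))
    hK.integrable_sq_mul
    (fun u _ => by
      have := hB u
      calc |u| * (u ^ 2 * K u) = |u| ^ 3 * K u := by rw [← sq_abs]; ring
        _ ≤ B := this) hφm hφi hφc h_pos h_zero
  rw [hφx] at hmain
  refine hmain.congr' ?_
  filter_upwards [eventually_integrable_rescaled_mul hK.measurable hK.nonneg hK.integrable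
    (hK.abs_mul_le hB) hqm hqi hq.continuousAt h_pos h_zero] with n hint
  have hh := (h_pos n).ne'
  have hℓint : Integrable fun u => kernelWeight K (h n) x u * (b * ℓ u) := by
    have h1 := (integrable_rescaled hK.integrable (h_pos n) x)
    refine (h1.mul_const |b|).mono'
      ((measurable_kernelWeight hK _ _).mul (by fun_prop)).aestronglyMeasurable
      (ae_of_all _ fun u => ?_)
    rw [Real.norm_eq_abs, abs_mul, abs_of_nonneg (kernelWeight_nonneg hK (h_pos n) x u), abs_mul]
    have hl : |ℓ u| ≤ 1 := by
      by_cases hu : u ∈ s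
      · rw [hℓ, Set.indicator_of_mem hu]; exact le_of_lt hu
      · rw [hℓ, Set.indicator_of_notMem hu]; simp
    have h2 := kernelWeight_nonneg hK (h_pos n) x u
    exact mul_le_mul_of_nonneg_left (mul_le_of_le_one_right (abs_nonneg b) hl) h2
  have hzero : ∫ u, kernelWeight K (h n) x u * (b * ℓ u) = 0 := by
    have := integral_kernelWeight_mul_indicator hK (h n) x 1
    simp_rw [mul_left_comm _ b, integral_const_mul]
    rw [this, mul_zero]
  change Integrable fun u => kernelWeight K (h n) x u * q u at hint
  rw [← sub_zero (∫ u, kernelWeight K (h n) x u * q u), ← hzero, ← integral_sub hint hℓint,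
    ← integral_div]
  refine integral_congr_ae ?_
  have hne : ∀ᵐ u : ℝ, u ≠ x := by simp [ae_iff]
  filter_upwards [hne] with u hu
  have : u - x ≠ 0 := sub_ne_zero.2 hu
  simp only [hφ, hu, if_false, kernelWeight]
  rw [div_pow, ← neg_sub u x, neg_sq]
  field_simp

end Kernel

/-! ### Moments of a regression law in terms of the density, the regression function and the
conditional variance. -/

section Law

variable {ν : Measure (ℝ × ℝ)} {m f σ2 : ℝ → ℝ}

theorem covariateSigma_le : covariateSigma ≤ (inferInstance : MeasurableSpace (ℝ × ℝ)) :=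
  measurable_fst.comap_le

theorem measurable_covariateSigma_comp_fst {φ : ℝ → ℝ} (hφ : Measurable φ) :
    Measurable[covariateSigma] fun p : ℝ × ℝ => φ p.1 :=
  hφ.comp (comap_measurable Prod.fst)

/-- The regression error `ε = Y - m(X)`. -/
def regressionError (m : ℝ → ℝ) (p : ℝ × ℝ) : ℝ := p.2 - m p.1

theorem IsRegressionLaw.measurable_error (hν : IsRegressionLaw ν m f σ2) :
    Measurable (regressionError m) := by
  have := hν.measurable_m
  unfold regressionError
  fun_prop

theorem IsRegressionLaw.integral_fst (hν : IsRegressionLaw ν m f σ2) {φ : ℝ → ℝ}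
    (hφ : Measurable φ) : ∫ p, φ p.1 ∂ν = ∫ u, φ u * f u := by
  rw [← integral_map (φ := Prod.fst) measurable_fst.aemeasurable
    (hφ.aestronglyMeasurable), hν.map_fst,
    integral_withDensity_eq_integral_toReal_smul hν.measurable_f.ennreal_ofReal (by simp)]
  refine integral_congr_ae (ae_of_all _ fun u => ?_)
  simp [ENNReal.toReal_ofReal (hν.f_nonneg u), mul_comm]

theorem IsRegressionLaw.integrable_fst_iff (hν : IsRegressionLaw ν m f σ2) {φ : ℝ → ℝ}
    (hφ : Measurable φ) : Integrable (fun p => φ p.1) ν ↔ Integrable fun u => φ u * f u := by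
  have h1 := integrable_map_measure (μ := ν) (f := Prod.fst) (g := φ)
    hφ.aestronglyMeasurable measurable_fst.aemeasurable
  change Integrable (φ ∘ Prod.fst) ν ↔ _
  rw [← h1, hν.map_fst, integrable_withDensity_iff_integrable_smul'
    hν.measurable_f.ennreal_ofReal (by simp)]
  refine integrable_congr (ae_of_all _ fun u => ?_)
  simp [ENNReal.toReal_ofReal (hν.f_nonneg u), mul_comm]

theorem IsRegressionLaw.condExp_error_sq (hν : IsRegressionLaw ν m f σ2) :
    ν[fun p => regressionError m p ^ 2 | covariateSigma] =ᵐ[ν] fun p => σ2 p.1 := by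
  refine EventuallyEq.trans ?_ hν.condVar_snd
  refine condExp_congr_ae ?_
  filter_upwards [hν.condExp_snd] with p hp
  simp [hp, regressionError]

variable [IsProbabilityMeasure ν]

theorem IsRegressionLaw.integrable_density (hν : IsRegressionLaw ν m f σ2) : Integrable f := by
  have := (hν.integrable_fst_iff (φ := fun _ => 1) measurable_const).1 (integrable_const _)
  simpa using this

theorem IsRegressionLaw.memLp_regression (hν : IsRegressionLaw ν m f σ2) :
    MemLp (fun p : ℝ × ℝ => m p.1) 2 ν :=
  (memLp_congr_ae hν.condExp_snd).1 (MemLp.condExp one_le_two hν.memLp_snd)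

theorem IsRegressionLaw.memLp_error (hν : IsRegressionLaw ν m f σ2) :
    MemLp (regressionError m) 2 ν :=
  hν.memLp_snd.sub hν.memLp_regression

theorem IsRegressionLaw.integrable_error_sq (hν : IsRegressionLaw ν m f σ2) :
    Integrable (fun p => regressionError m p ^ 2) ν := hν.memLp_error.integrable_sq

theorem IsRegressionLaw.condExp_error (hν : IsRegressionLaw ν m f σ2) :
    ν[regressionError m | covariateSigma] =ᵐ[ν] 0 := by
  have h1 : Integrable (fun p : ℝ × ℝ => p.2) ν := hν.memLp_snd.integrable one_le_two
  have h2 : Integrable (fun p : ℝ × ℝ => m p.1) ν := hν.memLp_regression.integrable one_le_two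
  have h3 := condExp_sub h1 h2 covariateSigma
  have h4 := condExp_of_stronglyMeasurable covariateSigma_le
    (measurable_covariateSigma_comp_fst hν.measurable_m).stronglyMeasurable h2
  filter_upwards [h3, hν.condExp_snd] with p hp1 hp2
  have hp1' : (ν[regressionError m | covariateSigma]) p = _ := hp1
  rw [hp1', Pi.sub_apply, hp2, h4]
  simp

/-- Errors are centered given the covariate. -/
theorem IsRegressionLaw.integral_error_mul (hν : IsRegressionLaw ν m f σ2) {φ : ℝ → ℝ}
    (hφ : Measurable φ) (hi : Integrable (fun p => φ p.1 * regressionError m p) ν) :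
    ∫ p, φ p.1 * regressionError m p ∂ν = 0 := by
  have h1 := condExp_mul_of_stronglyMeasurable_left (m := covariateSigma)
    (measurable_covariateSigma_comp_fst hφ).stronglyMeasurable hi
    (hν.memLp_error.integrable one_le_two)
  have h2 := integral_condExp (μ := ν) covariateSigma_le
    (f := fun p : ℝ × ℝ => φ p.1 * regressionError m p)
  rw [← h2]
  refine integral_eq_zero_of_ae ?_
  filter_upwards [h1, hν.condExp_error] with p hp1 hp2
  refine hp1.trans ?_
  simp [hp2]

theorem IsRegressionLaw.integrable_variance (hν : IsRegressionLaw ν m f σ2) :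
    Integrable (fun p => σ2 p.1) ν :=
  integrable_condExp.congr hν.condExp_error_sq

theorem IsRegressionLaw.variance_nonneg_ae (hν : IsRegressionLaw ν m f σ2) :
    ∀ᵐ p ∂ν, 0 ≤ σ2 p.1 := by
  have h1 : 0 ≤ᵐ[ν] ν[fun p => regressionError m p ^ 2 | covariateSigma] :=
    condExp_nonneg (ae_of_all _ fun p => sq_nonneg _)
  filter_upwards [h1, hν.condExp_error_sq] with p hp1 hp2
  rwa [hp2] at hp1

/-- By the definition of conditional expectation, `ε² ν` and `σ²(X) ν` agree on events of the
covariate. Stated as an equality of measures, this transfers integrals and integrability for every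
measurable `φ(X)`, without knowing beforehand that `φ(X) ε²` is integrable. -/
theorem IsRegressionLaw.map_withDensity_error_sq (hν : IsRegressionLaw ν m f σ2) :
    (ν.withDensity fun p => ENNReal.ofReal (regressionError m p ^ 2)).map Prod.fst =
      (ν.withDensity fun p => ENNReal.ofReal (σ2 p.1)).map Prod.fst := by
  ext A hA
  rw [Measure.map_apply measurable_fst hA, Measure.map_apply measurable_fst hA,
    withDensity_apply _ (measurable_fst hA), withDensity_apply _ (measurable_fst hA),
    ← ofReal_integral_eq_lintegral_ofReal hν.integrable_error_sq.integrableOn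
      (ae_of_all _ fun p => sq_nonneg _),
    ← ofReal_integral_eq_lintegral_ofReal hν.integrable_variance.integrableOn
      (ae_restrict_of_ae hν.variance_nonneg_ae),
    ← setIntegral_condExp covariateSigma_le hν.integrable_error_sq ⟨A, hA, rfl⟩]
  congr 1
  exact integral_congr_ae (ae_restrict_of_ae hν.condExp_error_sq)

theorem IsRegressionLaw.integral_mul_error_sq (hν : IsRegressionLaw ν m f σ2) {φ : ℝ → ℝ}
    (hφ : Measurable φ) :
    ∫ p, φ p.1 * regressionError m p ^ 2 ∂ν = ∫ u, φ u * (σ2 u * f u) := by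
  have hE := hν.measurable_error
  have hS := hν.measurable_σ2
  have h1 : ∀ g : ℝ × ℝ → ℝ, Measurable g → (∀ᵐ p ∂ν, 0 ≤ g p) → ∫ p, φ p.1 * g p ∂ν =
      ∫ u, φ u ∂((ν.withDensity fun p => ENNReal.ofReal (g p)).map Prod.fst) := fun g hg hg0 => by
    rw [integral_map measurable_fst.aemeasurable hφ.aestronglyMeasurable,
      integral_withDensity_eq_integral_toReal_smul hg.ennreal_ofReal (by simp)]
    refine integral_congr_ae ?_
    filter_upwards [hg0] with p hp
    simp [ENNReal.toReal_ofReal hp, mul_comm]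
  rw [h1 _ (by fun_prop) (ae_of_all _ fun p => sq_nonneg _), hν.map_withDensity_error_sq,
    ← h1 (fun p => σ2 p.1) (by fun_prop) hν.variance_nonneg_ae,
    hν.integral_fst (φ := fun u => φ u * σ2 u) (by fun_prop)]
  simp_rw [mul_assoc]

theorem IsRegressionLaw.integrable_mul_error_sq_iff (hν : IsRegressionLaw ν m f σ2) {φ : ℝ → ℝ}
    (hφ : Measurable φ) :
    Integrable (fun p => φ p.1 * regressionError m p ^ 2) ν ↔
      Integrable fun u => φ u * (σ2 u * f u) := by
  have hE := hν.measurable_error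
  have hS := hν.measurable_σ2
  have h1 : ∀ g : ℝ × ℝ → ℝ, Measurable g → (∀ᵐ p ∂ν, 0 ≤ g p) →
      (Integrable (fun p => φ p.1 * g p) ν ↔
      Integrable φ ((ν.withDensity fun p => ENNReal.ofReal (g p)).map Prod.fst)) :=
    fun g hg hg0 => by
      rw [integrable_map_measure hφ.aestronglyMeasurable measurable_fst.aemeasurable,
        integrable_withDensity_iff_integrable_smul' hg.ennreal_ofReal (by simp)]
      refine integrable_congr ?_
      filter_upwards [hg0] with p hp
      simp [ENNReal.toReal_ofReal hp, mul_comm]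
  rw [h1 _ (by fun_prop) (ae_of_all _ fun p => sq_nonneg _), hν.map_withDensity_error_sq,
    ← h1 (fun p => σ2 p.1) (by fun_prop) hν.variance_nonneg_ae,
    hν.integrable_fst_iff (φ := fun u => φ u * σ2 u) (by fun_prop)]
  simp_rw [mul_assoc]

end Law

/-- A regression law that is regular at the interior point `x`, a kernel, and bandwidths tending
to zero. -/
structure IsRegularDesign (ν : Measure (ℝ × ℝ)) (K m f σ2 : ℝ → ℝ) (h : ℕ → ℝ) (x : ℝ) :
    Prop where
  law : IsRegressionLaw ν m f σ2
  kernel : IsSmoothingKernel K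
  h_pos : ∀ n, 0 < h n
  h_zero : Tendsto h atTop (𝓝 0)
  contDiffAt_m : ContDiffAt ℝ 2 m x
  contDiffAt_f : ContDiffAt ℝ 2 f x
  f_pos : 0 < f x
  continuousAt_σ2 : ContinuousAt σ2 x
  errors : LocallyUniformlyIntegrableErrors ν m x

/-! ### Limits of kernel weighted moments, and the Lindeberg condition. -/

section Moments

variable {ν : Measure (ℝ × ℝ)} {K m f σ2 : ℝ → ℝ} {h : ℕ → ℝ} {x : ℝ}

theorem IsSmoothingKernel.abs_mul_sq_le (hK : IsSmoothingKernel K) {B : ℝ}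
    (hB : ∀ u, |u| ^ 3 * K u ≤ B) (u : ℝ) (hu : 1 ≤ |u|) : |u| * K u ^ 2 ≤ B ^ 2 := by
  have h0 : 0 ≤ |u| ^ 3 * K u := mul_nonneg (by positivity) (hK.nonneg u)
  calc |u| * K u ^ 2 ≤ |u| ^ 6 * K u ^ 2 :=
        mul_le_mul_of_nonneg_right (le_self_pow₀ hu (by norm_num)) (sq_nonneg _)
    _ = (|u| ^ 3 * K u) ^ 2 := by ring
    _ ≤ B ^ 2 := pow_le_pow_left₀ h0 (hB u) 2

/-- The cubic tail gives a factor `h³`, of which the normalization `h⁻¹` consumes one power. The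
remaining `h²` makes waypoints, and all observations far from `x`, negligible. -/
theorem kernelWeight_le_of_far (hK : IsSmoothingKernel K) {B δ b u : ℝ}
    (hB : ∀ u, |u| ^ 3 * K u ≤ B) (hb : 0 < b) (hδ : 0 < δ) (hu : δ ≤ |x - u|) :
    kernelWeight K b x u ≤ b ^ 2 * (B / δ ^ 3) := by
  have h1 := hB ((x - u) / b)
  rw [abs_div, abs_of_pos hb, div_pow] at h1
  have h2 : δ ^ 3 * K ((x - u) / b) ≤ |x - u| ^ 3 * K ((x - u) / b) := by
    have := hK.nonneg ((x - u) / b)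
    gcongr
  have h3 : δ ^ 3 * K ((x - u) / b) ≤ B * b ^ 3 := by
    rw [div_mul_eq_mul_div, div_le_iff₀ (by positivity)] at h1
    linarith
  unfold kernelWeight
  rw [← div_eq_inv_mul, div_le_iff₀ hb, mul_div_assoc', div_mul_eq_mul_div,
    le_div_iff₀ (by positivity)]
  nlinarith

variable [IsProbabilityMeasure ν]

namespace IsRegularDesign

/-- One factor `h` turns `h⁻² L` into the approximate identity `h⁻¹ L`. The kernel `L` is either
`K²` or its part on large values of `K`; both inherit the tail of `K²`. -/
theorem tendsto_mul_integral_sq_aux (H : IsRegularDesign ν K m f σ2 h x) {L q : ℝ → ℝ}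
    (hLm : Measurable L) (hL0 : ∀ u, 0 ≤ L u) (hLK : ∀ u, L u ≤ K u ^ 2) (hqm : Measurable q)
    (hq : Integrable q) (hqx : ContinuousAt q x) :
    Tendsto (fun n => h n * ∫ u, (h n)⁻¹ ^ 2 * L ((x - u) / h n) * q u) atTop
      (𝓝 (q x * ∫ u, L u)) ∧
    ∀ᶠ n in atTop, Integrable fun u => (h n)⁻¹ ^ 2 * L ((x - u) / h n) * q u := by
  obtain ⟨B, -, hB⟩ := H.kernel.exists_tail
  have hLi : Integrable L := H.kernel.integrable_sq.mono' hLm.aestronglyMeasurable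
    (ae_of_all _ fun u => by rw [Real.norm_eq_abs, abs_of_nonneg (hL0 u)]; exact hLK u)
  have hLB : ∀ u, 1 ≤ |u| → |u| * L u ≤ B ^ 2 := fun u hu =>
    (mul_le_mul_of_nonneg_left (hLK u) (abs_nonneg u)).trans (H.kernel.abs_mul_sq_le hB u hu)
  constructor
  · refine (tendsto_integral_rescaled_mul hLm hL0 hLi hLB hqm hq hqx H.h_pos H.h_zero).congr
      fun n => ?_
    rw [← integral_const_mul]
    refine integral_congr_ae (ae_of_all _ fun u => ?_)
    have := (H.h_pos n).ne'
    field_simp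
  · filter_upwards [eventually_integrable_rescaled_mul hLm hL0 hLi hLB hqm hq hqx H.h_pos
      H.h_zero] with n hn
    refine (hn.const_mul (h n)⁻¹).congr (ae_of_all _ fun u => ?_)
    ring

theorem measurable_weight (H : IsRegularDesign ν K m f σ2 h x) (n : ℕ) :
    Measurable (kernelWeight K (h n) x) := measurable_kernelWeight H.kernel _ _

theorem weight_nonneg (H : IsRegularDesign ν K m f σ2 h x) (n : ℕ) (u : ℝ) :
    0 ≤ kernelWeight K (h n) x u := kernelWeight_nonneg H.kernel (H.h_pos n) x u

theorem tendsto_integral_weight (H : IsRegularDesign ν K m f σ2 h x) :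
    Tendsto (fun n => ∫ p, kernelWeight K (h n) x p.1 ∂ν) atTop (𝓝 (f x)) := by
  obtain ⟨B, -, hB⟩ := H.kernel.exists_tail
  have h1 := tendsto_integral_rescaled_mul H.kernel.measurable H.kernel.nonneg H.kernel.integrable
    (H.kernel.abs_mul_le hB) H.law.measurable_f H.law.integrable_density
    H.contDiffAt_f.continuousAt H.h_pos H.h_zero
  rw [H.kernel.integral_eq_one, mul_one] at h1
  exact h1.congr fun n => (H.law.integral_fst (H.measurable_weight n)).symm

theorem tendsto_integral_weight_sq (H : IsRegularDesign ν K m f σ2 h x) :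
    Tendsto (fun n => h n * ∫ p, kernelWeight K (h n) x p.1 ^ 2 ∂ν) atTop
      (𝓝 (f x * kernelRoughness K)) := by
  refine (H.tendsto_mul_integral_sq_aux (H.kernel.measurable.pow_const 2) (fun u => sq_nonneg _)
    (fun u => le_rfl) H.law.measurable_f H.law.integrable_density
    H.contDiffAt_f.continuousAt).1.congr fun n => ?_
  rw [H.law.integral_fst (φ := fun u => kernelWeight K (h n) x u ^ 2)
    ((H.measurable_weight n).pow_const 2)]
  simp_rw [kernelWeight, mul_pow]

theorem eventually_memLp_weight (H : IsRegularDesign ν K m f σ2 h x) :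
    ∀ᶠ n in atTop, MemLp (fun p : ℝ × ℝ => kernelWeight K (h n) x p.1) 2 ν := by
  filter_upwards [(H.tendsto_mul_integral_sq_aux (H.kernel.measurable.pow_const 2)
    (fun u => sq_nonneg _) (fun u => le_rfl) H.law.measurable_f H.law.integrable_density
    H.contDiffAt_f.continuousAt).2] with n hn
  have := H.measurable_weight n
  rw [memLp_two_iff_integrable_sq (by fun_prop : Measurable _).aestronglyMeasurable,
    H.law.integrable_fst_iff (φ := fun u => kernelWeight K (h n) x u ^ 2)
    ((H.measurable_weight n).pow_const 2)]
  simpa only [kernelWeight, mul_pow] using hn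

theorem integrable_regression_sub_mul_density (H : IsRegularDesign ν K m f σ2 h x) :
    Integrable fun u => (m u - m x) * f u := by
  have hm := H.law.measurable_m
  rw [← H.law.integrable_fst_iff (φ := fun u => m u - m x) (by fun_prop)]
  exact (H.law.memLp_regression.integrable one_le_two).sub (integrable_const _)

theorem tendsto_integral_weight_mul_regression (H : IsRegularDesign ν K m f σ2 h x) :
    Tendsto (fun n => (∫ p, kernelWeight K (h n) x p.1 * (m p.1 - m x) ∂ν) / h n ^ 2) atTop
      (𝓝 ((deriv (deriv m) x * f x + 2 * deriv m x * deriv f x) / 2 *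
        kernelSecondMoment K)) := by
  have hm := H.law.measurable_m
  have hf := H.law.measurable_f
  have h1 := tendsto_integral_kernelWeight_mul_div_sq H.kernel (q := fun u => (m u - m x) * f u)
    (by fun_prop) H.integrable_regression_sub_mul_density
    ((H.contDiffAt_m.sub contDiffAt_const).mul H.contDiffAt_f) (by simp) H.h_pos H.h_zero
  rw [deriv_deriv_sub_const_mul H.contDiffAt_m H.contDiffAt_f] at h1
  refine h1.congr fun n => ?_
  have := H.measurable_weight n
  rw [H.law.integral_fst (φ := fun u => kernelWeight K (h n) x u * (m u - m x)) (by fun_prop)]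
  simp_rw [mul_assoc]

theorem integrable_regression_sub_sq_mul_density (H : IsRegularDesign ν K m f σ2 h x) :
    Integrable fun u => (m u - m x) ^ 2 * f u := by
  have hm := H.law.measurable_m
  rw [← H.law.integrable_fst_iff (φ := fun u => (m u - m x) ^ 2) (by fun_prop)]
  exact (H.law.memLp_regression.sub (memLp_const (m x))).integrable_sq

/-- The limit of such an integral is proportional to the value of `(m - m x)² f` at `x`, which is
zero. -/
theorem tendsto_integral_weight_mul_regression_sq (H : IsRegularDesign ν K m f σ2 h x) :
    Tendsto (fun n => h n * ∫ p, (kernelWeight K (h n) x p.1 * (m p.1 - m x)) ^ 2 ∂ν) atTop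
      (𝓝 0) ∧
    ∀ᶠ n in atTop, MemLp (fun p : ℝ × ℝ => kernelWeight K (h n) x p.1 * (m p.1 - m x)) 2 ν := by
  have hm := H.law.measurable_m
  have hf := H.law.measurable_f
  have hc : ContinuousAt (fun u => (m u - m x) ^ 2 * f u) x :=
    ((H.contDiffAt_m.continuousAt.sub continuousAt_const).pow 2).mul H.contDiffAt_f.continuousAt
  obtain ⟨h1, h2⟩ := H.tendsto_mul_integral_sq_aux (H.kernel.measurable.pow_const 2)
    (fun u => sq_nonneg _) (fun u => le_rfl) (q := fun u => (m u - m x) ^ 2 * f u)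
    (by fun_prop) H.integrable_regression_sub_sq_mul_density hc
  have h3 : ∀ n u, (h n)⁻¹ ^ 2 * K ((x - u) / h n) ^ 2 * ((m u - m x) ^ 2 * f u) =
      (kernelWeight K (h n) x u * (m u - m x)) ^ 2 * f u := fun n u => by
    simp only [kernelWeight]; ring
  simp only [h3] at h1 h2
  constructor
  · simp only [sub_self, ne_eq, OfNat.ofNat_ne_zero, not_false_eq_true, zero_pow, zero_mul] at h1
    refine h1.congr fun n => ?_
    have := H.measurable_weight n
    rw [H.law.integral_fst (φ := fun u => (kernelWeight K (h n) x u * (m u - m x)) ^ 2)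
      (by fun_prop)]
  · filter_upwards [h2] with n hn
    have := H.measurable_weight n
    rw [memLp_two_iff_integrable_sq (by fun_prop : Measurable _).aestronglyMeasurable,
      H.law.integrable_fst_iff (φ := fun u => (kernelWeight K (h n) x u * (m u - m x)) ^ 2)
      (by fun_prop)]
    exact hn

theorem integrable_variance_mul_density (H : IsRegularDesign ν K m f σ2 h x) :
    Integrable fun u => σ2 u * f u :=
  (H.law.integrable_fst_iff H.law.measurable_σ2).1 H.law.integrable_variance

theorem tendsto_integral_kernel_mul_error_sq (H : IsRegularDesign ν K m f σ2 h x) {L : ℝ → ℝ}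
    (hLm : Measurable L) (hL0 : ∀ u, 0 ≤ L u) (hLK : ∀ u, L u ≤ K u ^ 2) :
    Tendsto (fun n => h n * ∫ p, (h n)⁻¹ ^ 2 * L ((x - p.1) / h n) * regressionError m p ^ 2 ∂ν)
      atTop (𝓝 (σ2 x * f x * ∫ u, L u)) ∧
    ∀ᶠ n in atTop, Integrable
      (fun p => (h n)⁻¹ ^ 2 * L ((x - p.1) / h n) * regressionError m p ^ 2) ν := by
  have hs := H.law.measurable_σ2
  have hf := H.law.measurable_f
  obtain ⟨h1, h2⟩ := H.tendsto_mul_integral_sq_aux hLm hL0 hLK (q := fun u => σ2 u * f u)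
    (by fun_prop) H.integrable_variance_mul_density
    (H.continuousAt_σ2.mul H.contDiffAt_f.continuousAt)
  constructor
  · refine h1.congr fun n => ?_
    rw [H.law.integral_mul_error_sq (φ := fun u => (h n)⁻¹ ^ 2 * L ((x - u) / h n))
      (by fun_prop)]
  · filter_upwards [h2] with n hn
    rw [H.law.integrable_mul_error_sq_iff (φ := fun u => (h n)⁻¹ ^ 2 * L ((x - u) / h n))
      (by fun_prop)]
    exact hn

theorem tendsto_integral_weight_mul_error_sq (H : IsRegularDesign ν K m f σ2 h x) :
    Tendsto (fun n => h n * ∫ p, (kernelWeight K (h n) x p.1 * regressionError m p) ^ 2 ∂ν)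
      atTop (𝓝 (σ2 x * f x * kernelRoughness K)) ∧
    ∀ᶠ n in atTop,
      MemLp (fun p => kernelWeight K (h n) x p.1 * regressionError m p) 2 ν := by
  obtain ⟨h1, h2⟩ := H.tendsto_integral_kernel_mul_error_sq (H.kernel.measurable.pow_const 2)
    (fun u => sq_nonneg _) (fun u => le_rfl)
  have h3 : ∀ n (p : ℝ × ℝ), (h n)⁻¹ ^ 2 * K ((x - p.1) / h n) ^ 2 * regressionError m p ^ 2 =
      (kernelWeight K (h n) x p.1 * regressionError m p) ^ 2 := fun n u => by
    simp only [kernelWeight]; ring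
  simp only [h3] at h1 h2
  refine ⟨h1, ?_⟩
  filter_upwards [h2] with n hn
  have := H.measurable_weight n
  have := H.law.measurable_error
  rwa [memLp_two_iff_integrable_sq (by fun_prop : Measurable _).aestronglyMeasurable]

/-- Large kernel values do not contribute to the noise level. -/
theorem tendsto_integral_large_kernel (H : IsRegularDesign ν K m f σ2 h x) {s : ℕ → ℝ}
    (hs : Tendsto s atTop atTop) :
    Tendsto (fun n => h n * ∫ p, {p : ℝ × ℝ | s n < K ((x - p.1) / h n)}.indicator
      (fun p => (kernelWeight K (h n) x p.1 * regressionError m p) ^ 2) p ∂ν) atTop (𝓝 0) := by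
  have hKm := H.kernel.measurable
  have hE := H.law.measurable_error
  set L : ℝ → ℝ → ℝ := fun s => {u | s < K u}.indicator (fun u => K u ^ 2) with hL
  have hLm : ∀ s, Measurable (L s) := fun s =>
    (hKm.pow_const 2).indicator (measurableSet_lt measurable_const hKm)
  have hL0 : ∀ s u, 0 ≤ L s u := fun s u => Set.indicator_nonneg (fun u _ => sq_nonneg _) u
  have hLK : ∀ s u, L s u ≤ K u ^ 2 := fun s u =>
    Set.indicator_le_self' (fun u _ => sq_nonneg _) u
  have hsmall : Tendsto (fun k : ℕ => ∫ u, L k u) atTop (𝓝 (∫ _ : ℝ, (0 : ℝ))) := by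
    refine tendsto_integral_of_dominated_convergence (fun u => K u ^ 2)
      (fun k => (hLm k).aestronglyMeasurable) H.kernel.integrable_sq
      (fun k => ae_of_all _ fun u => ?_) (ae_of_all _ fun u => ?_)
    · rw [Real.norm_eq_abs, abs_of_nonneg (hL0 _ _)]; exact hLK _ _
    · refine tendsto_const_nhds.congr' ?_
      obtain ⟨k₀, hk₀⟩ := exists_nat_ge (K u)
      filter_upwards [eventually_ge_atTop k₀] with k hk
      have : ¬ (k : ℝ) < K u := not_lt.2 (hk₀.trans (by exact_mod_cast hk))
      simp [hL, this]
  rw [integral_zero] at hsmall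
  have hsmall' := hsmall.const_mul (σ2 x * f x)
  rw [mul_zero] at hsmall'
  rw [Metric.tendsto_nhds]
  intro ε hε
  -- A fixed level `k` already brings the limiting integral below `ε`, and eventually `s n ≥ k`.
  obtain ⟨k, hk⟩ := (hsmall'.eventually_lt_const hε).exists
  obtain ⟨h1, h2⟩ := H.tendsto_integral_kernel_mul_error_sq (hLm k) (hL0 k) (hLK k)
  filter_upwards [h1.eventually_lt_const hk, h2, hs.eventually_ge_atTop (k : ℝ)] with n hn hi hsn
  have hnn : 0 ≤ ∫ p, {p : ℝ × ℝ | s n < K ((x - p.1) / h n)}.indicator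
      (fun p => (kernelWeight K (h n) x p.1 * regressionError m p) ^ 2) p ∂ν :=
    integral_nonneg fun p => Set.indicator_nonneg (fun p _ => sq_nonneg _) p
  rw [Real.dist_eq, sub_zero, abs_of_nonneg (mul_nonneg (H.h_pos n).le hnn)]
  refine lt_of_le_of_lt (mul_le_mul_of_nonneg_left ?_ (H.h_pos n).le) hn
  refine integral_mono_of_nonneg
    (ae_of_all _ fun p => Set.indicator_nonneg (fun p _ => sq_nonneg _) p) hi
    (ae_of_all _ fun p => ?_)
  by_cases hp : s n < K ((x - p.1) / h n)
  · have hp' : (k : ℝ) < K ((x - p.1) / h n) := hsn.trans_lt hp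
    simp only [Set.indicator, Set.mem_ofPred_eq, hp, hp', if_true, hL, kernelWeight]
    apply le_of_eq; ring
  · simp only [Set.indicator, Set.mem_ofPred_eq, hp, if_false]
    exact mul_nonneg (mul_nonneg (sq_nonneg _) (hL0 _ _)) (sq_nonneg _)

/-- The second moments of the summands are asymptotically unaffected by replacing a sample average
with its leave-one-out version. -/
theorem tendsto_integral_weight_error_sq_mul_min (H : IsRegularDesign ν K m f σ2 h x)
    (h_top : Tendsto (fun n : ℕ => n * h n) atTop atTop) {c : ℝ} (hc : 0 < c) :
    Tendsto (fun n : ℕ => h n * ∫ p, (kernelWeight K (h n) x p.1 * regressionError m p) ^ 2 *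
      min (1 / c) (kernelWeight K (h n) x p.1 / n / c ^ 2) ^ 2 ∂ν) atTop (𝓝 0) := by
  have hKm := H.kernel.measurable
  have hE := H.law.measurable_error
  -- The kernel values are split at `√(n h)`: below this level the minimum is at most `1 / (c² √(n
  -- h))`, which tends to zero; above it the minimum is at most `1 / c` and large kernel values are
  -- negligible.
  have hs : Tendsto (fun n : ℕ => √(n * h n)) atTop atTop := Real.tendsto_sqrt_atTop.comp h_top
  obtain ⟨h1, h2⟩ := H.tendsto_integral_weight_mul_error_sq
  have h3 := H.tendsto_integral_large_kernel hs
  have h4 : Tendsto (fun n : ℕ => (1 / (c ^ 2 * √(n * h n))) ^ 2) atTop (𝓝 0) := by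
    have : Tendsto (fun n : ℕ => 1 / (c ^ 2 * √(n * h n))) atTop (𝓝 0) :=
      (hs.const_mul_atTop (by positivity)).const_div_atTop 1
    simpa using this.pow 2
  have h5 := (h4.mul h1).add (h3.const_mul ((1 / c) ^ 2))
  rw [zero_mul, mul_zero, add_zero] at h5
  refine squeeze_zero' (Eventually.of_forall fun n => mul_nonneg (H.h_pos n).le
    (integral_nonneg fun p => by positivity)) ?_ h5
  filter_upwards [h2, h_top.eventually_gt_atTop 0] with n hn hnh
  have hh := H.h_pos n
  have hn0 : (0 : ℝ) < n := pos_of_mul_pos_left hnh hh.le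
  have hw := H.measurable_weight n
  have hset : MeasurableSet {p : ℝ × ℝ | √(n * h n) < K ((x - p.1) / h n)} :=
    measurableSet_lt measurable_const (by fun_prop)
  have hi := hn.integrable_sq
  rw [mul_left_comm, mul_left_comm ((1 / c) ^ 2), ← mul_add]
  refine mul_le_mul_of_nonneg_left ?_ hh.le
  rw [← integral_const_mul, ← integral_const_mul,
    ← integral_add (hi.const_mul _) ((hi.indicator hset).const_mul _)]
  refine integral_mono_of_nonneg (ae_of_all _ fun p => by positivity)
    ((hi.const_mul _).add ((hi.indicator hset).const_mul _)) (ae_of_all _ fun p => ?_)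
  have hwn := H.weight_nonneg n p.1
  have hmin0 : 0 ≤ min (1 / c) (kernelWeight K (h n) x p.1 / n / c ^ 2) := by positivity
  by_cases hp : √(n * h n) < K ((x - p.1) / h n)
  · simp only [Set.indicator, Set.mem_ofPred_eq, hp, if_true]
    have := pow_le_pow_left₀ hmin0 (min_le_left _ _) 2
    nlinarith [mul_le_mul_of_nonneg_left this
      (sq_nonneg (kernelWeight K (h n) x p.1 * regressionError m p)),
      mul_nonneg (sq_nonneg (1 / (c ^ 2 * √(n * h n))))
      (sq_nonneg (kernelWeight K (h n) x p.1 * regressionError m p))]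
  · simp only [Set.indicator, Set.mem_ofPred_eq, hp, if_false, mul_zero, add_zero]
    have h6 : kernelWeight K (h n) x p.1 / n / c ^ 2 ≤ 1 / (c ^ 2 * √(n * h n)) := by
      have hsq : √(n * h n) * √(n * h n) = n * h n := Real.mul_self_sqrt hnh.le
      have hsp : 0 < √(n * h n) := Real.sqrt_pos.2 hnh
      calc kernelWeight K (h n) x p.1 / n / c ^ 2
          = K ((x - p.1) / h n) / (c ^ 2 * (n * h n)) := by
            rw [kernelWeight]; field_simp
        _ ≤ √(n * h n) / (c ^ 2 * (n * h n)) := by gcongr; exact not_lt.1 hp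
        _ = 1 / (c ^ 2 * √(n * h n)) := by
            rw [div_eq_div_iff (by positivity) (by positivity), one_mul, mul_left_comm, hsq]
    rw [mul_comm]
    exact mul_le_mul_of_nonneg_right (pow_le_pow_left₀ hmin0 ((min_le_right _ _).trans h6) 2)
      (sq_nonneg _)

/-- The Lindeberg condition for the kernel weighted errors. -/
theorem tendsto_integral_lindeberg (H : IsRegularDesign ν K m f σ2 h x) {s : ℕ → ℝ}
    (hs : Tendsto s atTop atTop) :
    Tendsto (fun n => h n * ∫ p,
      {p : ℝ × ℝ | s n < |h n * (kernelWeight K (h n) x p.1 * regressionError m p)|}.indicator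
      (fun p => (kernelWeight K (h n) x p.1 * regressionError m p) ^ 2) p ∂ν) atTop (𝓝 0) := by
  have hKm := H.kernel.measurable
  have hE := H.law.measurable_error
  have hR0 : 0 ≤ kernelRoughness K := integral_nonneg fun u => sq_nonneg _
  set Q := f x * kernelRoughness K + 1 with hQ
  have hQpos : 0 < Q := by have := H.f_pos; positivity
  rw [Metric.tendsto_nhds]
  intro ε hε
  -- `Q` exceeds the limit of `h E w²`, so this tail level costs at most `ε / 3`. The other two
  -- thirds pay for large kernel values and for covariates far from `x`.
  obtain ⟨M, δ, hδ, hM⟩ := H.errors (ε / (3 * Q)) (by positivity)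
  obtain ⟨B, hB0, hB⟩ := H.kernel.exists_tail
  set Z : ℝ × ℝ → ℝ := {q : ℝ × ℝ | M < |q.2 - m q.1|}.indicator
    (fun q => (q.2 - m q.1) ^ 2) with hZ
  have hEset : MeasurableSet {q : ℝ × ℝ | M < |q.2 - m q.1|} :=
    measurableSet_lt measurable_const hE.abs
  have hZi : Integrable Z ν := H.law.integrable_error_sq.indicator hEset
  have hZ0 : ∀ p, 0 ≤ Z p := fun p => Set.indicator_nonneg (fun p _ => sq_nonneg _) p
  have hZE : ∀ p, Z p ≤ regressionError m p ^ 2 := fun p =>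
    Set.indicator_le_self' (fun p _ => sq_nonneg _) p
  -- the contribution of large kernel values
  have hs' : Tendsto (fun n => s n / max M 1) atTop atTop :=
    hs.atTop_div_const (by positivity)
  have h1 := H.tendsto_integral_large_kernel hs'
  have h2 := H.tendsto_integral_weight_sq
  obtain ⟨-, h3⟩ := H.tendsto_integral_weight_mul_error_sq
  have hfar : Tendsto (fun n => h n * ((h n ^ 2 * (B / δ ^ 3)) ^ 2 *
      ∫ p, regressionError m p ^ 2 ∂ν)) atTop (𝓝 0) := by
    have : Tendsto (fun n => h n * ((h n ^ 2 * (B / δ ^ 3)) ^ 2 *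
        ∫ p, regressionError m p ^ 2 ∂ν)) atTop
        (𝓝 (0 * (((0 : ℝ) ^ 2 * (B / δ ^ 3)) ^ 2 * ∫ p, regressionError m p ^ 2 ∂ν))) :=
      H.h_zero.mul ((((H.h_zero.pow 2).mul_const _).pow 2).mul_const _)
    simpa using this
  filter_upwards [h1.eventually_lt_const (show (0 : ℝ) < ε / 3 by positivity),
    h2.eventually_lt_const (show f x * kernelRoughness K < Q by linarith), h3,
    H.eventually_memLp_weight,
    hfar.eventually_lt_const (show (0 : ℝ) < ε / 3 by positivity)] with n hn1 hn2 hn3 hn4 hn5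
  have hh := H.h_pos n
  have hw := H.measurable_weight n
  have hwn := H.weight_nonneg n
  set w := kernelWeight K (h n) x with hwdef
  have hi := hn3.integrable_sq
  have hw2 := hn4.integrable_sq
  have hset1 : MeasurableSet {p : ℝ × ℝ | s n / max M 1 < K ((x - p.1) / h n)} :=
    measurableSet_lt measurable_const (by fun_prop)
  have hwZ : Integrable (fun p : ℝ × ℝ => w p.1 ^ 2 * Z p) ν := by
    refine hi.mono' (by fun_prop : AEStronglyMeasurable _ _) (ae_of_all _ fun p => ?_)
    rw [Real.norm_eq_abs, abs_of_nonneg (mul_nonneg (sq_nonneg _) (hZ0 p)), mul_pow]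
    exact mul_le_mul_of_nonneg_left (hZE p) (sq_nonneg _)
  have hnn : 0 ≤ ∫ p, {p : ℝ × ℝ | s n < |h n * (w p.1 * regressionError m p)|}.indicator
      (fun p => (w p.1 * regressionError m p) ^ 2) p ∂ν :=
    integral_nonneg fun p => Set.indicator_nonneg (fun p _ => sq_nonneg _) p
  -- Since `h w |ε| = K |ε|`, exceeding `s n` requires `|ε| > M` or `K > s n / M`; the maximum with
  -- 1 keeps the divisor positive.
  have hsplit : ∫ p, {p : ℝ × ℝ | s n < |h n * (w p.1 * regressionError m p)|}.indicator
      (fun p => (w p.1 * regressionError m p) ^ 2) p ∂ν ≤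
      (∫ p, {p : ℝ × ℝ | s n / max M 1 < K ((x - p.1) / h n)}.indicator
        (fun p => (w p.1 * regressionError m p) ^ 2) p ∂ν) + ∫ p, w p.1 ^ 2 * Z p ∂ν := by
    rw [← integral_add (hi.indicator hset1) hwZ]
    refine integral_mono_of_nonneg
      (ae_of_all _ fun p => Set.indicator_nonneg (fun p _ => sq_nonneg _) p)
      ((hi.indicator hset1).add hwZ) (ae_of_all _ fun p => ?_)
    have hA : 0 ≤ {p : ℝ × ℝ | s n / max M 1 < K ((x - p.1) / h n)}.indicator
      (fun p => (w p.1 * regressionError m p) ^ 2) p :=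
      Set.indicator_nonneg (fun p _ => sq_nonneg _) p
    have hB' : 0 ≤ w p.1 ^ 2 * Z p := mul_nonneg (sq_nonneg _) (hZ0 p)
    beta_reduce
    by_cases hp : s n < |h n * (w p.1 * regressionError m p)|
    · rw [Set.indicator_of_mem (show p ∈ {p : ℝ × ℝ | s n < |h n * (w p.1 * regressionError m p)|} from hp)]
      by_cases hpM : M < |p.2 - m p.1|
      · have : Z p = regressionError m p ^ 2 :=
          Set.indicator_of_mem (show p ∈ {q : ℝ × ℝ | M < |q.2 - m q.1|} from hpM) _
        rw [this, ← mul_pow]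
        exact le_add_of_nonneg_left hA
      · have hK : s n / max M 1 < K ((x - p.1) / h n) := by
          rw [div_lt_iff₀ (by positivity)]
          refine hp.trans_le ?_
          have : h n * (w p.1 * regressionError m p) =
              K ((x - p.1) / h n) * regressionError m p := by
            rw [hwdef, kernelWeight]; field_simp
          rw [this, abs_mul, abs_of_nonneg (H.kernel.nonneg _)]
          exact mul_le_mul_of_nonneg_left ((not_lt.1 hpM).trans (le_max_left _ _))
            (H.kernel.nonneg _)
        rw [Set.indicator_of_mem (show p ∈ {p : ℝ × ℝ | s n / max M 1 < K ((x - p.1) / h n)} from hK)]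
        exact le_add_of_nonneg_right hB'
    · rw [Set.indicator_of_notMem (show p ∉ {p : ℝ × ℝ | s n < |h n * (w p.1 * regressionError m p)|} from hp)]
      exact add_nonneg hA hB'
  -- Conditioning on the covariate: near `x` the conditional tail of `ε²` is small, and farther than
  -- `δ` the weight is `O(h²)`.
  have hcond : ∫ p, w p.1 ^ 2 * Z p ∂ν ≤ ε / (3 * Q) * (∫ p, w p.1 ^ 2 ∂ν) +
      (h n ^ 2 * (B / δ ^ 3)) ^ 2 * ∫ p, regressionError m p ^ 2 ∂ν := by
    have hpull := condExp_mul_of_stronglyMeasurable_left (μ := ν) (m := covariateSigma)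
      (f := fun p : ℝ × ℝ => w p.1 ^ 2) (g := Z)
      (measurable_covariateSigma_comp_fst (hw.pow_const 2)).stronglyMeasurable hwZ hZi
    have hZc : Integrable (fun p => (ν[Z | covariateSigma]) p) ν := integrable_condExp
    have hZcE : ∫ p, (ν[Z | covariateSigma]) p ∂ν ≤ ∫ p, regressionError m p ^ 2 ∂ν := by
      rw [integral_condExp covariateSigma_le]
      exact integral_mono hZi H.law.integrable_error_sq hZE
    rw [← integral_condExp (μ := ν) covariateSigma_le (f := fun p : ℝ × ℝ => w p.1 ^ 2 * Z p)]
    refine le_trans ?_ (add_le_add_right (mul_le_mul_of_nonneg_left hZcE (sq_nonneg _)) _)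
    rw [← integral_const_mul, ← integral_const_mul,
      ← integral_add (hw2.const_mul _) (hZc.const_mul _)]
    refine integral_mono_ae integrable_condExp ((hw2.const_mul _).add (hZc.const_mul _)) ?_
    have hpos : 0 ≤ᵐ[ν] ν[Z | covariateSigma] := condExp_nonneg (ae_of_all _ hZ0)
    filter_upwards [hpull, hM, hpos] with p hp1 hp2 hp3
    have hp1' : (ν[fun p : ℝ × ℝ => w p.1 ^ 2 * Z p | covariateSigma]) p =
      w p.1 ^ 2 * (ν[Z | covariateSigma]) p := hp1
    rw [hp1']
    have hp3' : 0 ≤ (ν[Z | covariateSigma]) p := hp3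
    by_cases hpx : |p.1 - x| < δ
    · have h6 := mul_le_mul_of_nonneg_left (hp2 hpx) (sq_nonneg (w p.1))
      have h7 : 0 ≤ (h n ^ 2 * (B / δ ^ 3)) ^ 2 * (ν[Z | covariateSigma]) p := by positivity
      linarith
    · have h6 := kernelWeight_le_of_far (x := x) H.kernel hB hh hδ (u := p.1)
        (by rw [abs_sub_comm]; exact not_lt.1 hpx)
      have h7 := mul_le_mul_of_nonneg_right (pow_le_pow_left₀ (hwn p.1) h6 2) hp3'
      have h8 : 0 ≤ ε / (3 * Q) * w p.1 ^ 2 := by positivity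
      linarith
  rw [Real.dist_eq, sub_zero, abs_of_nonneg (mul_nonneg hh.le hnn)]
  have h9 := mul_le_mul_of_nonneg_left (hsplit.trans (add_le_add_right hcond _)) hh.le
  refine h9.trans_lt ?_
  have h10 : h n * (ε / (3 * Q) * ∫ p, w p.1 ^ 2 ∂ν) ≤ ε / 3 := by
    rw [mul_left_comm]
    calc _ ≤ ε / (3 * Q) * Q := mul_le_mul_of_nonneg_left hn2.le (by positivity)
      _ = ε / 3 := by field_simp
  rw [mul_add, mul_add]
  linarith

end IsRegularDesign

end Moments

/-- Independent observations, those with index in `J` having the law `ν`. -/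
structure IsIIDSample {Ω : Type*} [MeasurableSpace Ω] (μ : Measure Ω) (Z : ℕ → Ω → ℝ × ℝ)
    (ν : Measure (ℝ × ℝ)) (J : Finset ℕ) : Prop where
  indep : iIndepFun Z μ
  aemeasurable : ∀ i, AEMeasurable (Z i) μ
  hasLaw : ∀ i ∈ J, HasLaw (Z i) ν μ

/-! ### Sums over independent observations, and orthogonality of the errors. -/

section Sample

variable {Ω : Type*} [MeasurableSpace Ω] {μ : Measure Ω} [IsProbabilityMeasure μ]
  {Z : ℕ → Ω → ℝ × ℝ} {ν : Measure (ℝ × ℝ)} [IsProbabilityMeasure ν] {J : Finset ℕ}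
  {m f σ2 : ℝ → ℝ}

namespace IsIIDSample

theorem mono (hZ : IsIIDSample μ Z ν J) {J' : Finset ℕ} (h : J' ⊆ J) : IsIIDSample μ Z ν J' :=
  ⟨hZ.indep, hZ.aemeasurable, fun i hi => hZ.hasLaw i (h hi)⟩

theorem integral_comp (hZ : IsIIDSample μ Z ν J) {i : ℕ} (hi : i ∈ J) {φ : ℝ × ℝ → ℝ}
    (hφ : Measurable φ) : ∫ ω, φ (Z i ω) ∂μ = ∫ p, φ p ∂ν :=
  (hZ.hasLaw i hi).integral_comp hφ.aestronglyMeasurable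

theorem memLp_comp (hZ : IsIIDSample μ Z ν J) {i : ℕ} (hi : i ∈ J) {φ : ℝ × ℝ → ℝ} {q : ℝ≥0∞}
    (hφ : MemLp φ q ν) : MemLp (fun ω => φ (Z i ω)) q μ := by
  have h := (hZ.hasLaw i hi).map_eq
  rw [← h] at hφ
  exact hφ.comp_of_map (hZ.aemeasurable i)

theorem integrable_comp (hZ : IsIIDSample μ Z ν J) {i : ℕ} (hi : i ∈ J) {φ : ℝ × ℝ → ℝ}
    (hφ : Integrable φ ν) : Integrable (fun ω => φ (Z i ω)) μ :=
  memLp_one_iff_integrable.1 (hZ.memLp_comp hi (memLp_one_iff_integrable.2 hφ))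

theorem integral_sum (hZ : IsIIDSample μ Z ν J) {φ : ℝ × ℝ → ℝ} (hφm : Measurable φ)
    (hφ : Integrable φ ν) : ∫ ω, ∑ i ∈ J, φ (Z i ω) ∂μ = J.card * ∫ p, φ p ∂ν := by
  rw [integral_finsetSum _ fun i hi => hZ.integrable_comp hi hφ,
    Finset.sum_congr rfl fun i hi => hZ.integral_comp hi hφm]
  simp

theorem memLp_sum (hZ : IsIIDSample μ Z ν J) {φ : ℝ × ℝ → ℝ} {q : ℝ≥0∞} (hφ : MemLp φ q ν) :
    MemLp (fun ω => ∑ i ∈ J, φ (Z i ω)) q μ :=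
  memLp_finsetSum _ fun _ hi => hZ.memLp_comp hi hφ

theorem variance_sum (hZ : IsIIDSample μ Z ν J) {φ : ℝ × ℝ → ℝ} (hφm : Measurable φ)
    (hφ : MemLp φ 2 ν) : Var[fun ω => ∑ i ∈ J, φ (Z i ω); μ] = J.card * Var[φ; ν] := by
  have h1 := IndepFun.variance_sum (μ := μ) (X := fun i ω => φ (Z i ω)) (s := J)
    (fun i hi => hZ.memLp_comp hi hφ)
    (fun i _ j _ hij => (hZ.indep.indepFun hij).comp hφm hφm)
  have h2 : (∑ i ∈ J, fun ω => φ (Z i ω)) = fun ω => ∑ i ∈ J, φ (Z i ω) := by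
    ext ω; simp
  rw [h2] at h1
  rw [h1, Finset.sum_congr rfl fun i hi => ?_, Finset.sum_const, nsmul_eq_mul]
  have h3 := (hZ.hasLaw i hi).covariance_fun_comp hφm.aemeasurable hφm.aemeasurable
  rwa [covariance_self (X := fun ω => φ (Z i ω)) (hφm.comp_aemeasurable (hZ.aemeasurable i)),
    covariance_self hφm.aemeasurable] at h3

theorem indepFun_tuple (hZ : IsIIDSample μ Z ν J) {i : ℕ} {T : Finset ℕ} (hiT : i ∉ T) :
    IndepFun (Z i) (fun ω (j : T) => Z j ω) μ := by
  have h := hZ.indep.indepFun_finset₀ {i} T (by simpa using hiT) hZ.aemeasurable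
  exact h.comp (φ := fun z : ((({i} : Finset ℕ) : Type) → ℝ × ℝ) => z ⟨i, by simp⟩)
    (measurable_pi_apply _) measurable_id

theorem aemeasurable_tuple (hZ : IsIIDSample μ Z ν J) (T : Finset ℕ) :
    AEMeasurable (fun ω (j : T) => Z j ω) μ :=
  aemeasurable_pi_lambda _ fun j => hZ.aemeasurable j

/-- An error is orthogonal to functions of its covariate and of the other observations. -/
theorem integral_mul_error_eq_zero (hZ : IsIIDSample μ Z ν J) (hν : IsRegressionLaw ν m f σ2)
    {i : ℕ} (hi : i ∈ J) {T : Finset ℕ} (hiT : i ∉ T) {F : ℝ × (T → ℝ × ℝ) → ℝ}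
    (hF : Measurable F)
    (hint : Integrable (fun ω => F ((Z i ω).1, fun j => Z j ω) * regressionError m (Z i ω)) μ) :
    ∫ ω, F ((Z i ω).1, fun j => Z j ω) * regressionError m (Z i ω) ∂μ = 0 := by
  have hE := hν.measurable_error
  set W : Ω → (T → ℝ × ℝ) := fun ω j => Z j ω with hW
  have hWm : AEMeasurable W μ := hZ.aemeasurable_tuple T
  have hWlaw : HasLaw W (μ.map W) μ := ⟨hWm, rfl⟩
  have hprod := (hZ.indepFun_tuple hiT).hasLaw_prod (hZ.hasLaw i hi) hWlaw
  have : IsProbabilityMeasure (μ.map W) := Measure.isProbabilityMeasure_map hWm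
  set G : (ℝ × ℝ) × (T → ℝ × ℝ) → ℝ := fun q => F (q.1.1, q.2) * regressionError m q.1 with hG
  have hGm : Measurable G := by fun_prop
  have hGi : Integrable G (ν.prod (μ.map W)) := by
    rw [← hprod.map_eq, integrable_map_measure hGm.aestronglyMeasurable hprod.aemeasurable]
    exact hint
  have h1 := hprod.integral_comp (f := G) hGm.aestronglyMeasurable
  refine Eq.trans h1 ?_
  -- With the other observations frozen, the inner integral is that of a function of the covariate
  -- times its centered error.
  rw [integral_prod_symm _ hGi]
  refine integral_eq_zero_of_ae ?_
  filter_upwards [hGi.prod_left_ae] with z hz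
  exact hν.integral_error_mul (φ := fun u => F (u, z)) (by fun_prop) hz

theorem integral_comp_mul (hZ : IsIIDSample μ Z ν J) {i : ℕ} (hi : i ∈ J) {T : Finset ℕ}
    (hiT : i ∉ T) {φ : ℝ × ℝ → ℝ} (hφ : Measurable φ) {F : (T → ℝ × ℝ) → ℝ} (hF : Measurable F) :
    ∫ ω, φ (Z i ω) * F (fun j => Z j ω) ∂μ = (∫ p, φ p ∂ν) * ∫ ω, F (fun j => Z j ω) ∂μ := by
  rw [(hZ.indepFun_tuple hiT).integral_fun_comp_mul_comp (hZ.aemeasurable i)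
    (hZ.aemeasurable_tuple T) hφ.aestronglyMeasurable hF.aestronglyMeasurable,
    hZ.integral_comp hi hφ]

theorem aemeasurable_sum_fst (hZ : IsIIDSample μ Z ν J) {w : ℝ → ℝ} (hw : Measurable w)
    (T : Finset ℕ) : AEMeasurable (fun ω => ∑ k ∈ T, w (Z k ω).1) μ :=
  Finset.aemeasurable_fun_sum _ fun k _ =>
    (hw.comp measurable_fst).comp_aemeasurable (hZ.aemeasurable k)

/-- The factor `r` sees covariates only, so each error is centered given all that multiplies it.
Hence the noise contributes no bias, even after division by the random denominator; boundedness of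
`r` secures integrability. -/
theorem integral_sum_error_mul (hZ : IsIIDSample μ Z ν J) (hν : IsRegressionLaw ν m f σ2)
    {w r : ℝ → ℝ} {b : ℝ} (hw : Measurable w) (hr : Measurable r) (hrb : ∀ y, |r y| ≤ b)
    (he : MemLp (fun p => w p.1 * regressionError m p) 2 ν) :
    ∫ ω, (∑ i ∈ J, w (Z i ω).1 * regressionError m (Z i ω)) * r (∑ k ∈ J, w (Z k ω).1) ∂μ = 0 := by
  have hrm : AEStronglyMeasurable (fun ω => r (∑ k ∈ J, w (Z k ω).1)) μ :=
    (hr.comp_aemeasurable (hZ.aemeasurable_sum_fst hw J)).aestronglyMeasurable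
  have hint : ∀ i ∈ J, Integrable (fun ω => w (Z i ω).1 * regressionError m (Z i ω) *
      r (∑ k ∈ J, w (Z k ω).1)) μ := fun i hi =>
    (hZ.integrable_comp hi (he.integrable one_le_two)).mul_bdd hrm (ae_of_all _ fun ω => hrb _)
  simp_rw [Finset.sum_mul]
  rw [integral_finsetSum _ hint]
  refine Finset.sum_eq_zero fun i hi => ?_
  have h1 : ∀ ω, w (Z i ω).1 * regressionError m (Z i ω) * r (∑ k ∈ J, w (Z k ω).1) =
      w (Z i ω).1 * r (w (Z i ω).1 + ∑ k : J.erase i, w (Z k ω).1) *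
        regressionError m (Z i ω) := fun ω => by
    rw [← Finset.add_sum_erase J _ hi, ← Finset.sum_coe_sort (J.erase i)]
    ring
  have h2 := hint i hi
  simp_rw [h1] at h2 ⊢
  exact hZ.integral_mul_error_eq_zero hν hi (Finset.notMem_erase i J)
    (F := fun q => w q.1 * r (w q.1 + ∑ k, w (q.2 k).1)) (by fun_prop) h2

/-- In a cross term, the error of observation `i` is multiplied only by its own covariate and by
other observations, so only the diagonal survives. -/
theorem integral_sum_error_sq_mul (hZ : IsIIDSample μ Z ν J) (hν : IsRegressionLaw ν m f σ2)
    {w r : ℝ → ℝ} {b : ℝ} (hw : Measurable w) (hr : Measurable r) (hrb : ∀ y, |r y| ≤ b)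
    (he : MemLp (fun p => w p.1 * regressionError m p) 2 ν) :
    ∫ ω, (∑ i ∈ J, w (Z i ω).1 * regressionError m (Z i ω)) ^ 2 * r (∑ k ∈ J, w (Z k ω).1) ∂μ =
      ∑ i ∈ J, ∫ ω, (w (Z i ω).1 * regressionError m (Z i ω)) ^ 2 *
        r (∑ k ∈ J, w (Z k ω).1) ∂μ := by
  have hE := hν.measurable_error
  have hrm : AEStronglyMeasurable (fun ω => r (∑ k ∈ J, w (Z k ω).1)) μ :=
    (hr.comp_aemeasurable (hZ.aemeasurable_sum_fst hw J)).aestronglyMeasurable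
  have hint : ∀ i ∈ J, ∀ j ∈ J, Integrable (fun ω => w (Z i ω).1 * regressionError m (Z i ω) *
      (w (Z j ω).1 * regressionError m (Z j ω)) * r (∑ k ∈ J, w (Z k ω).1)) μ :=
    fun i hi j hj => ((hZ.memLp_comp hi he).integrable_mul (hZ.memLp_comp hj he)).mul_bdd hrm
      (ae_of_all _ fun ω => hrb _)
  simp_rw [sq, Finset.sum_mul_sum, Finset.sum_mul]
  rw [integral_finsetSum _ fun i hi => integrable_finsetSum _ fun j hj => hint i hi j hj]
  refine Finset.sum_congr rfl fun i hi => ?_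
  rw [integral_finsetSum _ fun j hj => hint i hi j hj, Finset.sum_eq_single_of_mem i hi]
  intro j hj hji
  have hjT : j ∈ J.erase i := Finset.mem_erase.2 ⟨hji, hj⟩
  have h1 : ∀ ω, w (Z i ω).1 * regressionError m (Z i ω) *
      (w (Z j ω).1 * regressionError m (Z j ω)) * r (∑ k ∈ J, w (Z k ω).1) =
      w (Z i ω).1 * (w (Z j ω).1 * regressionError m (Z j ω)) *
        r (w (Z i ω).1 + ∑ k : J.erase i, w (Z k ω).1) * regressionError m (Z i ω) := fun ω => by
    rw [← Finset.add_sum_erase J _ hi, ← Finset.sum_coe_sort (J.erase i)]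
    ring
  have h2 := hint i hi j hj
  simp_rw [h1] at h2 ⊢
  exact hZ.integral_mul_error_eq_zero hν hi (Finset.notMem_erase i J)
    (F := fun q => w q.1 * (w (q.2 ⟨j, hjT⟩).1 * regressionError m (q.2 ⟨j, hjT⟩)) *
      r (w q.1 + ∑ k, w (q.2 k).1)) (by fun_prop) h2

end IsIIDSample

end Sample

/-- The inverse `1 / d`, truncated at `d = c`. -/
noncomputable def truncInv (c d : ℝ) : ℝ := 1 / max d c

/-! ### The truncated inverse: bounded by `1 / c` and Lipschitz with constant `1 / c ^ 2`. -/

section TruncInv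

variable {c : ℝ}

theorem truncInv_nonneg (hc : 0 < c) (d : ℝ) : 0 ≤ truncInv c d :=
  one_div_nonneg.2 (hc.le.trans (le_max_right _ _))

theorem truncInv_le (hc : 0 < c) (d : ℝ) : truncInv c d ≤ 1 / c :=
  one_div_le_one_div_of_le hc (le_max_right _ _)

theorem truncInv_of_le {d : ℝ} (hd : c ≤ d) : truncInv c d = 1 / d := by
  rw [truncInv, max_eq_left hd]

theorem truncInv_of_ge {d : ℝ} (hd : d ≤ c) : truncInv c d = 1 / c := by
  rw [truncInv, max_eq_right hd]

theorem measurable_truncInv (c : ℝ) : Measurable (truncInv c) := by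
  unfold truncInv; fun_prop

theorem abs_truncInv_le (hc : 0 < c) (d : ℝ) : |truncInv c d| ≤ 1 / c := by
  rw [abs_of_nonneg (truncInv_nonneg hc d)]; exact truncInv_le hc d

theorem abs_truncInv_sub_le_inv (hc : 0 < c) (d d' : ℝ) :
    |truncInv c d - truncInv c d'| ≤ 1 / c := by
  have h1 := truncInv_nonneg hc d
  have h2 := truncInv_nonneg hc d'
  have h3 := truncInv_le hc d
  have h4 := truncInv_le hc d'
  rw [abs_le]; constructor <;> linarith

theorem abs_truncInv_sub_le (hc : 0 < c) (d d' : ℝ) :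
    |truncInv c d - truncInv c d'| ≤ |d - d'| / c ^ 2 := by
  have h1 : c ≤ max d c := le_max_right _ _
  have h2 : c ≤ max d' c := le_max_right _ _
  have h3 : |max d' c - max d c| ≤ |d - d'| := by
    rw [abs_sub_comm d d']; exact abs_max_sub_max_le_abs _ _ _
  unfold truncInv
  rw [div_sub_div _ _ (by positivity) (by positivity), one_mul, mul_one, abs_div,
    abs_of_pos (show 0 < max d c * max d' c by positivity)]
  have h4 : c ^ 2 ≤ max d c * max d' c := by nlinarith
  exact div_le_div₀ (abs_nonneg _) h3 (by positivity) h4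

theorem sq_truncInv_sub_le (hc : 0 < c) (d d' : ℝ) :
    (truncInv c d - truncInv c d') ^ 2 ≤ (d - d') ^ 2 / c ^ 4 := by
  have h := pow_le_pow_left₀ (abs_nonneg _) (abs_truncInv_sub_le hc d d') 2
  rw [sq_abs, div_pow, sq_abs, ← pow_mul] at h
  exact h

theorem continuousAt_truncInv (hc : 0 < c) {d : ℝ} : ContinuousAt (truncInv c) d := by
  unfold truncInv
  refine ContinuousAt.div continuousAt_const (by fun_prop) ?_
  exact (hc.trans_le (le_max_right _ _)).ne'

end TruncInv

/-! ### Leave-one-out control of the random denominator. -/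

section Sample

variable {Ω : Type*} [MeasurableSpace Ω] {μ : Measure Ω} [IsProbabilityMeasure μ]
  {Z : ℕ → Ω → ℝ × ℝ} {ν : Measure (ℝ × ℝ)} [IsProbabilityMeasure ν] {J : Finset ℕ}
  {m f σ2 w : ℝ → ℝ} {n : ℕ} {c : ℝ}

namespace IsIIDSample

/-- The mean square deviation of `δ + n⁻¹ ∑ φ(Z i)` from its expectation. -/
theorem integral_sq_average_sub_le (hZ : IsIIDSample μ Z ν J) (hn : 0 < n) (hJ : J.card ≤ n)
    {φ : ℝ × ℝ → ℝ} (hφm : Measurable φ) (hφ : MemLp φ 2 ν) (δ : ℝ) :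
    ∫ ω, (δ + (∑ i ∈ J, φ (Z i ω)) / n - (δ + J.card / n * ∫ p, φ p ∂ν)) ^ 2 ∂μ ≤
      (∫ p, φ p ^ 2 ∂ν) / n := by
  have hn' : (0 : ℝ) < n := by exact_mod_cast hn
  have hs := hZ.memLp_sum (μ := μ) hφ
  have h1 := hZ.variance_sum hφm hφ
  rw [variance_eq_integral hs.aemeasurable, hZ.integral_sum hφm (hφ.integrable one_le_two)] at h1
  have h2 : ∀ ω, (δ + (∑ i ∈ J, φ (Z i ω)) / n - (δ + J.card / n * ∫ p, φ p ∂ν)) ^ 2 =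
      (1 / (n : ℝ) ^ 2) * (∑ i ∈ J, φ (Z i ω) - J.card * ∫ p, φ p ∂ν) ^ 2 := fun ω => by
    field_simp; ring
  simp_rw [h2]
  rw [integral_const_mul, h1]
  have h3 : Var[φ; ν] ≤ ∫ p, φ p ^ 2 ∂ν := variance_le_expectation_sq hφm.aestronglyMeasurable
  have h4 : (J.card : ℝ) * Var[φ; ν] ≤ n * ∫ p, φ p ^ 2 ∂ν :=
    mul_le_mul (by exact_mod_cast hJ) h3 (variance_nonneg _ _) hn'.le
  calc _ ≤ 1 / (n : ℝ) ^ 2 * (n * ∫ p, φ p ^ 2 ∂ν) :=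
        mul_le_mul_of_nonneg_left h4 (by positivity)
    _ = _ := by field_simp

theorem memLp_average (hZ : IsIIDSample μ Z ν J) {φ : ℝ × ℝ → ℝ} (hφ : MemLp φ 2 ν) (δ : ℝ)
    (n : ℕ) : MemLp (fun ω => δ + (∑ i ∈ J, φ (Z i ω)) / n) 2 μ := by
  have h := (memLp_const (μ := μ) (p := 2) δ).add ((hZ.memLp_sum (μ := μ) hφ).mul_const (n : ℝ)⁻¹)
  simp only [div_eq_mul_inv]
  exact h

theorem integral_average (hZ : IsIIDSample μ Z ν J) {φ : ℝ × ℝ → ℝ} (hφm : Measurable φ)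
    (hφ : Integrable φ ν) (δ : ℝ) (n : ℕ) :
    ∫ ω, (δ + (∑ i ∈ J, φ (Z i ω)) / n) ∂μ = δ + J.card / n * ∫ p, φ p ∂ν := by
  have hi : Integrable (fun ω => (∑ i ∈ J, φ (Z i ω)) / (n : ℝ)) μ :=
    (integrable_finsetSum _ fun i hi => hZ.integrable_comp hi hφ).div_const _
  rw [integral_add (integrable_const _) hi, integral_div, hZ.integral_sum hφm hφ]
  simp; ring

/-- The interaction of the weighted errors with the fluctuations of the denominator. -/
theorem integral_sum_error_sq_mul_truncInv_le (hZ : IsIIDSample μ Z ν J)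
    (hν : IsRegressionLaw ν m f σ2) (hw : Measurable w) (hw0 : ∀ u, 0 ≤ w u)
    (hw2 : MemLp (fun p : ℝ × ℝ => w p.1) 2 ν)
    (he : MemLp (fun p => w p.1 * regressionError m p) 2 ν) (hc : 0 < c) (hn : 0 < n)
    (hJ : J.card ≤ n) (δ : ℝ) :
    ∫ ω, (∑ i ∈ J, w (Z i ω).1 * regressionError m (Z i ω)) ^ 2 *
      (truncInv c (δ + (∑ k ∈ J, w (Z k ω).1) / n) -
        truncInv c (δ + J.card / n * ∫ p, w p.1 ∂ν)) ^ 2 ∂μ ≤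
    n * (8 / c ^ 4 * (∫ p, (w p.1 * regressionError m p) ^ 2 ∂ν) * ((∫ p, w p.1 ^ 2 ∂ν) / n) +
      2 * ∫ p, (w p.1 * regressionError m p) ^ 2 * min (1 / c) (w p.1 / n / c ^ 2) ^ 2 ∂ν) := by
  have hE := hν.measurable_error
  have hn' : (0 : ℝ) < n := by exact_mod_cast hn
  have hψ := measurable_truncInv c
  set d := δ + J.card / n * ∫ p, w p.1 ∂ν with hd
  have hwm : Measurable fun p : ℝ × ℝ => w p.1 := by fun_prop
  have hVD := hZ.integral_sq_average_sub_le hn hJ hwm hw2 δ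
  rw [← hd] at hVD
  have hei := he.integrable_sq
  rw [hZ.integral_sum_error_sq_mul hν (r := fun y => (truncInv c (δ + y / n) - truncInv c d) ^ 2)
    (b := (1 / c) ^ 2) hw (by fun_prop) (fun y => by
      rw [abs_of_nonneg (sq_nonneg _), ← sq_abs]
      exact pow_le_pow_left₀ (abs_nonneg _) (abs_truncInv_sub_le_inv hc _ _) 2) he]
  set A := 8 / c ^ 4 * (∫ p, (w p.1 * regressionError m p) ^ 2 ∂ν) * ((∫ p, w p.1 ^ 2 ∂ν) / n) +
      2 * ∫ p, (w p.1 * regressionError m p) ^ 2 * min (1 / c) (w p.1 / n / c ^ 2) ^ 2 ∂ν with hA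
  suffices h : ∀ i ∈ J, ∫ ω, (w (Z i ω).1 * regressionError m (Z i ω)) ^ 2 *
      (truncInv c (δ + (∑ k ∈ J, w (Z k ω).1) / n) - truncInv c d) ^ 2 ∂μ ≤ A by
    have hA0 : 0 ≤ A := by
      have h1 : 0 ≤ ∫ p, (w p.1 * regressionError m p) ^ 2 ∂ν :=
        integral_nonneg fun p => sq_nonneg _
      have h2 : 0 ≤ ∫ p, w p.1 ^ 2 ∂ν := integral_nonneg fun p => sq_nonneg _
      have h3 : 0 ≤ ∫ p, (w p.1 * regressionError m p) ^ 2 *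
        min (1 / c) (w p.1 / n / c ^ 2) ^ 2 ∂ν := integral_nonneg fun p => by positivity
      positivity
    calc _ ≤ ∑ i ∈ J, A := Finset.sum_le_sum h
      _ = J.card * A := by simp
      _ ≤ n * A := mul_le_mul_of_nonneg_right (by exact_mod_cast hJ) hA0
  intro i hi
  -- Without observation `i` the denominator is independent of `(X i, ε i)`. Removing it changes the
  -- truncated inverse by at most `min (1 / c) (w / n / c²)`, the source of the second term of the
  -- bound.
  set F : (J.erase i → ℝ × ℝ) → ℝ := fun z =>
    (truncInv c (δ + (∑ k, w (z k).1) / n) - truncInv c d) ^ 2 with hF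
  have hFm : Measurable F := by fun_prop
  have hFb : ∀ z, |F z| ≤ (1 / c) ^ 2 := fun z => by
    change |(truncInv c (δ + (∑ k, w (z k).1) / n) - truncInv c d) ^ 2| ≤ _
    rw [abs_pow]
    exact pow_le_pow_left₀ (abs_nonneg _) (abs_truncInv_sub_le_inv hc _ _) 2
  have hsum : ∀ ω, ∑ k ∈ J, w (Z k ω).1 = w (Z i ω).1 + ∑ k : J.erase i, w (Z k ω).1 := fun ω => by
    rw [← Finset.add_sum_erase J _ hi, ← Finset.sum_coe_sort (J.erase i)]
  -- the leave-one-out deviation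
  have hloo : ∫ ω, F (fun j => Z j ω) ∂μ ≤ 4 / c ^ 4 * ((∫ p, w p.1 ^ 2 ∂ν) / n) := by
    have hDi : Integrable (fun ω => (δ + (∑ k ∈ J, w (Z k ω).1) / n - d) ^ 2) μ :=
      ((hZ.memLp_average (μ := μ) (φ := fun p => w p.1) hw2 δ n).sub (memLp_const d)).integrable_sq
    have hwi : Integrable (fun ω => w (Z i ω).1 ^ 2) μ :=
      (hZ.memLp_comp (φ := fun p => w p.1) hi hw2).integrable_sq
    have hle : ∀ ω, F (fun j => Z j ω) ≤ 2 / c ^ 4 *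
        ((δ + (∑ k ∈ J, w (Z k ω).1) / n - d) ^ 2 + (1 / n ^ 2) * w (Z i ω).1 ^ 2) := fun ω => by
      refine (sq_truncInv_sub_le hc _ _).trans ?_
      rw [hsum ω, div_mul_eq_mul_div]
      refine div_le_div_of_nonneg_right ?_ (by positivity)
      set y := ∑ k : J.erase i, w (Z k ω).1
      have h1 : δ + y / n - d = (δ + (w (Z i ω).1 + y) / n - d) - w (Z i ω).1 / n := by
        field_simp; ring
      have h2 : (1 / (n : ℝ) ^ 2) * w (Z i ω).1 ^ 2 = (w (Z i ω).1 / n) ^ 2 := by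
        rw [div_pow]; ring
      rw [h1, h2]
      nlinarith [sq_nonneg ((δ + (w (Z i ω).1 + y) / n - d) + w (Z i ω).1 / n)]
    have hbi := (hDi.add (hwi.const_mul (1 / (n : ℝ) ^ 2))).const_mul (2 / c ^ 4)
    have h1 := integral_mono_of_nonneg (ae_of_all _ fun ω => sq_nonneg _) hbi (ae_of_all _ hle)
    refine h1.trans ?_
    rw [integral_const_mul]
    have h2 : ∫ ω, ((δ + (∑ k ∈ J, w (Z k ω).1) / n - d) ^ 2 + (1 / (n : ℝ) ^ 2) *
        w (Z i ω).1 ^ 2) ∂μ = (∫ ω, (δ + (∑ k ∈ J, w (Z k ω).1) / n - d) ^ 2 ∂μ) +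
        (1 / (n : ℝ) ^ 2) * ∫ p, w p.1 ^ 2 ∂ν := by
      rw [integral_add hDi (hwi.const_mul _), integral_const_mul,
        hZ.integral_comp hi (φ := fun p => w p.1 ^ 2) (by fun_prop)]
    have h2' : 0 ≤ ∫ p, w p.1 ^ 2 ∂ν := integral_nonneg fun p => sq_nonneg _
    have h3 : (1 / (n : ℝ) ^ 2) * ∫ p, w p.1 ^ 2 ∂ν ≤ (∫ p, w p.1 ^ 2 ∂ν) / n := by
      rw [one_div_mul_eq_div]
      refine div_le_div_of_nonneg_left h2' hn' ?_
      exact le_self_pow₀ (by exact_mod_cast hn) two_ne_zero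
    calc _ ≤ 2 / c ^ 4 * ((∫ p, w p.1 ^ 2 ∂ν) / n + (∫ p, w p.1 ^ 2 ∂ν) / n) := by
          refine mul_le_mul_of_nonneg_left ?_ (by positivity)
          refine (le_of_eq h2).trans (add_le_add hVD h3)
      _ = _ := by ring
  have hmi : Integrable (fun p : ℝ × ℝ => (w p.1 * regressionError m p) ^ 2 *
      min (1 / c) (w p.1 / n / c ^ 2) ^ 2) ν := by
    refine hei.mul_bdd (c := (1 / c) ^ 2) (by fun_prop : Measurable _).aestronglyMeasurable
      (ae_of_all _ fun p => ?_)
    have h0 : 0 ≤ min (1 / c) (w p.1 / n / c ^ 2) := by have := hw0 p.1; positivity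
    rw [Real.norm_eq_abs, abs_of_nonneg (sq_nonneg _)]
    exact pow_le_pow_left₀ h0 (min_le_left _ _) 2
  have hFi : Integrable (fun ω => (w (Z i ω).1 * regressionError m (Z i ω)) ^ 2 *
      F (fun j => Z j ω)) μ :=
    (hZ.integrable_comp hi hei).mul_bdd
      (hFm.comp_aemeasurable (hZ.aemeasurable_tuple _)).aestronglyMeasurable
      (ae_of_all _ fun ω => hFb _)
  have hmZ := hZ.integrable_comp (μ := μ) hi hmi
  have hle : ∀ ω, (w (Z i ω).1 * regressionError m (Z i ω)) ^ 2 *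
      (truncInv c (δ + (∑ k ∈ J, w (Z k ω).1) / n) - truncInv c d) ^ 2 ≤
      2 * ((w (Z i ω).1 * regressionError m (Z i ω)) ^ 2 * F (fun j => Z j ω)) +
      2 * ((w (Z i ω).1 * regressionError m (Z i ω)) ^ 2 *
        min (1 / c) (w (Z i ω).1 / n / c ^ 2) ^ 2) := fun ω => by
    rw [hsum ω]
    set y := ∑ k : J.erase i, w (Z k ω).1 with hy
    have hFy : F (fun j => Z j ω) = (truncInv c (δ + y / n) - truncInv c d) ^ 2 := rfl
    rw [hFy]
    set a := truncInv c (δ + (w (Z i ω).1 + y) / n)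
    set b := truncInv c (δ + y / n)
    have h1 : |a - b| ≤ min (1 / c) (w (Z i ω).1 / n / c ^ 2) := by
      refine le_min (abs_truncInv_sub_le_inv hc _ _) ((abs_truncInv_sub_le hc _ _).trans ?_)
      have h2 : δ + (w (Z i ω).1 + y) / n - (δ + y / n) = w (Z i ω).1 / n := by ring
      rw [h2, abs_of_nonneg (div_nonneg (hw0 _) hn'.le)]
    have h2 : (a - b) ^ 2 ≤ min (1 / c) (w (Z i ω).1 / n / c ^ 2) ^ 2 := by
      rw [← sq_abs]; exact pow_le_pow_left₀ (abs_nonneg _) h1 2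
    have h3 : (a - truncInv c d) ^ 2 ≤ 2 * (b - truncInv c d) ^ 2 +
        2 * min (1 / c) (w (Z i ω).1 / n / c ^ 2) ^ 2 := by
      nlinarith [sq_nonneg ((a - b) - (b - truncInv c d))]
    have h4 := mul_le_mul_of_nonneg_left h3
      (sq_nonneg (w (Z i ω).1 * regressionError m (Z i ω)))
    linarith
  refine (integral_mono_of_nonneg (ae_of_all _ fun ω => by positivity)
    ((hFi.const_mul 2).add (hmZ.const_mul 2)) (ae_of_all _ hle)).trans ?_
  have h5 := integral_add (hFi.const_mul 2) (hmZ.const_mul 2)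
  refine (le_of_eq h5).trans ?_
  rw [integral_const_mul, integral_const_mul,
    hZ.integral_comp_mul hi (Finset.notMem_erase i J)
      (φ := fun p => (w p.1 * regressionError m p) ^ 2) (by fun_prop) hFm,
    hZ.integral_comp hi (φ := fun p => (w p.1 * regressionError m p) ^ 2 *
      min (1 / c) (w p.1 / n / c ^ 2) ^ 2) (by fun_prop)]
  rw [hA]
  have h6 := mul_le_mul_of_nonneg_left hloo
    (integral_nonneg (μ := ν) fun p => sq_nonneg (w p.1 * regressionError m p))
  refine add_le_add ?_ le_rfl
  refine (mul_le_mul_of_nonneg_left h6 two_pos.le).trans (le_of_eq ?_)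
  ring

end IsIIDSample

end Sample

/-- The sum of `φ` over the observations with index in `J`, divided by `n`. -/
noncomputable def average {Ω : Type*} (Z : ℕ → Ω → ℝ × ℝ) (J : Finset ℕ) (n : ℕ) (φ : ℝ × ℝ → ℝ)
    (ω : Ω) : ℝ := (∑ i ∈ J, φ (Z i ω)) / n

/-! ### Mean and mean square of numerator times truncated inverse denominator. -/

section Sample

variable {Ω : Type*} [MeasurableSpace Ω] {μ : Measure Ω} [IsProbabilityMeasure μ]
  {Z : ℕ → Ω → ℝ × ℝ} {ν : Measure (ℝ × ℝ)} [IsProbabilityMeasure ν] {J : Finset ℕ}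
  {m f σ2 w : ℝ → ℝ} {n : ℕ} {c : ℝ}

namespace IsIIDSample

theorem aemeasurable_average (hZ : IsIIDSample μ Z ν J) (n : ℕ) {φ : ℝ × ℝ → ℝ}
    (hφ : Measurable φ) : AEMeasurable (average Z J n φ) μ :=
  (Finset.aemeasurable_fun_sum _ fun k _ => hφ.comp_aemeasurable (hZ.aemeasurable k)).div_const _

theorem integral_average_error (hZ : IsIIDSample μ Z ν J) (hν : IsRegressionLaw ν m f σ2)
    (hw : Measurable w) (he : MemLp (fun p => w p.1 * regressionError m p) 2 ν) (n : ℕ) :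
    ∫ ω, average Z J n (fun p => w p.1 * regressionError m p) ω ∂μ = 0 := by
  have hE := hν.measurable_error
  have h := hZ.integral_average (μ := μ) (φ := fun p => w p.1 * regressionError m p) (by fun_prop)
    (he.integrable one_le_two) 0 n
  rw [hν.integral_error_mul hw (he.integrable one_le_two)] at h
  simpa [average] using h

theorem memLp_average' (hZ : IsIIDSample μ Z ν J) {φ : ℝ × ℝ → ℝ} (hφ : MemLp φ 2 ν) (n : ℕ) :
    MemLp (average Z J n φ) 2 μ := by
  have h := hZ.memLp_average (μ := μ) hφ 0 n
  simp only [zero_add] at h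
  exact h

theorem integral_sq_average_error_le (hZ : IsIIDSample μ Z ν J) (hν : IsRegressionLaw ν m f σ2)
    (hw : Measurable w) (he : MemLp (fun p => w p.1 * regressionError m p) 2 ν) (hn : 0 < n)
    (hJ : J.card ≤ n) :
    ∫ ω, average Z J n (fun p => w p.1 * regressionError m p) ω ^ 2 ∂μ ≤
      (∫ p, (w p.1 * regressionError m p) ^ 2 ∂ν) / n := by
  have hE := hν.measurable_error
  have h := hZ.integral_sq_average_sub_le (μ := μ) hn hJ
    (φ := fun p => w p.1 * regressionError m p) (by fun_prop) he 0
  rw [hν.integral_error_mul hw (he.integrable one_le_two)] at h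
  simpa [average] using h

theorem memLp_mul_truncInv (hZ : IsIIDSample μ Z ν J) (hw : Measurable w) (hc : 0 < c) (n : ℕ)
    (δ : ℝ) {U : Ω → ℝ} (hU : MemLp U 2 μ) :
    MemLp (fun ω => U ω * truncInv c (δ + average Z J n (fun p => w p.1) ω)) 2 μ := by
  have hD := hZ.aemeasurable_average n (φ := fun p : ℝ × ℝ => w p.1) (by fun_prop)
  refine hU.of_le_mul (c := 1 / c) (hU.aestronglyMeasurable.mul
    ((measurable_truncInv c).comp_aemeasurable (hD.const_add δ)).aestronglyMeasurable)
    (ae_of_all _ fun ω => ?_)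
  rw [norm_mul, mul_comm]
  exact mul_le_mul_of_nonneg_right (abs_truncInv_le hc _) (norm_nonneg _)

/-- The noise has mean zero against the truncated inverse, and so has `G - γ` against its constant
value at `d`. With `v` the deviation of the truncated inverse, what remains is `(G - γ) v + γ v`.
The product is second order by the inequality of means; in `γ v`, `|D - d| ≤ (θ + (D - d)² / θ) / 2`
trades a first moment for the variance, with `θ` left free for the choice of rate. -/
theorem abs_integral_truncated_sub_le (hZ : IsIIDSample μ Z ν J)
    (hν : IsRegressionLaw ν m f σ2) (hw : Measurable w)
    (hw2 : MemLp (fun p : ℝ × ℝ => w p.1) 2 ν)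
    (he : MemLp (fun p => w p.1 * regressionError m p) 2 ν)
    {g : ℝ × ℝ → ℝ} (hgm : Measurable g) (hg : MemLp g 2 ν) (hc : 0 < c) (hn : 0 < n)
    (hJ : J.card ≤ n) (δ η : ℝ) {θ : ℝ} (hθ : 0 < θ) :
    |(∫ ω, (average Z J n (fun p => w p.1 * regressionError m p) ω + (η + average Z J n g ω)) *
        truncInv c (δ + average Z J n (fun p => w p.1) ω) ∂μ) -
      (η + J.card / n * ∫ p, g p ∂ν) * truncInv c (δ + J.card / n * ∫ p, w p.1 ∂ν)| ≤
    ((∫ p, g p ^ 2 ∂ν) / n + (∫ p, w p.1 ^ 2 ∂ν) / n / c ^ 4) / 2 +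
      |η + J.card / n * ∫ p, g p ∂ν| * ((θ + (∫ p, w p.1 ^ 2 ∂ν) / n / θ) / c ^ 2 / 2) := by
  have hE := hν.measurable_error
  have hψ := measurable_truncInv c
  have hwm : Measurable fun p : ℝ × ℝ => w p.1 := by fun_prop
  set S : Ω → ℝ := average Z J n (fun p => w p.1 * regressionError m p) with hS
  set D : Ω → ℝ := fun ω => δ + average Z J n (fun p => w p.1) ω with hD
  set G : Ω → ℝ := fun ω => η + average Z J n g ω with hG
  set d := δ + J.card / n * ∫ p, w p.1 ∂ν with hd
  set γ := η + J.card / n * ∫ p, g p ∂ν with hγ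
  have hVD : ∫ ω, (D ω - d) ^ 2 ∂μ ≤ (∫ p, w p.1 ^ 2 ∂ν) / n :=
    hZ.integral_sq_average_sub_le hn hJ hwm hw2 δ
  have hVG : ∫ ω, (G ω - γ) ^ 2 ∂μ ≤ (∫ p, g p ^ 2 ∂ν) / n :=
    hZ.integral_sq_average_sub_le hn hJ hgm hg η
  have hDL : MemLp D 2 μ := hZ.memLp_average hw2 δ n
  have hGL : MemLp G 2 μ := hZ.memLp_average hg η n
  have hSL : MemLp S 2 μ := hZ.memLp_average' he n
  have hSψ : Integrable (fun ω => S ω * truncInv c (D ω)) μ :=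
    (hZ.memLp_mul_truncInv hw hc n δ hSL).integrable one_le_two
  have hGψ : Integrable (fun ω => G ω * truncInv c (D ω)) μ :=
    (hZ.memLp_mul_truncInv hw hc n δ hGL).integrable one_le_two
  have hS0 : ∫ ω, S ω * truncInv c (D ω) ∂μ = 0 := by
    have h := hZ.integral_sum_error_mul (μ := μ) hν (r := fun y => truncInv c (δ + y / n)) hw
      (by fun_prop) (fun y => abs_truncInv_le hc _) he
    have h2 : ∀ ω, S ω * truncInv c (D ω) = (n : ℝ)⁻¹ *
        ((∑ i ∈ J, w (Z i ω).1 * regressionError m (Z i ω)) *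
          truncInv c (δ + (∑ k ∈ J, w (Z k ω).1) / n)) := fun ω => by
      simp only [hS, hD, average]; ring
    simp_rw [h2]
    rw [integral_const_mul, h, mul_zero]
  have hsub : (∫ ω, (S ω + G ω) * truncInv c (D ω) ∂μ) - γ * truncInv c d =
      ∫ ω, (G ω * truncInv c (D ω) - γ * truncInv c d) ∂μ := by
    simp_rw [add_mul]
    rw [integral_add hSψ hGψ, hS0, zero_add, integral_sub hGψ (integrable_const _)]
    simp
  have hmean : ∫ ω, (G ω - γ) * truncInv c d ∂μ = 0 := by
    have h1 : ∫ ω, G ω ∂μ = γ := hZ.integral_average hgm (hg.integrable one_le_two) η n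
    rw [integral_mul_const, integral_sub (hGL.integrable one_le_two) (integrable_const _), h1]
    simp
  have hGd : Integrable (fun ω => (G ω - γ) * truncInv c d) μ :=
    ((hGL.integrable one_le_two).sub (integrable_const _)).mul_const _
  have hid : ∫ ω, (G ω * truncInv c (D ω) - γ * truncInv c d) ∂μ =
      ∫ ω, (G ω * truncInv c (D ω) - γ * truncInv c d - (G ω - γ) * truncInv c d) ∂μ := by
    have h1 := integral_sub (hGψ.sub (integrable_const (γ * truncInv c d))) hGd
    rw [hmean, sub_zero] at h1
    exact h1.symm
  have hi1 := (hGL.sub (memLp_const γ)).integrable_sq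
  have hi2 := (hDL.sub (memLp_const d)).integrable_sq
  simp only [Pi.sub_apply] at hi1 hi2
  have hbi : Integrable (fun ω => ((G ω - γ) ^ 2 + (D ω - d) ^ 2 / c ^ 4) / 2 +
      |γ| * ((θ + (D ω - d) ^ 2 / θ) / c ^ 2 / 2)) μ :=
    ((hi1.add (hi2.div_const _)).div_const 2).add
      (((((integrable_const θ).add (hi2.div_const θ)).div_const _).div_const _).const_mul _)
  rw [hsub, hid, ← Real.norm_eq_abs]
  refine (norm_integral_le_of_norm_le hbi (ae_of_all _ fun ω => ?_)).trans ?_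
  · set v := truncInv c (D ω) - truncInv c d with hv
    have h1 : G ω * truncInv c (D ω) - γ * truncInv c d - (G ω - γ) * truncInv c d =
        (G ω - γ) * v + γ * v := by rw [hv]; ring
    have h2 : v ^ 2 ≤ (D ω - d) ^ 2 / c ^ 4 := sq_truncInv_sub_le hc _ _
    have h3 : |v| ≤ |D ω - d| / c ^ 2 := abs_truncInv_sub_le hc _ _
    rw [h1, Real.norm_eq_abs]
    have h4 : |D ω - d| ≤ (θ + (D ω - d) ^ 2 / θ) / 2 := by
      rw [← sq_abs (D ω - d)]
      have : θ + |D ω - d| ^ 2 / θ - 2 * |D ω - d| = (θ - |D ω - d|) ^ 2 / θ := by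
        field_simp; ring
      have h5 : 0 ≤ (θ - |D ω - d|) ^ 2 / θ := by positivity
      linarith
    have h6 : |(G ω - γ) * v| ≤ ((G ω - γ) ^ 2 + (D ω - d) ^ 2 / c ^ 4) / 2 := by
      rw [abs_mul]
      nlinarith [sq_nonneg (|G ω - γ| - |v|), sq_abs (G ω - γ), sq_abs v]
    have h7 : |γ * v| ≤ |γ| * ((θ + (D ω - d) ^ 2 / θ) / c ^ 2 / 2) := by
      rw [abs_mul]
      refine mul_le_mul_of_nonneg_left (h3.trans ?_) (abs_nonneg _)
      rw [div_right_comm]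
      exact div_le_div_of_nonneg_right h4 (by positivity)
    exact (abs_add_le _ _).trans (add_le_add h6 h7)
  · have h1 : ∫ ω, (((G ω - γ) ^ 2 + (D ω - d) ^ 2 / c ^ 4) / 2 +
        |γ| * ((θ + (D ω - d) ^ 2 / θ) / c ^ 2 / 2)) ∂μ =
        ((∫ ω, (G ω - γ) ^ 2 ∂μ) + (∫ ω, (D ω - d) ^ 2 ∂μ) / c ^ 4) / 2 +
        |γ| * ((θ + (∫ ω, (D ω - d) ^ 2 ∂μ) / θ) / c ^ 2 / 2) := by
      rw [integral_add, integral_div, integral_add hi1 (hi2.div_const _), integral_div,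
        integral_const_mul, integral_div, integral_div,
        integral_add (integrable_const _) (hi2.div_const _), integral_div]
      · simp
      · exact (hi1.add (hi2.div_const _)).div_const 2
      · exact ((((integrable_const θ).add (hi2.div_const θ)).div_const _).div_const _).const_mul _
    rw [h1]
    gcongr

/-- The difference is a sum of four terms: noise times the deviation of the denominator, noise times
the deviation of its mean value from `b`, fluctuation of `G`, and `γ` times the deviation of the
denominator. The factor 4 is the price of squaring such a sum. The limit `1 / f x` will serve as
`b`. -/
theorem integral_sq_truncated_sub_le (hZ : IsIIDSample μ Z ν J)
    (hν : IsRegressionLaw ν m f σ2) (hw : Measurable w) (hw0 : ∀ u, 0 ≤ w u)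
    (hw2 : MemLp (fun p : ℝ × ℝ => w p.1) 2 ν)
    (he : MemLp (fun p => w p.1 * regressionError m p) 2 ν)
    {g : ℝ × ℝ → ℝ} (hgm : Measurable g) (hg : MemLp g 2 ν) (hc : 0 < c) (hn : 0 < n)
    (hJ : J.card ≤ n) (δ η b : ℝ) :
    ∫ ω, ((average Z J n (fun p => w p.1 * regressionError m p) ω + (η + average Z J n g ω)) *
        truncInv c (δ + average Z J n (fun p => w p.1) ω) -
      (η + J.card / n * ∫ p, g p ∂ν) * truncInv c (δ + J.card / n * ∫ p, w p.1 ∂ν) -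
      average Z J n (fun p => w p.1 * regressionError m p) ω * b) ^ 2 ∂μ ≤
    4 * ((8 / c ^ 4 * (∫ p, (w p.1 * regressionError m p) ^ 2 ∂ν) * ((∫ p, w p.1 ^ 2 ∂ν) / n) +
        2 * ∫ p, (w p.1 * regressionError m p) ^ 2 * min (1 / c) (w p.1 / n / c ^ 2) ^ 2 ∂ν) / n +
      (truncInv c (δ + J.card / n * ∫ p, w p.1 ∂ν) - b) ^ 2 *
        ((∫ p, (w p.1 * regressionError m p) ^ 2 ∂ν) / n) +
      (∫ p, g p ^ 2 ∂ν) / n / c ^ 2 +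
      (η + J.card / n * ∫ p, g p ∂ν) ^ 2 * ((∫ p, w p.1 ^ 2 ∂ν) / n / c ^ 4)) := by
  have hE := hν.measurable_error
  have hn' : (0 : ℝ) < n := by exact_mod_cast hn
  have hψ := measurable_truncInv c
  have hwm : Measurable fun p : ℝ × ℝ => w p.1 := by fun_prop
  have hnoise := hZ.integral_sum_error_sq_mul_truncInv_le hν hw hw0 hw2 he hc hn hJ δ
  have hSe := hZ.integral_sq_average_error_le hν hw he hn hJ
  set S : Ω → ℝ := average Z J n (fun p => w p.1 * regressionError m p) with hS
  set D : Ω → ℝ := fun ω => δ + average Z J n (fun p => w p.1) ω with hD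
  set G : Ω → ℝ := fun ω => η + average Z J n g ω with hG
  set d := δ + J.card / n * ∫ p, w p.1 ∂ν with hd
  set γ := η + J.card / n * ∫ p, g p ∂ν with hγ
  have hVD : ∫ ω, (D ω - d) ^ 2 ∂μ ≤ (∫ p, w p.1 ^ 2 ∂ν) / n :=
    hZ.integral_sq_average_sub_le hn hJ hwm hw2 δ
  have hVG : ∫ ω, (G ω - γ) ^ 2 ∂μ ≤ (∫ p, g p ^ 2 ∂ν) / n :=
    hZ.integral_sq_average_sub_le hn hJ hgm hg η
  have hDL : MemLp D 2 μ := hZ.memLp_average hw2 δ n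
  have hGL : MemLp G 2 μ := hZ.memLp_average hg η n
  have hSL : MemLp S 2 μ := hZ.memLp_average' he n
  have hi1 := (hGL.sub (memLp_const γ)).integrable_sq
  have hi2 := (hDL.sub (memLp_const d)).integrable_sq
  simp only [Pi.sub_apply] at hi1 hi2
  have hi3 := hSL.integrable_sq
  have hi4 : Integrable (fun ω => S ω ^ 2 * (truncInv c (D ω) - truncInv c d) ^ 2) μ := by
    refine hi3.mul_bdd (c := (1 / c) ^ 2) ?_ (ae_of_all _ fun ω => ?_)
    · exact ((hψ.comp_aemeasurable hDL.aemeasurable).sub_const _ |>.pow_const 2).aestronglyMeasurable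
    · rw [Real.norm_eq_abs, abs_pow]
      exact pow_le_pow_left₀ (abs_nonneg _) (abs_truncInv_sub_le_inv hc _ _) 2
  have hnoise' : ∫ ω, S ω ^ 2 * (truncInv c (D ω) - truncInv c d) ^ 2 ∂μ ≤
      (8 / c ^ 4 * (∫ p, (w p.1 * regressionError m p) ^ 2 ∂ν) * ((∫ p, w p.1 ^ 2 ∂ν) / n) +
        2 * ∫ p, (w p.1 * regressionError m p) ^ 2 *
          min (1 / c) (w p.1 / n / c ^ 2) ^ 2 ∂ν) / n := by
    have h2 : ∀ ω, S ω ^ 2 * (truncInv c (D ω) - truncInv c d) ^ 2 = (1 / (n : ℝ) ^ 2) *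
        ((∑ i ∈ J, w (Z i ω).1 * regressionError m (Z i ω)) ^ 2 *
          (truncInv c (δ + (∑ k ∈ J, w (Z k ω).1) / n) - truncInv c d) ^ 2) := fun ω => by
      simp only [hS, hD, average]; ring
    simp_rw [h2]
    rw [integral_const_mul]
    refine (mul_le_mul_of_nonneg_left hnoise (by positivity)).trans (le_of_eq ?_)
    field_simp
  have hbi : Integrable (fun ω => 4 * (S ω ^ 2 * (truncInv c (D ω) - truncInv c d) ^ 2 +
      (truncInv c d - b) ^ 2 * S ω ^ 2 + (G ω - γ) ^ 2 / c ^ 2 +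
      γ ^ 2 * ((D ω - d) ^ 2 / c ^ 4))) μ :=
    (((hi4.add (hi3.const_mul _)).add (hi1.div_const _)).add
      ((hi2.div_const _).const_mul _)).const_mul 4
  refine (integral_mono_of_nonneg (ae_of_all _ fun ω => sq_nonneg _) hbi
    (ae_of_all _ fun ω => ?_)).trans ?_
  · change ((S ω + G ω) * truncInv c (D ω) - γ * truncInv c d - S ω * b) ^ 2 ≤ _
    have h2 : (truncInv c (D ω) - truncInv c d) ^ 2 ≤ (D ω - d) ^ 2 / c ^ 4 :=
      sq_truncInv_sub_le hc _ _
    have h3 : truncInv c (D ω) ^ 2 ≤ 1 / c ^ 2 := by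
      rw [← one_div_pow]
      exact pow_le_pow_left₀ (truncInv_nonneg hc _) (truncInv_le hc _) 2
    have h4 : ((G ω - γ) * truncInv c (D ω)) ^ 2 ≤ (G ω - γ) ^ 2 / c ^ 2 := by
      rw [mul_pow]
      refine (mul_le_mul_of_nonneg_left h3 (sq_nonneg _)).trans (le_of_eq ?_)
      ring
    have h5 : (γ * (truncInv c (D ω) - truncInv c d)) ^ 2 ≤ γ ^ 2 * ((D ω - d) ^ 2 / c ^ 4) := by
      rw [mul_pow]
      exact mul_le_mul_of_nonneg_left h2 (sq_nonneg _)
    have h6 : (S ω + G ω) * truncInv c (D ω) - γ * truncInv c d - S ω * b =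
        S ω * (truncInv c (D ω) - truncInv c d) + (truncInv c d - b) * S ω +
        (G ω - γ) * truncInv c (D ω) + γ * (truncInv c (D ω) - truncInv c d) := by ring
    have h7 : ∀ a b c d : ℝ, (a + b + c + d) ^ 2 ≤ 4 * (a ^ 2 + b ^ 2 + c ^ 2 + d ^ 2) := by
      intro a b c d
      nlinarith [sq_nonneg (a - b), sq_nonneg (a - c), sq_nonneg (a - d), sq_nonneg (b - c),
        sq_nonneg (b - d), sq_nonneg (c - d)]
    rw [h6]
    refine (h7 _ _ _ _).trans ?_
    rw [mul_pow (S ω), mul_pow (truncInv c d - b)]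
    linarith
  · have h1 : ∫ ω, 4 * (S ω ^ 2 * (truncInv c (D ω) - truncInv c d) ^ 2 +
        (truncInv c d - b) ^ 2 * S ω ^ 2 + (G ω - γ) ^ 2 / c ^ 2 +
        γ ^ 2 * ((D ω - d) ^ 2 / c ^ 4)) ∂μ =
        4 * ((∫ ω, S ω ^ 2 * (truncInv c (D ω) - truncInv c d) ^ 2 ∂μ) +
        (truncInv c d - b) ^ 2 * (∫ ω, S ω ^ 2 ∂μ) + (∫ ω, (G ω - γ) ^ 2 ∂μ) / c ^ 2 +
        γ ^ 2 * ((∫ ω, (D ω - d) ^ 2 ∂μ) / c ^ 4)) := by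
      rw [integral_const_mul, integral_add, integral_add, integral_add hi4 (hi3.const_mul _),
        integral_const_mul, integral_div, integral_const_mul, integral_div]
      · exact hi4.add (hi3.const_mul _)
      · exact hi1.div_const _
      · exact (hi4.add (hi3.const_mul _)).add (hi1.div_const _)
      · exact (hi2.div_const _).const_mul _
    rw [h1]
    gcongr

end IsIIDSample

end Sample

/-! ### Pointwise comparison of a weighted average with its truncation. -/

section WeightedAverage

variable {s : Finset ℕ} {a y : ℕ → ℝ}

/-- Cauchy-Schwarz and `∑ a² ≤ (∑ a)²`. No lower bound on the total weight enters, so this holds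
where the denominator is small; where it vanishes, the quotient is 0. -/
theorem sq_weighted_average_le (ha : ∀ i ∈ s, 0 ≤ a i) :
    ((∑ i ∈ s, a i * y i) / ∑ i ∈ s, a i) ^ 2 ≤ ∑ i ∈ s, y i ^ 2 := by
  have hy : 0 ≤ ∑ i ∈ s, y i ^ 2 := Finset.sum_nonneg fun i _ => sq_nonneg _
  have hA : 0 ≤ ∑ i ∈ s, a i := Finset.sum_nonneg ha
  rcases hA.eq_or_lt with h0 | h0
  · simpa [← h0] using hy
  have h1 := Finset.sum_mul_sq_le_sq_mul_sq s a y
  have h2 : ∑ i ∈ s, a i ^ 2 ≤ (∑ i ∈ s, a i) ^ 2 := by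
    rw [sq, Finset.sum_mul]
    refine Finset.sum_le_sum fun i hi => ?_
    rw [sq]
    exact mul_le_mul_of_nonneg_left (Finset.single_le_sum ha hi) (ha i hi)
  rw [div_pow, div_le_iff₀ (by positivity), mul_comm]
  exact h1.trans (mul_le_mul_of_nonneg_right h2 hy)

/-- A weighted average differs from its version with truncated denominator only if the
denominator is small. -/
theorem sq_weighted_average_sub_truncated_le (ha : ∀ i ∈ s, 0 ≤ a i) {n : ℕ} (hn : 0 < n) {c : ℝ}
    (hc : 0 < c) (M : ℝ) :
    ((∑ i ∈ s, a i * y i) / (∑ i ∈ s, a i) -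
      (M + (∑ i ∈ s, a i * (y i - M)) / n * truncInv c ((∑ i ∈ s, a i) / n))) ^ 2 ≤
    if (∑ i ∈ s, a i) / n < c then 2 * (M ^ 2 + ∑ i ∈ s, y i ^ 2) else 0 := by
  have hn' : (0 : ℝ) < n := by exact_mod_cast hn
  have hA : 0 ≤ ∑ i ∈ s, a i := Finset.sum_nonneg ha
  have hsq := sq_weighted_average_le (y := y) ha
  have hsum : ∑ i ∈ s, a i * (y i - M) = ∑ i ∈ s, a i * y i - (∑ i ∈ s, a i) * M := by
    simp_rw [mul_sub, Finset.sum_sub_distrib, Finset.sum_mul]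
  have hN0 : ∑ i ∈ s, a i = 0 → ∑ i ∈ s, a i * y i = 0 := fun h0 => by
    rw [Finset.sum_eq_zero_iff_of_nonneg ha] at h0
    exact Finset.sum_eq_zero fun i hi => by rw [h0 i hi, zero_mul]
  rw [hsum]
  set A := ∑ i ∈ s, a i
  set N := ∑ i ∈ s, a i * y i
  split_ifs with hlt
  · rw [truncInv_of_ge hlt.le]
    -- Below the truncation level the difference factors, with second factor in `[0, 1]`. If `A = 0`
    -- then `N = 0`, and the convention `N / 0 = 0` is consistent with the formula.
    have h1 : N / A - (M + (N - A * M) / n * (1 / c)) = (N / A - M) * (1 - A / n / c) := by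
      rcases hA.eq_or_lt with h0 | h0
      · simp [hN0 h0.symm, ← h0]
      · field_simp; ring
    rw [h1, mul_pow]
    have h2 : 0 ≤ A / n / c := by positivity
    have h3 : A / n / c ≤ 1 := by rw [div_le_one hc]; exact hlt.le
    have h4 : (1 - A / n / c) ^ 2 ≤ 1 := by
      rw [sq_le_one_iff_abs_le_one, abs_le]; constructor <;> linarith
    calc (N / A - M) ^ 2 * (1 - A / n / c) ^ 2 ≤ (N / A - M) ^ 2 :=
          mul_le_of_le_one_right (sq_nonneg _) h4
      _ ≤ 2 * (M ^ 2 + (N / A) ^ 2) := by nlinarith [sq_nonneg (N / A + M)]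
      _ ≤ _ := by linarith
  · have hle : c ≤ A / n := not_lt.1 hlt
    have hApos : 0 < A := by
      have := hc.trans_le hle
      rwa [div_pos_iff_of_pos_right hn'] at this
    rw [truncInv_of_le hle]
    apply le_of_eq
    rw [sq_eq_zero_iff]
    field_simp
    ring

end WeightedAverage

/-! ### Exponential bounds for the event of small total weight. -/

section Sample

/-- `exp y ≥ 1 + y + y² / 2`, and `(1 + y + y² / 2) (1 - y + y² / 2) = 1 + y⁴ / 4 ≥ 1`. -/
theorem exp_neg_le_one_sub_add {y : ℝ} (hy : 0 ≤ y) : Real.exp (-y) ≤ 1 - y + y ^ 2 / 2 := by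
  have h1 := Real.quadratic_le_exp_of_nonneg hy
  have h2 : 0 < 1 + y + y ^ 2 / 2 := by positivity
  rw [Real.exp_neg]
  refine (inv_anti₀ h2 h1).trans ?_
  rw [inv_le_iff_one_le_mul₀ h2]
  nlinarith [sq_nonneg (y ^ 2)]

variable {Ω : Type*} [MeasurableSpace Ω] {μ : Measure Ω} [IsProbabilityMeasure μ]
  {Z : ℕ → Ω → ℝ × ℝ} {ν : Measure (ℝ × ℝ)} [IsProbabilityMeasure ν] {J : Finset ℕ}
  {m f σ2 w : ℝ → ℝ} {n : ℕ} {c : ℝ}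

namespace IsIIDSample

/-- Lower tail bound for sums of independent nonnegative random variables. -/
theorem measureReal_sum_le (hZ : IsIIDSample μ Z ν J) (hw : Measurable w) (hw0 : ∀ u, 0 ≤ w u)
    (hw2 : MemLp (fun p : ℝ × ℝ => w p.1) 2 ν) {θ : ℝ} (hθ : 0 ≤ θ) (y : ℝ) :
    μ.real {ω | ∑ i ∈ J, w (Z i ω).1 ≤ y} ≤
      Real.exp (θ * y - J.card * (θ * (∫ p, w p.1 ∂ν) - θ ^ 2 * (∫ p, w p.1 ^ 2 ∂ν) / 2)) := by
  have hwm : Measurable fun p : ℝ × ℝ => w p.1 := by fun_prop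
  have hb : ∀ (T : Finset ℕ) ω, Real.exp (-θ * ∑ i ∈ T, w (Z i ω).1) ≤ 1 := fun T ω => by
    rw [Real.exp_le_one_iff, neg_mul, neg_nonpos]
    exact mul_nonneg hθ (Finset.sum_nonneg fun i _ => hw0 _)
  have hint : Integrable (fun ω => Real.exp (-θ * ∑ i ∈ J, w (Z i ω).1)) μ := by
    refine Integrable.of_bound (Real.measurable_exp.comp_aemeasurable
      ((hZ.aemeasurable_sum_fst hw J).const_mul _)).aestronglyMeasurable 1 (ae_of_all _ fun ω => ?_)
    rw [Real.norm_eq_abs, abs_of_nonneg (Real.exp_pos _).le]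
    exact hb J ω
  have h1 := measure_le_le_exp_mul_mgf (μ := μ) (X := fun ω => ∑ i ∈ J, w (Z i ω).1) y
    (neg_nonpos.2 hθ) hint
  have h2 := (hZ.indep.comp (fun _ p => w p.1) fun _ => hwm).mgf_sum₀ (t := -θ)
    (fun i => hwm.comp_aemeasurable (hZ.aemeasurable i)) J
  have h3 : (∑ i ∈ J, (fun p : ℝ × ℝ => w p.1) ∘ Z i) = fun ω => ∑ i ∈ J, w (Z i ω).1 := by
    ext ω; simp
  rw [h3] at h2
  rw [h2, neg_neg] at h1
  refine h1.trans ?_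
  set v := θ * (∫ p, w p.1 ∂ν) - θ ^ 2 * (∫ p, w p.1 ^ 2 ∂ν) / 2 with hv
  -- For nonnegative summands the quadratic bound on `exp (-y)` integrates to `1 - v ≤ exp (-v)`, so
  -- two moments suffice for the lower tail.
  have h4 : ∀ i ∈ J, mgf ((fun p : ℝ × ℝ => w p.1) ∘ Z i) μ (-θ) ≤ Real.exp (-v) := fun i hi => by
    have h5 : mgf ((fun p : ℝ × ℝ => w p.1) ∘ Z i) μ (-θ) =
        ∫ p, Real.exp (-(θ * w p.1)) ∂ν := by
      simp only [mgf, Function.comp_apply, neg_mul]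
      exact hZ.integral_comp hi (φ := fun p => Real.exp (-(θ * w p.1))) (by fun_prop)
    have hi1 : Integrable (fun p : ℝ × ℝ => w p.1) ν := hw2.integrable one_le_two
    have hi2 : Integrable (fun p : ℝ × ℝ => w p.1 ^ 2) ν := hw2.integrable_sq
    have hi12 : Integrable (fun p : ℝ × ℝ => 1 - θ * w p.1) ν :=
      (integrable_const _).sub (hi1.const_mul θ)
    have hi3 : Integrable (fun p : ℝ × ℝ => θ ^ 2 / 2 * w p.1 ^ 2) ν := hi2.const_mul _
    have h6 : ∫ p, (1 - θ * w p.1 + θ ^ 2 / 2 * w p.1 ^ 2) ∂ν = 1 - v := by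
      rw [integral_add hi12 hi3, integral_sub (integrable_const _) (hi1.const_mul θ),
        integral_const_mul, integral_const_mul]
      simp [hv]; ring
    rw [h5]
    refine (integral_mono_of_nonneg (ae_of_all _ fun p => (Real.exp_pos _).le) (hi12.add hi3)
      (ae_of_all _ fun p => ?_)).trans ?_
    · refine (exp_neg_le_one_sub_add (mul_nonneg hθ (hw0 p.1))).trans (le_of_eq ?_)
      simp only [Pi.add_apply]; ring
    · refine (le_of_eq h6).trans ?_
      have := Real.add_one_le_exp (-v)
      linarith
  have h5 : ∏ i ∈ J, mgf ((fun p : ℝ × ℝ => w p.1) ∘ Z i) μ (-θ) ≤ Real.exp (-v) ^ J.card := by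
    rw [← Finset.prod_const]
    exact Finset.prod_le_prod (fun i _ => mgf_nonneg) h4
  calc _ ≤ Real.exp (θ * y) * Real.exp (-v) ^ J.card :=
        mul_le_mul_of_nonneg_left h5 (Real.exp_pos _).le
    _ = _ := by rw [← Real.exp_nat_mul, ← Real.exp_add]; congr 1; ring

/-- Observations are bounded on the event of small total weight, which by independence is
determined by the other observations up to a factor. -/
theorem integral_indicator_sq_le (hZ : IsIIDSample μ Z ν J) (hw : Measurable w)
    (hw0 : ∀ u, 0 ≤ w u) {i : ℕ} (hi : i ∈ J) {A : Set Ω} {y ρ : ℝ}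
    (hA : ∀ ω ∈ A, ∑ k ∈ J, w (Z k ω).1 ≤ y)
    (hρ : μ.real {ω | ∑ k ∈ J.erase i, w (Z k ω).1 ≤ y} ≤ ρ)
    {φ : ℝ × ℝ → ℝ} (hφm : Measurable φ) (hφ : MemLp φ 2 ν) :
    ∫ ω, A.indicator (fun ω => φ (Z i ω) ^ 2) ω ∂μ ≤ (∫ p, φ p ^ 2 ∂ν) * ρ := by
  set B : Set (J.erase i → ℝ × ℝ) := {z | ∑ k, w (z k).1 ≤ y} with hB
  have hBm : MeasurableSet B := measurableSet_le (by fun_prop) measurable_const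
  set F : (J.erase i → ℝ × ℝ) → ℝ := B.indicator 1 with hF
  have hFm : Measurable F := measurable_one.indicator hBm
  have hsum : ∀ ω, ∑ k : J.erase i, w (Z k ω).1 = ∑ k ∈ J.erase i, w (Z k ω).1 := fun ω =>
    Finset.sum_coe_sort (J.erase i) fun k => w (Z k ω).1
  have hFZ : ∀ ω, F (fun j => Z j ω) =
      {ω | ∑ k ∈ J.erase i, w (Z k ω).1 ≤ y}.indicator 1 ω := fun ω => by
    simp only [hF, hB, Set.indicator, Set.mem_ofPred_eq, hsum ω, Pi.one_apply]
  have hset : NullMeasurableSet {ω | ∑ k ∈ J.erase i, w (Z k ω).1 ≤ y} μ :=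
    nullMeasurableSet_le (hZ.aemeasurable_sum_fst hw _) aemeasurable_const
  have h1 := hZ.integral_comp_mul (μ := μ) hi (Finset.notMem_erase i J) (φ := fun p => φ p ^ 2)
    (by fun_prop) hFm
  have h2 : ∫ ω, F (fun j => Z j ω) ∂μ = μ.real {ω | ∑ k ∈ J.erase i, w (Z k ω).1 ≤ y} := by
    simp_rw [hFZ]
    rw [integral_indicator₀ hset]
    simp
  have hφi : Integrable (fun ω => φ (Z i ω) ^ 2) μ :=
    hZ.integrable_comp (φ := fun p => φ p ^ 2) hi hφ.integrable_sq
  have hint : Integrable (fun ω => φ (Z i ω) ^ 2 * F (fun j => Z j ω)) μ := by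
    refine hφi.mul_bdd (c := 1)
      (hFm.comp_aemeasurable (hZ.aemeasurable_tuple _)).aestronglyMeasurable
      (ae_of_all _ fun ω => ?_)
    rw [hFZ]
    simp only [Set.indicator]
    split_ifs <;> simp
  calc _ ≤ ∫ ω, φ (Z i ω) ^ 2 * F (fun j => Z j ω) ∂μ := by
        refine integral_mono_of_nonneg
          (ae_of_all _ fun ω => Set.indicator_nonneg (fun ω _ => sq_nonneg _) ω) hint
          (ae_of_all _ fun ω => ?_)
        have hF0 : 0 ≤ F (fun j => Z j ω) := Set.indicator_nonneg (fun _ _ => zero_le_one) _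
        by_cases hω : ω ∈ A
        · have h3 := hA ω hω
          rw [← Finset.add_sum_erase J _ hi] at h3
          have h4 : ω ∈ {ω | ∑ k ∈ J.erase i, w (Z k ω).1 ≤ y} := by
            have := hw0 (Z i ω).1
            simp only [Set.mem_ofPred_eq]; linarith
          simp only [Set.indicator_of_mem hω]
          rw [hFZ, Set.indicator_of_mem h4]; simp
        · simp only [Set.indicator_of_notMem hω]
          positivity
    _ = (∫ p, φ p ^ 2 ∂ν) * μ.real {ω | ∑ k ∈ J.erase i, w (Z k ω).1 ≤ y} := by rw [h1, h2]
    _ ≤ _ := mul_le_mul_of_nonneg_left hρ (integral_nonneg fun p => sq_nonneg _)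

end IsIIDSample

end Sample

/-! ### Characteristic functions of null arrays. -/

section CharFun

open Complex in
-- For `|y| ≤ 1` the Taylor remainder is at most `|y|³`, hence at most `ε y²` once `|y| ≤ ε`. For
-- `|y| > 1` the terms add up to at most `2 + |y| + y² / 2`, which the factor 4 covers.
theorem norm_exp_mul_I_sub_le {ε y : ℝ} (hε : 0 < ε) (hε1 : ε ≤ 1) :
    ‖exp (y * I) - 1 - y * I + y ^ 2 / 2‖ ≤
      ε * y ^ 2 + 4 * {y : ℝ | ε < |y|}.indicator (fun y => y ^ 2) y := by
  have hsmall : |y| ≤ 1 → ‖exp (y * I) - 1 - y * I + y ^ 2 / 2‖ ≤ |y| * y ^ 2 := fun h => by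
    have hn : ‖(y : ℂ) * I‖ = |y| := by simp
    have h1 := Complex.exp_bound (x := y * I) (by rw [hn]; exact h) (n := 3) (by norm_num)
    rw [hn] at h1
    have h2 : exp (y * I) - 1 - y * I + y ^ 2 / 2 =
        exp (y * I) - ∑ i ∈ Finset.range 3, (y * I) ^ i / (i.factorial : ℂ) := by
      simp [Finset.sum_range_succ, mul_pow, Nat.factorial]
      ring
    rw [h2]
    refine h1.trans ?_
    rw [← sq_abs y]
    have h3 : 0 ≤ |y| := abs_nonneg y
    norm_num [Nat.factorial]
    have h4 : |y| * |y| ^ 2 = |y| ^ 3 := by ring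
    rw [sq_abs] at h4
    nlinarith [pow_nonneg h3 3]
  by_cases hy : ε < |y|
  · rw [Set.indicator_of_mem (show y ∈ {y : ℝ | ε < |y|} from hy)]
    have h0 : 0 ≤ ε * y ^ 2 := by positivity
    by_cases hy1 : |y| ≤ 1
    · have := hsmall hy1
      nlinarith [sq_nonneg y]
    · have h1 : ‖exp (y * I)‖ = 1 := Complex.norm_exp_ofReal_mul_I y
      have h2 : ‖exp (y * I) - 1 - y * I + y ^ 2 / 2‖ ≤ 1 + 1 + |y| + y ^ 2 / 2 := by
        refine (norm_add_le _ _).trans (add_le_add ((norm_sub_le _ _).trans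
          (add_le_add ((norm_sub_le _ _).trans ?_) ?_)) ?_)
        · rw [h1]; simp
        · simp
        · simp
      push Not at hy1
      have h3 : |y| ≤ y ^ 2 := by rw [← sq_abs y]; nlinarith
      linarith
  · rw [Set.indicator_of_notMem (show y ∉ {y : ℝ | ε < |y|} from hy)]
    have hy' := not_lt.1 hy
    have := hsmall (hy'.trans hε1)
    nlinarith [mul_le_mul_of_nonneg_right hy' (sq_nonneg y)]

variable {α : Type*} [MeasurableSpace α] {ν : Measure α} [IsProbabilityMeasure ν]

/-- Second order expansion of the characteristic functions of a null array satisfying the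
Lindeberg condition. -/
theorem tendsto_mul_integral_exp_sub_one {ξ : ℕ → α → ℝ} {v : ℝ} (hξm : ∀ n, Measurable (ξ n))
    (hξ2 : ∀ᶠ n in atTop, MemLp (ξ n) 2 ν) (hξ0 : ∀ᶠ n in atTop, ∫ p, ξ n p ∂ν = 0)
    (hv : Tendsto (fun n : ℕ => n * ∫ p, ξ n p ^ 2 ∂ν) atTop (𝓝 v))
    (hL : ∀ ε : ℝ, 0 < ε → Tendsto (fun n : ℕ => n * ∫ p, {p | ε < |ξ n p|}.indicator
      (fun p => ξ n p ^ 2) p ∂ν) atTop (𝓝 0)) (t : ℝ) :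
    Tendsto (fun n : ℕ => (n : ℂ) * ((∫ p, Complex.exp (((t * ξ n p : ℝ) : ℂ) * Complex.I) ∂ν) - 1))
      atTop (𝓝 ((-(t ^ 2 * v / 2) : ℝ) : ℂ)) := by
  have hv' : Tendsto (fun n : ℕ => (((-(t ^ 2 / 2 * (n * ∫ p, ξ n p ^ 2 ∂ν)) : ℝ)) : ℂ)) atTop
      (𝓝 ((-(t ^ 2 * v / 2) : ℝ) : ℂ)) := by
    have := (hv.const_mul (t ^ 2 / 2)).neg
    have h2 := (Complex.continuous_ofReal.tendsto _).comp this
    have h3 : t ^ 2 / 2 * v = t ^ 2 * v / 2 := by ring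
    rwa [h3] at h2
  -- The Lindeberg condition is used at the level `ε / |t|`, so `t = 0` is set apart.
  rcases eq_or_ne t 0 with rfl | ht
  · simp
  refine hv'.congr_dist ?_
  rw [Metric.tendsto_nhds]
  intro η hη
  have hv0 : Tendsto (fun n : ℕ => t ^ 2 * (n * ∫ p, ξ n p ^ 2 ∂ν)) atTop (𝓝 (t ^ 2 * v)) :=
    hv.const_mul _
  set Q := |t ^ 2 * v| + 1 with hQ
  have hQpos : 0 < Q := by positivity
  -- Eventually `t² n E ξ² < Q`, so this choice keeps the contribution of the small values below `η
  -- / 2`.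
  set ε := min 1 (η / (2 * Q)) with hε
  have hεpos : 0 < ε := by positivity
  have hL' := (hL (ε / |t|) (by positivity)).const_mul (4 * t ^ 2)
  rw [mul_zero] at hL'
  filter_upwards [hv0.eventually_lt_const (show t ^ 2 * v < Q by
      have := le_abs_self (t ^ 2 * v); linarith), hL'.eventually_lt_const (half_pos hη), hξ2, hξ0]
    with n hn1 hn2 hn3 hn4
  have hm := hξm n
  have hsqi := hn3.integrable_sq
  have hi := hn3.integrable one_le_two
  have hset : MeasurableSet {p | ε / |t| < |ξ n p|} := measurableSet_lt measurable_const hm.abs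
  have hexp : Integrable (fun p => Complex.exp (((t * ξ n p : ℝ) : ℂ) * Complex.I)) ν := by
    refine Integrable.of_bound (by fun_prop : Measurable _).aestronglyMeasurable 1
      (ae_of_all _ fun p => ?_)
    rw [Complex.norm_exp_ofReal_mul_I]
  have hiC : Integrable (fun p => ((t * ξ n p : ℝ) : ℂ) * Complex.I) ν :=
    ((hi.const_mul t).ofReal).mul_const _
  have hsC : Integrable (fun p => ((t * ξ n p : ℝ) : ℂ) ^ 2 / 2) ν := by
    have : Integrable (fun p => (((t * ξ n p) ^ 2 / 2 : ℝ) : ℂ)) ν := by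
      have h1 : Integrable (fun p => (t * ξ n p) ^ 2 / 2) ν := by
        simpa only [mul_pow] using (hsqi.const_mul (t ^ 2)).div_const 2
      exact h1.ofReal
    simpa using this
  have hi1 : ∫ p, ((t * ξ n p : ℝ) : ℂ) * Complex.I ∂ν = 0 := by
    rw [integral_mul_const, integral_complex_ofReal, integral_const_mul, hn4]; simp
  have hi2 : ∫ p, ((t * ξ n p : ℝ) : ℂ) ^ 2 / 2 ∂ν = ((t ^ 2 / 2 * ∫ p, ξ n p ^ 2 ∂ν : ℝ) : ℂ) := by
    rw [← integral_const_mul, ← integral_complex_ofReal]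
    refine integral_congr_ae (ae_of_all _ fun p => ?_)
    push_cast; ring
  have hexp1 : Integrable (fun p => Complex.exp (((t * ξ n p : ℝ) : ℂ) * Complex.I) - 1) ν :=
    hexp.sub (integrable_const _)
  have hexp2 : Integrable (fun p => Complex.exp (((t * ξ n p : ℝ) : ℂ) * Complex.I) - 1 -
      ((t * ξ n p : ℝ) : ℂ) * Complex.I) ν := hexp1.sub hiC
  have hmain : (n : ℂ) * ((∫ p, Complex.exp (((t * ξ n p : ℝ) : ℂ) * Complex.I) ∂ν) - 1) -
      ((-(t ^ 2 / 2 * (n * ∫ p, ξ n p ^ 2 ∂ν)) : ℝ) : ℂ) =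
      (n : ℂ) * ∫ p, (Complex.exp (((t * ξ n p : ℝ) : ℂ) * Complex.I) - 1 -
        ((t * ξ n p : ℝ) : ℂ) * Complex.I + ((t * ξ n p : ℝ) : ℂ) ^ 2 / 2) ∂ν := by
    rw [integral_add hexp2 hsC, integral_sub hexp1 hiC, hi1, hi2,
      integral_sub hexp (integrable_const _)]
    simp
    ring
  rw [Real.dist_eq, sub_zero, abs_of_nonneg dist_nonneg, dist_comm, Complex.dist_eq, hmain, norm_mul,
    Complex.norm_natCast]
  have hbi : Integrable (fun p => ε * t ^ 2 * ξ n p ^ 2 +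
      4 * t ^ 2 * {p | ε / |t| < |ξ n p|}.indicator (fun p => ξ n p ^ 2) p) ν :=
    (hsqi.const_mul _).add ((hsqi.indicator hset).const_mul _)
  have hle : ‖∫ p, (Complex.exp (((t * ξ n p : ℝ) : ℂ) * Complex.I) - 1 -
        ((t * ξ n p : ℝ) : ℂ) * Complex.I + ((t * ξ n p : ℝ) : ℂ) ^ 2 / 2) ∂ν‖ ≤
      ∫ p, (ε * t ^ 2 * ξ n p ^ 2 +
        4 * t ^ 2 * {p | ε / |t| < |ξ n p|}.indicator (fun p => ξ n p ^ 2) p) ∂ν := by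
    refine norm_integral_le_of_norm_le hbi (ae_of_all _ fun p => ?_)
    refine (norm_exp_mul_I_sub_le hεpos (min_le_left _ _)).trans (le_of_eq ?_)
    have h1 : (ε < |t * ξ n p|) ↔ (ε / |t| < |ξ n p|) := by
      rw [abs_mul, div_lt_iff₀ (abs_pos.2 ht), mul_comm]
    by_cases h2 : ε / |t| < |ξ n p|
    · simp only [Set.indicator, Set.mem_ofPred_eq, h1, h2, if_true]; ring
    · simp only [Set.indicator, Set.mem_ofPred_eq, h1, h2, if_false]; ring
  refine (mul_le_mul_of_nonneg_left hle (Nat.cast_nonneg n)).trans_lt ?_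
  rw [integral_add (hsqi.const_mul _) ((hsqi.indicator hset).const_mul _), integral_const_mul,
    integral_const_mul]
  have h3 : ε * (t ^ 2 * (n * ∫ p, ξ n p ^ 2 ∂ν)) ≤ η / 2 := by
    calc _ ≤ η / (2 * Q) * Q := mul_le_mul (min_le_right _ _) hn1.le
          (mul_nonneg (sq_nonneg _) (mul_nonneg (Nat.cast_nonneg n)
            (integral_nonneg fun p => sq_nonneg _))) (by positivity)
      _ = η / 2 := by field_simp
  calc _ = ε * (t ^ 2 * (n * ∫ p, ξ n p ^ 2 ∂ν)) + 4 * t ^ 2 *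
        (n * ∫ p, {p | ε / |t| < |ξ n p|}.indicator (fun p => ξ n p ^ 2) p ∂ν) := by ring
    _ < η := by linarith

end CharFun

/-! ### Removing finitely many waypoints does not affect limits. -/

section Card

theorem eventually_card_range_sdiff (C : Finset ℕ) :
    ∀ᶠ n in atTop, (Finset.range n \ C).card + C.card = n := by
  obtain ⟨N, hN⟩ := C.exists_nat_subset_range
  filter_upwards [eventually_ge_atTop N] with n hn
  have h : C ⊆ Finset.range n := hN.trans (Finset.range_mono hn)
  rw [Finset.card_sdiff_of_subset h, Finset.card_range]
  have := Finset.card_le_card h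
  rw [Finset.card_range] at this
  omega

theorem tendsto_card_range_sdiff_div (C : Finset ℕ) :
    Tendsto (fun n : ℕ => ((Finset.range n \ C).card : ℝ) / n) atTop (𝓝 1) := by
  have h1 : Tendsto (fun n : ℕ => 1 - (C.card : ℝ) / n) atTop (𝓝 (1 - 0)) :=
    tendsto_const_nhds.sub (tendsto_const_div_atTop_nhds_zero_nat _)
  rw [sub_zero] at h1
  refine h1.congr' ?_
  filter_upwards [eventually_card_range_sdiff C, eventually_gt_atTop 0] with n hn hn0
  have hn' : (n : ℝ) ≠ 0 := by exact_mod_cast hn0.ne'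
  have : ((Finset.range n \ C).card : ℝ) + C.card = n := by exact_mod_cast hn
  field_simp
  linarith

theorem card_range_sdiff_le (C : Finset ℕ) (n : ℕ) : (Finset.range n \ C).card ≤ n := by
  simpa using Finset.card_le_card (Finset.sdiff_subset (s := Finset.range n) (t := C))

/-- The exponent is eventually `n - C.card`, and the missing `C.card` factors tend to 1, so the
limit of the `n`-th powers persists. -/
theorem tendsto_one_add_pow_card {g : ℕ → ℂ} {z : ℂ} (C : Finset ℕ)
    (hg : Tendsto (fun n : ℕ => n * g n) atTop (𝓝 z)) :
    Tendsto (fun n => (1 + g n) ^ (Finset.range n \ C).card) atTop (𝓝 (Complex.exp z)) := by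
  have h1 := Complex.tendsto_one_add_pow_exp_of_tendsto hg
  have hg0 : Tendsto g atTop (𝓝 0) := by
    have h2 : Tendsto (fun n : ℕ => (n : ℂ)⁻¹ * (n * g n)) atTop (𝓝 (0 * z)) :=
      tendsto_inv_atTop_nhds_zero_nat.mul hg
    rw [zero_mul] at h2
    refine h2.congr' ?_
    filter_upwards [eventually_ne_atTop 0] with n hn
    have : (n : ℂ) ≠ 0 := by exact_mod_cast hn
    field_simp
  have h3 : Tendsto (fun n => 1 + g n) atTop (𝓝 1) := by simpa using hg0.const_add 1
  have h4 := h1.div (h3.pow C.card) (by simp)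
  rw [one_pow, div_one] at h4
  refine h4.congr' ?_
  filter_upwards [eventually_card_range_sdiff C, h3.eventually_ne one_ne_zero] with n hn hne
  rw [Pi.div_apply, div_eq_iff (pow_ne_zero _ hne), ← pow_add, hn]

end Card

/-! ### A Lindeberg central limit theorem. -/

section CLT

variable {Ω : Type*} [MeasurableSpace Ω] {μ : Measure Ω} [IsProbabilityMeasure μ]
  {Z : ℕ → Ω → ℝ × ℝ} {ν : Measure (ℝ × ℝ)} [IsProbabilityMeasure ν]

/-- The Lindeberg central limit theorem for row sums `∑ ξ n (Z i)`, where `i < n` is not in `C`. -/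
theorem tendstoInDistribution_sum {C : Finset ℕ} (hZ : ∀ n, IsIIDSample μ Z ν (Finset.range n \ C))
    {ξ : ℕ → ℝ × ℝ → ℝ} {v : ℝ} (hv0 : 0 ≤ v) (hξm : ∀ n, Measurable (ξ n))
    (hξ2 : ∀ᶠ n in atTop, MemLp (ξ n) 2 ν) (hξ0 : ∀ᶠ n in atTop, ∫ p, ξ n p ∂ν = 0)
    (hv : Tendsto (fun n : ℕ => n * ∫ p, ξ n p ^ 2 ∂ν) atTop (𝓝 v))
    (hL : ∀ ε : ℝ, 0 < ε → Tendsto (fun n : ℕ => n * ∫ p, {p | ε < |ξ n p|}.indicator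
      (fun p => ξ n p ^ 2) p ∂ν) atTop (𝓝 0)) :
    TendstoInDistribution (fun n ω => ∑ i ∈ Finset.range n \ C, ξ n (Z i ω)) atTop (id : ℝ → ℝ)
      (fun _ => μ) (gaussianReal 0 v.toNNReal) where
  forall_aemeasurable n := Finset.aemeasurable_fun_sum _ fun i _ =>
    (hξm n).comp_aemeasurable ((hZ n).aemeasurable i)
  tendsto := by
    refine ProbabilityMeasure.tendsto_iff_tendsto_charFun.2 fun t => ?_
    simp only [ProbabilityMeasure.coe_mk, Measure.map_id, charFun_gaussianReal]
    have h1 := tendsto_one_add_pow_card C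
      (tendsto_mul_integral_exp_sub_one hξm hξ2 hξ0 hv hL t)
    have h2 : Complex.exp (t * (0 : ℝ) * Complex.I - (v.toNNReal : ℝ) * t ^ 2 / 2) =
        Complex.exp ((-(t ^ 2 * v / 2) : ℝ) : ℂ) := by
      rw [Real.coe_toNNReal v hv0]
      congr 1
      push_cast
      ring
    rw [h2]
    refine h1.congr fun n => ?_
    have hind : iIndepFun (fun i ω => ξ n (Z i ω)) μ :=
      (hZ n).indep.comp (fun _ => ξ n) fun _ => hξm n
    rw [iIndepFun.charFun_map_fun_finsetSum_eq_prod (X := fun i ω => ξ n (Z i ω))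
      (fun i _ => (hξm n).comp_aemeasurable ((hZ n).aemeasurable i)) (hind.restrict _),
      Finset.prod_apply, Finset.prod_congr rfl fun i hi => ?_, Finset.prod_const]
    rw [charFun_apply_real, integral_map (φ := fun ω => ξ n (Z i ω)) ((hξm n).comp_aemeasurable ((hZ n).aemeasurable i))
      (by fun_prop)]
    have h3 := ((hZ n).hasLaw i hi).integral_comp
      (f := fun p => Complex.exp (t * ξ n p * Complex.I))
      (by have := hξm n; fun_prop : Measurable _).aestronglyMeasurable
    refine Eq.trans h3 ?_
    push_cast
    ring

end CLT

/-! ### From a mean square linearization to bias, variance and limit law. -/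

section Linear

variable {Ω : Type*} [MeasurableSpace Ω] {μ : Measure Ω} [IsProbabilityMeasure μ]
  {Z : ℕ → Ω → ℝ × ℝ} {ν : Measure (ℝ × ℝ)} [IsProbabilityMeasure ν] {C : Finset ℕ}
  {K m f σ2 : ℝ → ℝ} {h : ℕ → ℝ} {x : ℝ}

/-- Mean square convergence implies convergence in probability. -/
theorem tendstoInMeasure_of_tendsto_integral_sq {R : ℕ → Ω → ℝ} {s : ℕ → ℝ} (hs : ∀ n, 0 ≤ s n)
    (hR : ∀ᶠ n in atTop, MemLp (R n) 2 μ)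
    (hlim : Tendsto (fun n => s n * ∫ ω, R n ω ^ 2 ∂μ) atTop (𝓝 0)) :
    TendstoInMeasure μ (fun n ω => √(s n) * R n ω) atTop (fun _ => 0) := by
  rw [tendstoInMeasure_iff_measureReal_norm]
  intro ε hε
  have h1 : Tendsto (fun n => (s n * ∫ ω, R n ω ^ 2 ∂μ) / ε ^ 2) atTop (𝓝 0) := by
    simpa using hlim.div_const (ε ^ 2)
  refine squeeze_zero' (Eventually.of_forall fun n => measureReal_nonneg) ?_ h1
  filter_upwards [hR] with n hn
  have hi : Integrable (fun ω => s n * R n ω ^ 2) μ := hn.integrable_sq.const_mul _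
  have h2 := mul_meas_ge_le_integral_of_nonneg (μ := μ)
    (ae_of_all _ fun ω => mul_nonneg (hs n) (sq_nonneg (R n ω))) hi (ε ^ 2)
  rw [integral_const_mul] at h2
  rw [le_div_iff₀ (by positivity), mul_comm]
  refine le_trans (mul_le_mul_of_nonneg_left (measureReal_mono ?_) (by positivity)) h2
  intro ω hω
  have h3 : ε ≤ ‖√(s n) * R n ω - 0‖ := hω
  rw [sub_zero, Real.norm_eq_abs] at h3
  have h4 := pow_le_pow_left₀ hε.le h3 2
  rw [sq_abs, mul_pow, Real.sq_sqrt (hs n)] at h4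
  exact h4

/-- The average of the kernel weighted errors. -/
noncomputable def noiseAverage (Z : ℕ → Ω → ℝ × ℝ) (C : Finset ℕ) (K m : ℝ → ℝ) (h : ℕ → ℝ)
    (x : ℝ) (n : ℕ) : Ω → ℝ :=
  average Z (Finset.range n \ C) n fun p => kernelWeight K (h n) x p.1 * regressionError m p

namespace IsRegularDesign

/-- `σ2` is a version of the conditional variance and is known to be nonnegative only almost
everywhere. At the point `x` the sign follows because the expression is a positive multiple of a
limit of second moments, so `toNNReal` in the limit law loses nothing. -/
theorem limitVariance_nonneg (H : IsRegularDesign ν K m f σ2 h x) :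
    0 ≤ σ2 x * kernelRoughness K / f x := by
  have h1 : 0 ≤ σ2 x * f x * kernelRoughness K :=
    ge_of_tendsto H.tendsto_integral_weight_mul_error_sq.1 (Eventually.of_forall fun n =>
      mul_nonneg (H.h_pos n).le (integral_nonneg fun p => sq_nonneg _))
  have hf := H.f_pos
  have h2 : σ2 x * kernelRoughness K / f x = σ2 x * f x * kernelRoughness K / f x ^ 2 := by
    field_simp
  rw [h2]; positivity

theorem eventually_memLp_noiseAverage (H : IsRegularDesign ν K m f σ2 h x)
    (hZ : ∀ n, IsIIDSample μ Z ν (Finset.range n \ C)) :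
    ∀ᶠ n in atTop, MemLp (noiseAverage Z C K m h x n) 2 μ ∧
      ∫ ω, noiseAverage Z C K m h x n ω ∂μ = 0 := by
  filter_upwards [H.tendsto_integral_weight_mul_error_sq.2] with n hn
  exact ⟨(hZ n).memLp_average' hn n,
    (hZ n).integral_average_error H.law (H.measurable_weight n) hn n⟩

theorem tendsto_integral_noiseAverage_sq (H : IsRegularDesign ν K m f σ2 h x)
    (hZ : ∀ n, IsIIDSample μ Z ν (Finset.range n \ C)) :
    Tendsto (fun n : ℕ => n * h n * ∫ ω, (noiseAverage Z C K m h x n ω * (1 / f x)) ^ 2 ∂μ) atTop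
      (𝓝 (σ2 x * kernelRoughness K / f x)) := by
  have hf := H.f_pos
  obtain ⟨h1, h2⟩ := H.tendsto_integral_weight_mul_error_sq
  have h3 := ((tendsto_card_range_sdiff_div C).mul h1).div_const (f x ^ 2)
  have h4 : 1 * (σ2 x * f x * kernelRoughness K) / f x ^ 2 = σ2 x * kernelRoughness K / f x := by
    field_simp
  rw [h4] at h3
  refine h3.congr' ?_
  filter_upwards [h2, eventually_gt_atTop 0] with n hn hn0
  have hn' : (n : ℝ) ≠ 0 := by exact_mod_cast hn0.ne'
  have hw := H.measurable_weight n
  have hE := H.law.measurable_error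
  have h5 := (hZ n).variance_sum
    (φ := fun p => kernelWeight K (h n) x p.1 * regressionError m p) (by fun_prop) hn
  have h0 := H.law.integral_error_mul hw (hn.integrable one_le_two)
  rw [variance_eq_integral ((hZ n).memLp_sum hn).aemeasurable,
    variance_eq_integral hn.aemeasurable, (hZ n).integral_sum (by fun_prop)
      (hn.integrable one_le_two), h0] at h5
  simp only [mul_zero, sub_zero] at h5
  have h6 : ∀ ω, (noiseAverage Z C K m h x n ω * (1 / f x)) ^ 2 = (1 / (n * f x) ^ 2) *
      (∑ i ∈ Finset.range n \ C,
        kernelWeight K (h n) x (Z i ω).1 * regressionError m (Z i ω)) ^ 2 := fun ω => by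
    simp only [noiseAverage, average]; field_simp
  simp_rw [h6]
  rw [integral_const_mul, h5]
  field_simp

theorem tendstoInDistribution_noiseAverage (H : IsRegularDesign ν K m f σ2 h x)
    (h_top : Tendsto (fun n : ℕ => n * h n) atTop atTop)
    (hZ : ∀ n, IsIIDSample μ Z ν (Finset.range n \ C)) :
    TendstoInDistribution
      (fun (n : ℕ) ω => √(n * h n) * (noiseAverage Z C K m h x n ω * (1 / f x)))
      atTop (id : ℝ → ℝ) (fun _ => μ)
      (gaussianReal 0 (σ2 x * kernelRoughness K / f x).toNNReal) := by
  have hf := H.f_pos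
  have hE := H.law.measurable_error
  obtain ⟨h1, h2⟩ := H.tendsto_integral_weight_mul_error_sq
  -- The scaled noise is the row sum of `κ n * (w ε)`, and `n κ² = h / (f x)²` reduces all its
  -- moments to the limits of `h E (w ε)²`.
  set κ : ℕ → ℝ := fun n => √(n * h n) / (n * f x) with hκ
  have hκ2 : ∀ n : ℕ, 0 < n → n * κ n ^ 2 = h n / f x ^ 2 := fun n hn => by
    have hn' : (n : ℝ) ≠ 0 := by exact_mod_cast hn.ne'
    rw [hκ, div_pow, Real.sq_sqrt (mul_nonneg (Nat.cast_nonneg n) (H.h_pos n).le)]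
    field_simp
  have hclt := tendstoInDistribution_sum (μ := μ) (Z := Z) (ν := ν) (C := C)
    (ξ := fun n p => κ n * (kernelWeight K (h n) x p.1 * regressionError m p))
    (v := σ2 x * kernelRoughness K / f x) hZ H.limitVariance_nonneg
    (fun n => by have := H.measurable_weight n; fun_prop)
    (by filter_upwards [h2] with n hn using hn.const_mul (κ n))
    (by
      filter_upwards [h2] with n hn
      rw [integral_const_mul, H.law.integral_error_mul (H.measurable_weight n)
        (hn.integrable one_le_two), mul_zero])
    (by
      have h3 := h1.div_const (f x ^ 2)
      have h4 : σ2 x * f x * kernelRoughness K / f x ^ 2 = σ2 x * kernelRoughness K / f x := by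
        field_simp
      rw [h4] at h3
      refine h3.congr' ?_
      filter_upwards [eventually_gt_atTop 0] with n hn
      simp_rw [mul_pow (κ n)]
      rw [integral_const_mul, ← mul_assoc, hκ2 n hn]
      ring)
    (fun ε hε => by
      -- For the scaled summands, `|κ w ε| > ε` means `|h w ε| > ε f(x) √(n h)`, a level that tends
      -- to infinity (the error and the tolerance share a letter here).
      have hs : Tendsto (fun n : ℕ => ε * f x * √(n * h n)) atTop atTop :=
        (Real.tendsto_sqrt_atTop.comp h_top).const_mul_atTop (by positivity)
      have h3 := (H.tendsto_integral_lindeberg hs).div_const (f x ^ 2)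
      rw [zero_div] at h3
      refine h3.congr' ?_
      filter_upwards [eventually_gt_atTop 0] with n hn
      have hn' : (0 : ℝ) < n := by exact_mod_cast hn
      have hh := H.h_pos n
      have hκpos : 0 < κ n := by
        have : 0 < √(n * h n) := Real.sqrt_pos.2 (by positivity)
        rw [hκ]; positivity
      have hiff : ∀ y : ℝ, ε * f x * √(n * h n) < |h n * y| ↔ ε < |κ n * y| := fun y => by
        rw [abs_mul, abs_mul, abs_of_pos hh, abs_of_pos hκpos]
        have hsq : √(n * h n) * √(n * h n) = n * h n := Real.mul_self_sqrt (by positivity)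
        have hsp : 0 < √(n * h n) := Real.sqrt_pos.2 (by positivity)
        have h5 : κ n * |y| = (h n * |y|) / (f x * √(n * h n)) := by
          rw [hκ, div_mul_eq_mul_div, div_eq_div_iff (by positivity) (by positivity)]
          linear_combination f x * |y| * hsq
        rw [h5, lt_div_iff₀ (by positivity), mul_assoc]
      have h6 : ∀ p : ℝ × ℝ, {p : ℝ × ℝ | ε < |κ n *
          (kernelWeight K (h n) x p.1 * regressionError m p)|}.indicator
          (fun p => (κ n * (kernelWeight K (h n) x p.1 * regressionError m p)) ^ 2) p = κ n ^ 2 *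
          {p : ℝ × ℝ | ε * f x * √(n * h n) < |h n *
          (kernelWeight K (h n) x p.1 * regressionError m p)|}.indicator
          (fun p => (kernelWeight K (h n) x p.1 * regressionError m p) ^ 2) p := fun p => by
        have h7 := hiff (kernelWeight K (h n) x p.1 * regressionError m p)
        by_cases h8 : ε < |κ n * (kernelWeight K (h n) x p.1 * regressionError m p)|
        · simp only [Set.indicator, Set.mem_ofPred_eq, h7, h8, if_true]; ring
        · simp only [Set.indicator, Set.mem_ofPred_eq, h7, h8, if_false]; ring
      simp_rw [h6]
      rw [integral_const_mul, ← mul_assoc, hκ2 n hn]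
      ring)
  refine hclt.congr (fun n => ae_of_all _ fun ω => ?_) (ae_of_all _ fun _ => rfl)
  simp only [hκ, noiseAverage, average]
  rw [← Finset.mul_sum]
  ring

/-- An estimator whose bias has the right order and whose centered version is linear up to a
negligible error has the interior asymptotics. -/
theorem hasInteriorAsymptotics (H : IsRegularDesign ν K m f σ2 h x)
    (h_top : Tendsto (fun n : ℕ => n * h n) atTop atTop)
    (hZ : ∀ n, IsIIDSample μ Z ν (Finset.range n \ C)) {T : ℕ → Ω → ℝ}
    (hTm : ∀ n, AEMeasurable (T n) μ) (hT2 : ∀ᶠ n in atTop, MemLp (T n) 2 μ)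
    (hbias : Tendsto (fun n => ((∫ ω, T n ω ∂μ) - m x) / h n ^ 2) atTop
      (𝓝 (1 / 2 * kernelSecondMoment K * (deriv (deriv m) x + 2 * deriv m x * deriv f x / f x))))
    (hlin : Tendsto (fun n : ℕ => n * h n * ∫ ω, (T n ω - (∫ ω', T n ω' ∂μ) -
      noiseAverage Z C K m h x n ω * (1 / f x)) ^ 2 ∂μ) atTop (𝓝 0)) :
    HasInteriorAsymptotics μ T h K m f σ2 x where
  memLp := hT2
  bias_expansion := by
    rw [isLittleO_iff_tendsto (fun n hn => absurd hn (pow_ne_zero 2 (H.h_pos n).ne'))]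
    have h1 := hbias.sub_const (1 / 2 * kernelSecondMoment K *
      (deriv (deriv m) x + 2 * deriv m x * deriv f x / f x))
    rw [sub_self] at h1
    refine h1.congr fun n => ?_
    have := (H.h_pos n).ne'
    simp only [bias]
    field_simp
  variance_expansion := by
    have hS := H.tendsto_integral_noiseAverage_sq hZ
    set S : ℕ → Ω → ℝ := fun n ω => noiseAverage Z C K m h x n ω * (1 / f x) with hSdef
    set R : ℕ → Ω → ℝ := fun n ω => T n ω - (∫ ω', T n ω' ∂μ) - S n ω with hR
    set r : ℕ → ℝ := fun n => n * h n * ∫ ω, R n ω ^ 2 ∂μ with hr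
    set V : ℕ → ℝ := fun n => n * h n * ∫ ω, S n ω ^ 2 ∂μ with hV
    have hnh : ∀ n : ℕ, 0 ≤ n * h n := fun n => mul_nonneg (Nat.cast_nonneg n) (H.h_pos n).le
    have hr0 : ∀ n, 0 ≤ r n := fun n =>
      mul_nonneg (hnh n) (integral_nonneg fun ω => sq_nonneg _)
    have hV0 : ∀ n, 0 ≤ V n := fun n =>
      mul_nonneg (hnh n) (integral_nonneg fun ω => sq_nonneg _)
    -- The cross term of the variance is at most `r / θ + θ V`. Taking `θ` slightly larger than `√r`
    -- makes both parts vanish; the summand `1 / (n + 1)` keeps `θ` positive when `r = 0`.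
    set θ : ℕ → ℝ := fun n => √(r n) + 1 / ((n : ℝ) + 1) with hθ
    have hθpos : ∀ n, 0 < θ n := fun n => by positivity
    have hsqrt : Tendsto (fun n => √(r n)) atTop (𝓝 0) := by
      have := (Real.continuous_sqrt.tendsto 0).comp hlin
      rwa [Real.sqrt_zero] at this
    have hθ0 : Tendsto θ atTop (𝓝 0) := by
      have h1 := hsqrt.add (tendsto_one_div_add_atTop_nhds_zero_nat (𝕜 := ℝ))
      rwa [add_zero] at h1
    have hbound : Tendsto (fun n => r n + √(r n) + θ n * V n) atTop (𝓝 0) := by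
      simpa using (hlin.add hsqrt).add (hθ0.mul hS)
    have hvar : Tendsto (fun n : ℕ => n * h n * Var[T n; μ] - V n) atTop (𝓝 0) := by
      refine squeeze_zero_norm' ?_ hbound
      filter_upwards [hT2, H.eventually_memLp_noiseAverage hZ] with n hn hSn
      have hSL : MemLp (S n) 2 μ := hSn.1.mul_const _
      have hRL : MemLp (R n) 2 μ := (hn.sub (memLp_const _)).sub hSL
      have hRS : Integrable (fun ω => R n ω * S n ω) μ := hRL.integrable_mul hSL
      have hvarT : Var[T n; μ] = (∫ ω, R n ω ^ 2 ∂μ) + 2 * (∫ ω, R n ω * S n ω ∂μ) +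
          ∫ ω, S n ω ^ 2 ∂μ := by
        have hi : Integrable (fun ω => R n ω ^ 2 + 2 * (R n ω * S n ω)) μ :=
          hRL.integrable_sq.add (hRS.const_mul 2)
        rw [variance_eq_integral (hTm n), ← integral_const_mul,
          ← integral_add hRL.integrable_sq (hRS.const_mul 2), ← integral_add hi hSL.integrable_sq]
        refine integral_congr_ae (ae_of_all _ fun ω => ?_)
        simp only [hR]; ring
      have hcross : |2 * ∫ ω, R n ω * S n ω ∂μ| ≤ (1 / θ n) * (∫ ω, R n ω ^ 2 ∂μ) +
          θ n * ∫ ω, S n ω ^ 2 ∂μ := by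
        rw [← integral_const_mul, ← integral_const_mul, ← integral_const_mul, ← integral_add
          (hRL.integrable_sq.const_mul _) (hSL.integrable_sq.const_mul _), ← Real.norm_eq_abs]
        refine norm_integral_le_of_norm_le
          ((hRL.integrable_sq.const_mul _).add (hSL.integrable_sq.const_mul _))
          (ae_of_all _ fun ω => ?_)
        rw [Real.norm_eq_abs, abs_mul, abs_mul, abs_two]
        have h3 := hθpos n
        have h4 : (1 / θ n) * R n ω ^ 2 + θ n * S n ω ^ 2 - 2 * (|R n ω| * |S n ω|) =
            (|R n ω| - θ n * |S n ω|) ^ 2 / θ n := by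
          rw [← sq_abs (R n ω), ← sq_abs (S n ω)]
          field_simp; ring
        have h5 : 0 ≤ (|R n ω| - θ n * |S n ω|) ^ 2 / θ n := by positivity
        linarith
      have h6 : r n / θ n ≤ √(r n) := by
        rw [div_le_iff₀ (hθpos n)]
        have h7 : √(r n) * √(r n) = r n := Real.mul_self_sqrt (hr0 n)
        have h8 : 0 ≤ √(r n) * (1 / ((n : ℝ) + 1)) := by positivity
        calc r n = √(r n) * √(r n) := h7.symm
          _ ≤ √(r n) * √(r n) + √(r n) * (1 / ((n : ℝ) + 1)) := le_add_of_nonneg_right h8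
          _ = √(r n) * θ n := (mul_add _ _ _).symm
      have h9 : n * h n * Var[T n; μ] - V n =
          r n + n * h n * (2 * ∫ ω, R n ω * S n ω ∂μ) := by
        rw [hvarT]; simp only [hr, hV]; ring
      rw [h9, Real.norm_eq_abs]
      refine (abs_add_le _ _).trans ?_
      rw [abs_of_nonneg (hr0 n), abs_mul, abs_of_nonneg (hnh n)]
      have h10 := mul_le_mul_of_nonneg_left hcross (hnh n)
      have h11 : n * h n * ((1 / θ n) * (∫ ω, R n ω ^ 2 ∂μ) + θ n * ∫ ω, S n ω ^ 2 ∂μ) =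
          r n / θ n + θ n * V n := by simp only [hr, hV]; ring
      linarith
    have hvar2 := hvar.add hS
    simp only [zero_add, hV, sub_add_cancel] at hvar2
    have hpos : ∀ᶠ n : ℕ in atTop, 0 < n * h n := h_top.eventually_gt_atTop 0
    rw [isLittleO_iff_tendsto' (by
      filter_upwards [hpos] with n hn h0
      exact absurd h0 (one_div_ne_zero hn.ne'))]
    have h1 := hvar2.sub_const (σ2 x * kernelRoughness K / f x)
    rw [sub_self] at h1
    refine h1.congr' ?_
    filter_upwards [hpos] with n hn
    have hf := H.f_pos
    have h2 : σ2 x * kernelRoughness K / (n * h n * f x) =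
        σ2 x * kernelRoughness K / f x / (n * h n) := by
      rw [div_div, mul_comm (f x)]
    rw [h2, div_div_eq_mul_div, div_one, sub_mul, div_mul_cancel₀ _ hn.ne']
    ring
  clt := by
    refine tendstoInDistribution_of_tendstoInMeasure_sub _ _
      (H.tendstoInDistribution_noiseAverage h_top hZ) ?_ fun n => ?_
    · have h1 := tendstoInMeasure_of_tendsto_integral_sq (μ := μ)
        (R := fun n ω => T n ω - (∫ ω', T n ω' ∂μ) - noiseAverage Z C K m h x n ω * (1 / f x))
        (s := fun n : ℕ => n * h n)
        (fun n => mul_nonneg (Nat.cast_nonneg n) (H.h_pos n).le) (by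
          filter_upwards [hT2, H.eventually_memLp_noiseAverage hZ] with n hn hSn
          exact (hn.sub (memLp_const _)).sub (hSn.1.mul_const _)) hlin
      have h2 : (fun (n : ℕ) ω => √(n * h n) * (T n ω - m x - bias μ (T n) (m x))) -
          (fun (n : ℕ) ω => √(n * h n) * (noiseAverage Z C K m h x n ω * (1 / f x))) =
          fun (n : ℕ) ω => √(n * h n) * (T n ω - (∫ ω', T n ω' ∂μ) -
            noiseAverage Z C K m h x n ω * (1 / f x)) := by
        ext n ω
        simp only [Pi.sub_apply, bias]; ring
      rw [h2]
      exact h1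
    · exact (((hTm n).sub_const _).sub_const _).const_mul _

end IsRegularDesign

end Linear

/-- The contribution `∑ l w(t j) v j / n` of the waypoints to a weighted average of values `v j`. -/
noncomputable def waypointAverage (C : Finset ℕ) (t : ℕ → ℝ) (K : ℝ → ℝ) (h l : ℕ → ℝ) (x : ℝ)
    (v : ℕ → ℝ) (n : ℕ) : ℝ :=
  (∑ j ∈ Finset.range n ∩ C, l n * kernelWeight K (h n) x (t j) * v j) / n

/-! ### Rates for the truncated estimator. -/

section Truncated

variable {Ω : Type*} [MeasurableSpace Ω] {μ : Measure Ω} [IsProbabilityMeasure μ]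
  {Z : ℕ → Ω → ℝ × ℝ} {ν : Measure (ℝ × ℝ)} [IsProbabilityMeasure ν] {C : Finset ℕ}
  {K m f σ2 : ℝ → ℝ} {h l t δ η : ℕ → ℝ} {x : ℝ}

namespace IsRegularDesign

/-- A waypoint has weight `O(h²)`, so its contribution divided by `h²` is of order `l / n = (l / (n
h⁴)) h⁴`. -/
theorem tendsto_waypointAverage (H : IsRegularDesign ν K m f σ2 h x)
    (hl : Tendsto (fun n : ℕ => l n / (n * h n ^ 4)) atTop (𝓝 0)) (hx : ∀ j ∈ C, x ≠ t j)
    (v : ℕ → ℝ) :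
    Tendsto (fun n => waypointAverage C t K h l x v n / h n ^ 2) atTop (𝓝 0) := by
  obtain ⟨B, hB0, hB⟩ := H.kernel.exists_tail
  have h1 : ∀ j ∈ C, Tendsto (fun n : ℕ => l n * kernelWeight K (h n) x (t j) * v j / n / h n ^ 2)
      atTop (𝓝 0) := fun j hj => by
    have hd : 0 < |x - t j| := abs_pos.2 (sub_ne_zero.2 (hx j hj))
    have h2 : Tendsto (fun n : ℕ => |l n / (n * h n ^ 4)| * (h n ^ 4 * (B / |x - t j| ^ 3 * |v j|)))
        atTop (𝓝 0) := by
      simpa using hl.abs.mul ((H.h_zero.pow 4).mul_const (B / |x - t j| ^ 3 * |v j|))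
    refine squeeze_zero_norm (fun n => ?_) h2
    have hh := H.h_pos n
    have h3 := kernelWeight_le_of_far H.kernel hB hh hd le_rfl
    have h4 := H.weight_nonneg n (t j)
    have h5 : l n * kernelWeight K (h n) x (t j) * v j / n / h n ^ 2 =
        l n / (n * h n ^ 4) * (h n ^ 2 * kernelWeight K (h n) x (t j) * v j) := by
      rcases Nat.eq_zero_or_pos n with h0 | h0
      · simp [h0]
      · have hn' : (n : ℝ) ≠ 0 := by exact_mod_cast h0.ne'
        field_simp
    rw [h5, Real.norm_eq_abs, abs_mul, abs_mul, abs_of_nonneg (mul_nonneg (by positivity) h4)]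
    refine mul_le_mul_of_nonneg_left ?_ (abs_nonneg _)
    calc h n ^ 2 * kernelWeight K (h n) x (t j) * |v j|
        ≤ h n ^ 2 * (h n ^ 2 * (B / |x - t j| ^ 3)) * |v j| := by gcongr
      _ = h n ^ 4 * (B / |x - t j| ^ 3 * |v j|) := by ring
  have h2 := tendsto_finsetSum C h1
  simp only [Finset.sum_const_zero] at h2
  obtain ⟨N, hN⟩ := C.exists_nat_subset_range
  refine h2.congr' ?_
  filter_upwards [eventually_ge_atTop N] with n hn
  rw [waypointAverage, Finset.inter_eq_right.2 (hN.trans (Finset.range_mono hn)),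
    Finset.sum_div, Finset.sum_div]

theorem tendsto_waypointAverage_zero (H : IsRegularDesign ν K m f σ2 h x)
    (hl : Tendsto (fun n : ℕ => l n / (n * h n ^ 4)) atTop (𝓝 0)) (hx : ∀ j ∈ C, x ≠ t j)
    (v : ℕ → ℝ) : Tendsto (waypointAverage C t K h l x v) atTop (𝓝 0) := by
  have h1 := (H.tendsto_waypointAverage hl hx v).mul (H.h_zero.pow 2)
  simp only [zero_mul] at h1
  exact h1.congr fun n => div_mul_cancel₀ _ (pow_ne_zero 2 (H.h_pos n).ne')

/-- The truncated denominator, evaluated at the mean. -/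
theorem tendsto_truncInv_mean (H : IsRegularDesign ν K m f σ2 h x)
    (hδ : Tendsto δ atTop (𝓝 0)) :
    Tendsto (fun n : ℕ => truncInv (f x / 2) (δ n + ((Finset.range n \ C).card : ℝ) / n *
      ∫ p, kernelWeight K (h n) x p.1 ∂ν)) atTop (𝓝 (1 / f x)) := by
  have hf := H.f_pos
  have h1 := hδ.add ((tendsto_card_range_sdiff_div C).mul H.tendsto_integral_weight)
  rw [zero_add, one_mul] at h1
  have h2 := (continuousAt_truncInv (c := f x / 2) (by positivity) (d := f x)).tendsto.comp h1
  rwa [truncInv_of_le (by linarith)] at h2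

theorem tendsto_mean_numerator (H : IsRegularDesign ν K m f σ2 h x)
    (hη : Tendsto (fun n => η n / h n ^ 2) atTop (𝓝 0)) :
    Tendsto (fun n : ℕ => (η n + ((Finset.range n \ C).card : ℝ) / n *
      ∫ p, kernelWeight K (h n) x p.1 * (m p.1 - m x) ∂ν) / h n ^ 2) atTop
      (𝓝 ((deriv (deriv m) x * f x + 2 * deriv m x * deriv f x) / 2 * kernelSecondMoment K)) := by
  have h1 := hη.add ((tendsto_card_range_sdiff_div C).mul H.tendsto_integral_weight_mul_regression)
  rw [zero_add, one_mul] at h1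
  refine h1.congr fun n => ?_
  rw [add_div, mul_div_assoc]

/-- Numerator times truncated inverse denominator of the estimation error. -/
theorem tendsto_truncated_linear (H : IsRegularDesign ν K m f σ2 h x)
    (h_top : Tendsto (fun n : ℕ => n * h n) atTop atTop)
    (hZ : ∀ n, IsIIDSample μ Z ν (Finset.range n \ C)) (hδ : Tendsto δ atTop (𝓝 0))
    (hη : Tendsto (fun n => η n / h n ^ 2) atTop (𝓝 0)) :
    Tendsto (fun n : ℕ => n * h n * ∫ ω, ((noiseAverage Z C K m h x n ω + (η n +
        average Z (Finset.range n \ C) n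
          (fun p => kernelWeight K (h n) x p.1 * (m p.1 - m x)) ω)) *
        truncInv (f x / 2) (δ n + average Z (Finset.range n \ C) n
          (fun p => kernelWeight K (h n) x p.1) ω) -
      (η n + ((Finset.range n \ C).card : ℝ) / n *
        ∫ p, kernelWeight K (h n) x p.1 * (m p.1 - m x) ∂ν) *
        truncInv (f x / 2) (δ n + ((Finset.range n \ C).card : ℝ) / n *
          ∫ p, kernelWeight K (h n) x p.1 ∂ν) -
      noiseAverage Z C K m h x n ω * (1 / f x)) ^ 2 ∂μ) atTop (𝓝 0) := by
  have hf := H.f_pos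
  have hc : 0 < f x / 2 := by positivity
  set c := f x / 2 with hcdef
  obtain ⟨he, heL⟩ := H.tendsto_integral_weight_mul_error_sq
  obtain ⟨hg, hgL⟩ := H.tendsto_integral_weight_mul_regression_sq
  have hw := H.tendsto_integral_weight_sq
  have hmin := H.tendsto_integral_weight_error_sq_mul_min h_top hc
  have hψ := H.tendsto_truncInv_mean (C := C) hδ
  have hγ := (H.tendsto_mean_numerator (C := C) hη).mul (H.h_zero.pow 2)
  have hinv : Tendsto (fun n : ℕ => 1 / (n * h n)) atTop (𝓝 0) := by
    simp only [one_div]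
    exact h_top.inv_tendsto_atTop
  rw [show (0 : ℝ) ^ 2 = 0 by norm_num, mul_zero] at hγ
  set ψ : ℕ → ℝ := fun n => truncInv c (δ n + ((Finset.range n \ C).card : ℝ) / n *
      ∫ p, kernelWeight K (h n) x p.1 ∂ν) with hψdef
  set γ : ℕ → ℝ := fun n => η n + ((Finset.range n \ C).card : ℝ) / n *
      ∫ p, kernelWeight K (h n) x p.1 * (m p.1 - m x) ∂ν with hγdef
  have hγ0 : Tendsto γ atTop (𝓝 0) :=
    hγ.congr fun n => div_mul_cancel₀ _ (pow_ne_zero 2 (H.h_pos n).ne')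
  -- The bound of `integral_sq_truncated_sub_le`, multiplied by `n h`: every second moment is paired
  -- with the `h` that gives it a limit. The noise term keeps a factor `1 / (n h)`, and the others
  -- contain a vanishing limit.
  have h1 := (((((he.const_mul (8 / c ^ 4)).mul hw).mul hinv).add (hmin.const_mul 2)).add
    ((((hψ.sub_const (1 / f x)).pow 2).mul he).add
      ((hg.div_const (c ^ 2)).add ((hγ0.pow 2).mul (hw.div_const (c ^ 4)))))).const_mul 4
  have h2 : (4 : ℝ) * (8 / c ^ 4 * (σ2 x * f x * kernelRoughness K) * (f x * kernelRoughness K) * 0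
      + 2 * 0 + ((1 / f x - 1 / f x) ^ 2 * (σ2 x * f x * kernelRoughness K) +
      (0 / c ^ 2 + 0 ^ 2 * (f x * kernelRoughness K / c ^ 4)))) = 0 := by ring
  rw [h2] at h1
  have hnh : ∀ n : ℕ, 0 ≤ n * h n := fun n => mul_nonneg (Nat.cast_nonneg n) (H.h_pos n).le
  refine squeeze_zero' (Eventually.of_forall fun n => mul_nonneg (hnh n)
    (integral_nonneg fun ω => sq_nonneg _)) ?_ h1
  filter_upwards [heL, hgL, H.eventually_memLp_weight, eventually_gt_atTop 0] with n hen hgn hwn hn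
  have hmm := H.law.measurable_m
  have hwm := H.measurable_weight n
  have h3 := (hZ n).integral_sq_truncated_sub_le H.law hwm (H.weight_nonneg n) hwn hen
    (g := fun p => kernelWeight K (h n) x p.1 * (m p.1 - m x)) (by fun_prop) hgn hc hn
    (card_range_sdiff_le C n) (δ n) (η n) (1 / f x)
  refine (mul_le_mul_of_nonneg_left h3 (hnh n)).trans (le_of_eq ?_)
  have hn' : (n : ℝ) ≠ 0 := by exact_mod_cast hn.ne'
  have hh := (H.h_pos n).ne'
  have hc' := hc.ne'
  have key : ∀ E W M G p g : ℝ, n * h n * (4 * ((8 / c ^ 4 * E * (W / n) + 2 * M) / n + p * (E / n) +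
      G / n / c ^ 2 + g * (W / n / c ^ 4))) = 4 * (8 / c ^ 4 * (h n * E) * (h n * W) *
      (1 / (n * h n)) + 2 * (h n * M) + (p * (h n * E) + (h n * G / c ^ 2 +
      g * (h n * W / c ^ 4)))) := fun E W M G p g => by
    field_simp
    ring
  exact key _ _ _ _ _ _

/-- With `θ = h`, the error of `abs_integral_truncated_sub_le` is of order `1 / (n h) + h² (h + 1 /
(n h²))`. It has to be `o(h²)`, which `n h⁴ → ∞` ensures. -/
theorem tendsto_truncated_mean (H : IsRegularDesign ν K m f σ2 h x)
    (hn4 : Tendsto (fun n : ℕ => n * h n ^ 4) atTop atTop)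
    (hZ : ∀ n, IsIIDSample μ Z ν (Finset.range n \ C)) (hδ : Tendsto δ atTop (𝓝 0))
    (hη : Tendsto (fun n => η n / h n ^ 2) atTop (𝓝 0)) :
    Tendsto (fun n : ℕ => (∫ ω, (noiseAverage Z C K m h x n ω + (η n +
        average Z (Finset.range n \ C) n
          (fun p => kernelWeight K (h n) x p.1 * (m p.1 - m x)) ω)) *
        truncInv (f x / 2) (δ n + average Z (Finset.range n \ C) n
          (fun p => kernelWeight K (h n) x p.1) ω) ∂μ) / h n ^ 2) atTop
      (𝓝 (1 / 2 * kernelSecondMoment K *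
        (deriv (deriv m) x + 2 * deriv m x * deriv f x / f x))) := by
  have hf := H.f_pos
  have hc : 0 < f x / 2 := by positivity
  set c := f x / 2 with hcdef
  obtain ⟨he, heL⟩ := H.tendsto_integral_weight_mul_error_sq
  obtain ⟨hg, hgL⟩ := H.tendsto_integral_weight_mul_regression_sq
  have hw := H.tendsto_integral_weight_sq
  have hψ := H.tendsto_truncInv_mean (C := C) hδ
  have hγ := H.tendsto_mean_numerator (C := C) hη
  have hinv : Tendsto (fun n : ℕ => 1 / (n * h n ^ 4)) atTop (𝓝 0) := by
    simp only [one_div]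
    exact hn4.inv_tendsto_atTop
  have h1 := (((hg.mul hinv).mul (H.h_zero)).add (((hw.div_const (c ^ 4)).mul hinv).mul
    H.h_zero)).div_const 2
  have h2 := hγ.abs.mul (((H.h_zero.add ((hw.mul hinv).mul (H.h_zero.pow 2))).div_const
    (c ^ 2)).div_const 2)
  have h3 := h1.add h2
  simp only [mul_zero, add_zero, zero_div, ne_eq, OfNat.ofNat_ne_zero, not_false_eq_true,
    zero_pow] at h3
  have h4 := hγ.mul hψ
  have h5 : (deriv (deriv m) x * f x + 2 * deriv m x * deriv f x) / 2 * kernelSecondMoment K *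
      (1 / f x) = 1 / 2 * kernelSecondMoment K *
        (deriv (deriv m) x + 2 * deriv m x * deriv f x / f x) := by
    field_simp
  rw [h5] at h4
  refine tendsto_of_tendsto_of_dist h4 (squeeze_zero' (Eventually.of_forall fun n => dist_nonneg)
    ?_ h3)
  filter_upwards [heL, hgL, H.eventually_memLp_weight, eventually_gt_atTop 0] with n hen hgn hwn hn
  have hmm := H.law.measurable_m
  have hwm := H.measurable_weight n
  have hh := H.h_pos n
  have hn' : (0 : ℝ) < n := by exact_mod_cast hn
  have h6 := (hZ n).abs_integral_truncated_sub_le H.law hwm hwn hen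
    (g := fun p => kernelWeight K (h n) x p.1 * (m p.1 - m x)) (by fun_prop) hgn hc hn
    (card_range_sdiff_le C n) (δ n) (η n) hh
  rw [dist_comm, Real.dist_eq, div_mul_eq_mul_div, ← sub_div, abs_div,
    abs_of_pos (by positivity : 0 < h n ^ 2), div_le_iff₀ (by positivity)]
  refine h6.trans (le_of_eq ?_)
  rw [abs_div, abs_of_pos (by positivity : 0 < h n ^ 2)]
  have key : ∀ W G g : ℝ, (G / n + W / n / c ^ 4) / 2 + g * ((h n + W / n / h n) / c ^ 2 / 2) =
      ((h n * G * (1 / (n * h n ^ 4)) * h n + h n * W / c ^ 4 * (1 / (n * h n ^ 4)) * h n) / 2 +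
      g / h n ^ 2 * ((h n + h n * W * (1 / (n * h n ^ 4)) * h n ^ 2) / c ^ 2 / 2)) * h n ^ 2 :=
    fun W G g => by
      field_simp
  exact key _ _ _

theorem eventually_memLp_truncated (H : IsRegularDesign ν K m f σ2 h x)
    (hZ : ∀ n, IsIIDSample μ Z ν (Finset.range n \ C)) :
    ∀ᶠ n : ℕ in atTop, MemLp (fun ω => (noiseAverage Z C K m h x n ω + (η n +
        average Z (Finset.range n \ C) n
          (fun p => kernelWeight K (h n) x p.1 * (m p.1 - m x)) ω)) *
        truncInv (f x / 2) (δ n + average Z (Finset.range n \ C) n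
          (fun p => kernelWeight K (h n) x p.1) ω)) 2 μ := by
  have hf := H.f_pos
  filter_upwards [H.eventually_memLp_noiseAverage hZ,
    H.tendsto_integral_weight_mul_regression_sq.2] with n hSn hgn
  exact (hZ n).memLp_mul_truncInv (H.measurable_weight n) (by positivity) n (δ n)
    (hSn.1.add ((memLp_const (η n)).add ((hZ n).memLp_average' hgn n)))

end IsRegularDesign

end Truncated

/-! ### The estimators as weighted averages, and the cost of truncation. -/

section Estimator

variable {Ω : Type*} [MeasurableSpace Ω] {μ : Measure Ω} [IsProbabilityMeasure μ]
  {Z : ℕ → Ω → ℝ × ℝ} {ν : Measure (ℝ × ℝ)} [IsProbabilityMeasure ν] {C : Finset ℕ}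
  {K m f σ2 : ℝ → ℝ} {h l t : ℕ → ℝ} {x : ℝ}

/-- The kernel weight of an observation, multiplied by `l` for waypoints. -/
noncomputable def adaptiveWeight (C : Finset ℕ) (K : ℝ → ℝ) (b l x : ℝ) (i : ℕ) (u : ℝ) : ℝ :=
  (if i ∈ C then l else 1) * kernelWeight K b x u

theorem sum_adaptiveWeight_mul (C : Finset ℕ) (K : ℝ → ℝ) (b l x : ℝ) (n : ℕ) (X v : ℕ → ℝ) :
    ∑ i ∈ Finset.range n, adaptiveWeight C K b l x i (X i) * v i =
      (∑ i ∈ Finset.range n \ C, kernelWeight K b x (X i) * v i) +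
        ∑ i ∈ Finset.range n ∩ C, l * kernelWeight K b x (X i) * v i := by
  rw [← Finset.sum_inter_add_sum_sdiff (Finset.range n) C, add_comm]
  congr 1
  · refine Finset.sum_congr rfl fun i hi => ?_
    rw [adaptiveWeight, if_neg (Finset.mem_sdiff.1 hi).2, one_mul]
  · refine Finset.sum_congr rfl fun i hi => ?_
    rw [adaptiveWeight, if_pos (Finset.mem_inter.1 hi).2]

theorem sum_adaptiveWeight (C : Finset ℕ) (K : ℝ → ℝ) (b l x : ℝ) (n : ℕ) (X : ℕ → ℝ) :
    ∑ i ∈ Finset.range n, adaptiveWeight C K b l x i (X i) =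
      (∑ i ∈ Finset.range n \ C, kernelWeight K b x (X i)) +
        ∑ i ∈ Finset.range n ∩ C, l * kernelWeight K b x (X i) := by
  simpa using sum_adaptiveWeight_mul C K b l x n X fun _ => 1

theorem anw_eq (K : ℝ → ℝ) (b l : ℝ) (C : Finset ℕ) (n : ℕ) (X Y : ℕ → ℝ) (x : ℝ) :
    anw K b l C n X Y x =
      (∑ i ∈ Finset.range n, adaptiveWeight C K b l x i (X i) * Y i) /
        ∑ i ∈ Finset.range n, adaptiveWeight C K b l x i (X i) := by
  rw [anw, sum_adaptiveWeight_mul, sum_adaptiveWeight]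

theorem anw_one (K : ℝ → ℝ) (b : ℝ) (C : Finset ℕ) (n : ℕ) (X Y : ℕ → ℝ) (x : ℝ) :
    anw K b 1 C n X Y x = nw K b n X Y x := by
  simp [anw_eq, nw, adaptiveWeight]

theorem adaptiveWeight_nonneg (hK : IsSmoothingKernel K) {b l : ℝ} (hb : 0 < b) (hl : 0 ≤ l)
    (i : ℕ) (u : ℝ) : 0 ≤ adaptiveWeight C K b l x i u := by
  have := kernelWeight_nonneg hK hb x u
  rw [adaptiveWeight]
  split_ifs <;> positivity

/-- The adaptive estimator with its denominator bounded away from zero. -/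
noncomputable def truncatedEstimator (Z : ℕ → Ω → ℝ × ℝ) (C : Finset ℕ) (t : ℕ → ℝ)
    (K m f : ℝ → ℝ) (h l : ℕ → ℝ) (x : ℝ) (n : ℕ) (ω : Ω) : ℝ :=
  (noiseAverage Z C K m h x n ω + (waypointAverage C t K h l x (fun j => m (t j) - m x) n +
    average Z (Finset.range n \ C) n
      (fun p => kernelWeight K (h n) x p.1 * (m p.1 - m x)) ω)) *
    truncInv (f x / 2) (waypointAverage C t K h l x (fun _ => 1) n +
      average Z (Finset.range n \ C) n (fun p => kernelWeight K (h n) x p.1) ω)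

theorem sum_adaptiveWeight_div (hC : ∀ i ∈ C, ∀ ω, Z i ω = (t i, m (t i))) (n : ℕ) (ω : Ω) :
    (∑ i ∈ Finset.range n, adaptiveWeight C K (h n) (l n) x i (Z i ω).1) / n =
      waypointAverage C t K h l x (fun _ => 1) n +
        average Z (Finset.range n \ C) n (fun p => kernelWeight K (h n) x p.1) ω := by
  rw [sum_adaptiveWeight C K (h n) (l n) x n fun i => (Z i ω).1, add_comm, add_div,
    waypointAverage, average]
  congr 2
  refine Finset.sum_congr rfl fun i hi => ?_
  rw [hC i (Finset.mem_inter.1 hi).2 ω, mul_one]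

theorem sum_adaptiveWeight_mul_sub_div (hC : ∀ i ∈ C, ∀ ω, Z i ω = (t i, m (t i))) (n : ℕ)
    (ω : Ω) :
    (∑ i ∈ Finset.range n,
      adaptiveWeight C K (h n) (l n) x i (Z i ω).1 * ((Z i ω).2 - m x)) / n =
      noiseAverage Z C K m h x n ω + (waypointAverage C t K h l x (fun j => m (t j) - m x) n +
        average Z (Finset.range n \ C) n
          (fun p => kernelWeight K (h n) x p.1 * (m p.1 - m x)) ω) := by
  rw [sum_adaptiveWeight_mul C K (h n) (l n) x n (fun i => (Z i ω).1) fun i => (Z i ω).2 - m x]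
  have h1 : ∑ i ∈ Finset.range n ∩ C,
      l n * kernelWeight K (h n) x (Z i ω).1 * ((Z i ω).2 - m x) =
      ∑ j ∈ Finset.range n ∩ C, l n * kernelWeight K (h n) x (t j) * (m (t j) - m x) :=
    Finset.sum_congr rfl fun i hi => by rw [hC i (Finset.mem_inter.1 hi).2 ω]
  have h2 : ∑ i ∈ Finset.range n \ C, kernelWeight K (h n) x (Z i ω).1 * ((Z i ω).2 - m x) =
      (∑ i ∈ Finset.range n \ C,
        kernelWeight K (h n) x (Z i ω).1 * regressionError m (Z i ω)) +
      ∑ i ∈ Finset.range n \ C, kernelWeight K (h n) x (Z i ω).1 * (m (Z i ω).1 - m x) := by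
    rw [← Finset.sum_add_distrib]
    refine Finset.sum_congr rfl fun i _ => ?_
    rw [regressionError]; ring
  rw [h1, h2]
  simp only [noiseAverage, waypointAverage, average]
  ring

theorem aemeasurable_anw (hK : IsSmoothingKernel K) {J : Finset ℕ} (hZ : IsIIDSample μ Z ν J)
    (b l : ℝ) (n : ℕ) :
    AEMeasurable (fun ω => anw K b l C n (fun i => (Z i ω).1) (fun i => (Z i ω).2) x) μ := by
  have hw := measurable_kernelWeight hK b x
  have hm := hZ.aemeasurable
  have h1 : ∀ i, AEMeasurable (fun ω => kernelWeight K b x (Z i ω).1) μ := fun i =>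
    hw.comp_aemeasurable (measurable_fst.comp_aemeasurable (hm i))
  have h2 : ∀ i, AEMeasurable (fun ω => (Z i ω).2) μ := fun i =>
    measurable_snd.comp_aemeasurable (hm i)
  unfold anw
  refine AEMeasurable.div ?_ ?_
  · exact (Finset.aemeasurable_fun_sum _ fun i _ => (h1 i).mul (h2 i)).add
      (Finset.aemeasurable_fun_sum _ fun i _ => ((h1 i).const_mul l).mul (h2 i))
  · exact (Finset.aemeasurable_fun_sum _ fun i _ => h1 i).add
      (Finset.aemeasurable_fun_sum _ fun i _ => (h1 i).const_mul l)

/-- The squared estimate is dominated by the sum of the squared responses, however small the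
denominator. -/
theorem memLp_anw (hK : IsSmoothingKernel K) {n : ℕ} (hν : MemLp (fun p : ℝ × ℝ => p.2) 2 ν)
    (hZ : IsIIDSample μ Z ν (Finset.range n \ C))
    (hC : ∀ i ∈ C, ∀ ω, Z i ω = (t i, m (t i))) {b l : ℝ} (hb : 0 < b) (hl : 0 ≤ l) :
    MemLp (fun ω => anw K b l C n (fun i => (Z i ω).1) (fun i => (Z i ω).2) x) 2 μ := by
  have hm := aemeasurable_anw (C := C) (x := x) hK hZ b l n
  rw [memLp_two_iff_integrable_sq hm.aestronglyMeasurable]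
  have h1 : Integrable (fun ω => ∑ i ∈ Finset.range n, (Z i ω).2 ^ 2) μ := by
    refine integrable_finsetSum _ fun i hi => MemLp.integrable_sq ?_
    by_cases hiC : i ∈ C
    · simp only [hC i hiC]
      exact memLp_const _
    · exact hZ.memLp_comp (Finset.mem_sdiff.2 ⟨hi, hiC⟩) hν
  refine h1.mono' (hm.pow_const 2).aestronglyMeasurable (ae_of_all _ fun ω => ?_)
  rw [Real.norm_eq_abs, abs_of_nonneg (sq_nonneg _), anw_eq]
  exact sq_weighted_average_le fun i _ => adaptiveWeight_nonneg hK hb hl i _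

/-- The mean total weight is close to `n f(x)`, twice the threshold, and stays above three quarters
of `n f(x)` when one observation is left out, so the Chernoff bound applies. -/
theorem IsRegularDesign.eventually_measureReal_weight_sum_le (H : IsRegularDesign ν K m f σ2 h x)
    (hZ : ∀ n, IsIIDSample μ Z ν (Finset.range n \ C)) :
    ∃ k : ℝ, 0 < k ∧ ∀ᶠ n : ℕ in atTop, ∀ i ∈ Finset.range n \ C,
      μ.real {ω | ∑ j ∈ (Finset.range n \ C).erase i, kernelWeight K (h n) x (Z j ω).1 ≤
        n * (f x / 2)} ≤ Real.exp (-(k * (n * h n))) := by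
  have hf := H.f_pos
  set c := f x / 2 with hc
  have hc0 : 0 < c := by positivity
  set M := f x * kernelRoughness K + 1 with hM
  have hR : 0 ≤ kernelRoughness K := integral_nonneg fun u => sq_nonneg _
  have hM0 : 0 < M := by positivity
  -- With `θ = a h`, the exponent is at most `n h (-a c / 2 + a² M / 2)`; its minimum, at `a = c /
  -- (2 M)`, is `-c² / (8 M) n h`.
  refine ⟨c ^ 2 / (8 * M), by positivity, ?_⟩
  have h1 : ∀ᶠ n in atTop, h n * ∫ p, kernelWeight K (h n) x p.1 ^ 2 ∂ν ≤ M :=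
    (H.tendsto_integral_weight_sq.eventually_lt_const (by linarith)).mono fun n hn => hn.le
  have h2 : ∀ᶠ n : ℕ in atTop, 3 / 2 * c < (((Finset.range n \ C).card : ℝ) / n - 1 / n) *
      ∫ p, kernelWeight K (h n) x p.1 ∂ν := by
    have h3 := (((tendsto_card_range_sdiff_div C).sub
      (tendsto_one_div_atTop_nhds_zero_nat (𝕜 := ℝ))).mul H.tendsto_integral_weight)
    rw [sub_zero, one_mul] at h3
    exact h3.eventually_const_lt (by linarith)
  filter_upwards [h1, h2, H.eventually_memLp_weight, eventually_gt_atTop 0] with n hn1 hn2 hwn hn i hi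
  have hn' : (0 : ℝ) < n := by exact_mod_cast hn
  have hh := H.h_pos n
  have hκ : 0 ≤ c / (2 * M) * h n := by positivity
  have h4 := ((hZ n).mono (Finset.erase_subset i _)).measureReal_sum_le (H.measurable_weight n)
    (H.weight_nonneg n) hwn hκ (n * c)
  refine h4.trans (Real.exp_le_exp.2 ?_)
  have h5 : (((Finset.range n \ C).erase i).card : ℝ) = (Finset.range n \ C).card - 1 := by
    rw [Finset.card_erase_of_mem hi, Nat.cast_pred (Finset.card_pos.2 ⟨i, hi⟩)]
  have h6 : (((Finset.range n \ C).erase i).card : ℝ) ≤ n := by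
    rw [h5]
    have : ((Finset.range n \ C).card : ℝ) ≤ n := by exact_mod_cast card_range_sdiff_le C n
    linarith
  have h7 : 3 / 2 * c * n ≤ ((Finset.range n \ C).erase i).card *
      ∫ p, kernelWeight K (h n) x p.1 ∂ν := by
    rw [h5]
    refine (mul_le_mul_of_nonneg_right hn2.le hn'.le).trans (le_of_eq ?_)
    field_simp
  set N : ℝ := (((Finset.range n \ C).erase i).card : ℝ) with hN
  set W := ∫ p, kernelWeight K (h n) x p.1 ∂ν
  have hW2 : 0 ≤ ∫ p, kernelWeight K (h n) x p.1 ^ 2 ∂ν := integral_nonneg fun p => sq_nonneg _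
  set V := ∫ p, kernelWeight K (h n) x p.1 ^ 2 ∂ν
  have h8 : N * (h n * V) ≤ n * M := mul_le_mul h6 hn1 (by positivity) hn'.le
  have h9 := mul_le_mul_of_nonneg_left h7 hκ
  have h10 := mul_le_mul_of_nonneg_left h8
    (by positivity : 0 ≤ (c / (2 * M)) ^ 2 * h n / 2)
  have h11 : c / (2 * M) * h n * (n * c) - N * (c / (2 * M) * h n * W -
      (c / (2 * M) * h n) ^ 2 * V / 2) = c / (2 * M) * h n * (n * c) -
      c / (2 * M) * h n * (N * W) + (c / (2 * M)) ^ 2 * h n / 2 * (N * (h n * V)) := by ring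
  have h12 : -(c ^ 2 / (8 * M) * (n * h n)) = c / (2 * M) * h n * (n * c) -
      c / (2 * M) * h n * (3 / 2 * c * n) + (c / (2 * M)) ^ 2 * h n / 2 * (n * M) := by
    field_simp; ring
  rw [h11, h12]
  linarith

theorem IsRegularDesign.eventually_integral_sq_anw_sub_truncated_le (H : IsRegularDesign ν K m f σ2 h x)
    (hZ : ∀ n, IsIIDSample μ Z ν (Finset.range n \ C))
    (hC : ∀ i ∈ C, ∀ ω, Z i ω = (t i, m (t i))) (hl : ∀ᶠ n in atTop, 0 ≤ l n) :
    ∃ B k : ℝ, 0 < k ∧ ∀ᶠ n : ℕ in atTop,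
      ∫ ω, (anw K (h n) (l n) C n (fun i => (Z i ω).1) (fun i => (Z i ω).2) x -
        (m x + truncatedEstimator Z C t K m f h l x n ω)) ^ 2 ∂μ ≤
      n * (B * Real.exp (-(k * (n * h n)))) := by
  have hf := H.f_pos
  obtain ⟨k, hk, hev⟩ := H.eventually_measureReal_weight_sum_le hZ
  set Q : ℝ := 2 * (m x ^ 2 + ∑ j ∈ C, m (t j) ^ 2) with hQ
  have hQ0 : 0 ≤ Q := by
    have : 0 ≤ ∑ j ∈ C, m (t j) ^ 2 := Finset.sum_nonneg fun j _ => sq_nonneg _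
    positivity
  -- The deterministic terms, from `m x` and from the waypoints, are absorbed into `φ²` of each
  -- stochastic observation, so a single bound for `φ(Z i)²` on the bad event suffices. Requiring `n
  -- > C.card` below guarantees an observation to carry them.
  set φ : ℝ × ℝ → ℝ := fun p => √(Q + 2 * p.2 ^ 2) with hφ
  have hφsq : ∀ p, φ p ^ 2 = Q + 2 * p.2 ^ 2 := fun p => Real.sq_sqrt (by positivity)
  have hφm : Measurable φ := by fun_prop
  have hφL : MemLp φ 2 ν := by
    rw [memLp_two_iff_integrable_sq hφm.aestronglyMeasurable]
    simp_rw [hφsq]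
    exact (integrable_const Q).add (H.law.memLp_snd.integrable_sq.const_mul 2)
  have hB : 0 ≤ ∫ p, φ p ^ 2 ∂ν := integral_nonneg fun p => sq_nonneg _
  refine ⟨∫ p, φ p ^ 2 ∂ν, k, hk, ?_⟩
  filter_upwards [hev, hl, eventually_card_range_sdiff C, eventually_gt_atTop C.card]
    with n hn hln hcard hnC
  have hn0 : 0 < n := by omega
  have hn' : (0 : ℝ) < n := by exact_mod_cast hn0
  have hh := H.h_pos n
  have hJ : (Finset.range n \ C).Nonempty := by
    rw [← Finset.card_pos]; omega
  set J := Finset.range n \ C with hJdef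
  set a : ℕ → Ω → ℝ := fun i ω => adaptiveWeight C K (h n) (l n) x i (Z i ω).1 with ha
  have ha0 : ∀ i ω, 0 ≤ a i ω := fun i ω => adaptiveWeight_nonneg H.kernel hh hln i _
  set A : Set Ω := {ω | (∑ i ∈ Finset.range n, a i ω) / n < f x / 2} with hA
  have hAm : NullMeasurableSet A μ := by
    have h1 : ∀ i, AEMeasurable (fun ω => a i ω) μ := fun i =>
      ((H.measurable_weight n).const_mul _).comp_aemeasurable
        (measurable_fst.comp_aemeasurable ((hZ n).aemeasurable i))
    exact nullMeasurableSet_lt ((Finset.aemeasurable_fun_sum _ fun i _ => h1 i).div_const _)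
      aemeasurable_const
  have hAsum : ∀ ω ∈ A, ∑ i ∈ J, kernelWeight K (h n) x (Z i ω).1 ≤ n * (f x / 2) := fun ω hω => by
    have h1 : (∑ i ∈ Finset.range n, a i ω) / n < f x / 2 := hω
    rw [div_lt_iff₀ hn'] at h1
    have h2 : ∑ i ∈ J, kernelWeight K (h n) x (Z i ω).1 = ∑ i ∈ J, a i ω :=
      Finset.sum_congr rfl fun i hi => by
        simp only [ha, adaptiveWeight, if_neg (Finset.mem_sdiff.1 hi).2, one_mul]
    have h3 : ∑ i ∈ J, a i ω ≤ ∑ i ∈ Finset.range n, a i ω :=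
      Finset.sum_le_sum_of_subset_of_nonneg Finset.sdiff_subset fun i _ _ => ha0 i ω
    rw [h2]; linarith
  have hint : ∀ i ∈ J, Integrable (A.indicator fun ω => φ (Z i ω) ^ 2) μ := fun i hi =>
    ((hZ n).memLp_comp hi hφL).integrable_sq.indicator₀ hAm
  have hpt : ∀ ω, (anw K (h n) (l n) C n (fun i => (Z i ω).1) (fun i => (Z i ω).2) x -
      (m x + truncatedEstimator Z C t K m f h l x n ω)) ^ 2 ≤
      ∑ i ∈ J, A.indicator (fun ω => φ (Z i ω) ^ 2) ω := fun ω => by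
    rw [anw_eq, truncatedEstimator, ← sum_adaptiveWeight_div hC,
      ← sum_adaptiveWeight_mul_sub_div hC]
    refine (sq_weighted_average_sub_truncated_le (fun i _ => ha0 i ω) hn0 (by positivity)
      (m x)).trans ?_
    by_cases hω : ω ∈ A
    · rw [if_pos (show (∑ i ∈ Finset.range n, a i ω) / n < f x / 2 from hω)]
      simp only [Set.indicator_of_mem hω, hφsq]
      have h1 : ∑ i ∈ Finset.range n, (Z i ω).2 ^ 2 ≤
          (∑ j ∈ C, m (t j) ^ 2) + ∑ i ∈ J, (Z i ω).2 ^ 2 := by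
        rw [← Finset.sum_inter_add_sum_sdiff (Finset.range n) C]
        gcongr
        calc ∑ i ∈ Finset.range n ∩ C, (Z i ω).2 ^ 2
            = ∑ i ∈ Finset.range n ∩ C, m (t i) ^ 2 :=
              Finset.sum_congr rfl fun i hi => by rw [hC i (Finset.mem_inter.1 hi).2 ω]
          _ ≤ ∑ j ∈ C, m (t j) ^ 2 := Finset.sum_le_sum_of_subset_of_nonneg
              Finset.inter_subset_right fun i _ _ => sq_nonneg _
      have h2 : (1 : ℝ) ≤ J.card := by exact_mod_cast hJ.card_pos
      rw [Finset.sum_add_distrib, Finset.sum_const, nsmul_eq_mul, ← Finset.mul_sum]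
      have h3 : Q ≤ J.card * Q := le_mul_of_one_le_left hQ0 h2
      linarith
    · rw [if_neg (show ¬(∑ i ∈ Finset.range n, a i ω) / n < f x / 2 from hω)]
      exact Finset.sum_nonneg fun i _ => by rw [Set.indicator_of_notMem hω]
  calc ∫ ω, (anw K (h n) (l n) C n (fun i => (Z i ω).1) (fun i => (Z i ω).2) x -
        (m x + truncatedEstimator Z C t K m f h l x n ω)) ^ 2 ∂μ
      ≤ ∫ ω, ∑ i ∈ J, A.indicator (fun ω => φ (Z i ω) ^ 2) ω ∂μ :=
        integral_mono_of_nonneg (ae_of_all _ fun ω => sq_nonneg _)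
          (integrable_finsetSum _ hint) (ae_of_all _ hpt)
    _ = ∑ i ∈ J, ∫ ω, A.indicator (fun ω => φ (Z i ω) ^ 2) ω ∂μ := integral_finsetSum _ hint
    _ ≤ ∑ _i ∈ J, (∫ p, φ p ^ 2 ∂ν) * Real.exp (-(k * (n * h n))) :=
        Finset.sum_le_sum fun i hi => (hZ n).integral_indicator_sq_le (H.measurable_weight n)
          (H.weight_nonneg n) hi hAsum (hn i hi) hφm hφL
    _ ≤ n * ((∫ p, φ p ^ 2 ∂ν) * Real.exp (-(k * (n * h n)))) := by
        rw [Finset.sum_const, nsmul_eq_mul]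
        have : (J.card : ℝ) ≤ n := by exact_mod_cast card_range_sdiff_le C n
        gcongr

end Estimator

/-! ### Transfer from the truncated estimator to the estimator itself. -/

section Asymptotics

variable {Ω : Type*} [MeasurableSpace Ω] {μ : Measure Ω} [IsProbabilityMeasure μ]
  {Z : ℕ → Ω → ℝ × ℝ} {ν : Measure (ℝ × ℝ)} [IsProbabilityMeasure ν] {C : Finset ℕ}
  {K m f σ2 : ℝ → ℝ} {h l t : ℕ → ℝ} {x : ℝ}

/-- Linearization of an estimator around its mean from a linearization around an arbitrary
center. -/
theorem tendsto_centered_of_tendsto {T V S : ℕ → Ω → ℝ} {s γ : ℕ → ℝ} {M : ℝ} (hs : ∀ n, 0 ≤ s n)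
    (hT : ∀ᶠ n in atTop, MemLp (T n) 2 μ) (hV : ∀ᶠ n in atTop, MemLp (V n) 2 μ)
    (hS : ∀ᶠ n in atTop, MemLp (S n) 2 μ ∧ ∫ ω, S n ω ∂μ = 0)
    (hTV : Tendsto (fun n => s n * ∫ ω, (T n ω - (M + V n ω)) ^ 2 ∂μ) atTop (𝓝 0))
    (hVS : Tendsto (fun n => s n * ∫ ω, (V n ω - γ n - S n ω) ^ 2 ∂μ) atTop (𝓝 0)) :
    Tendsto (fun n => s n * ∫ ω, (T n ω - (∫ ω', T n ω' ∂μ) - S n ω) ^ 2 ∂μ) atTop (𝓝 0) := by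
  have h2 := (hTV.add hVS).const_mul 2
  rw [add_zero, mul_zero] at h2
  refine squeeze_zero' (Eventually.of_forall fun n => mul_nonneg (hs n)
    (integral_nonneg fun ω => sq_nonneg _)) ?_ h2
  filter_upwards [hT, hV, hS] with n hTn hVn hSn
  have hA : MemLp (fun ω => T n ω - (M + V n ω)) 2 μ :=
    hTn.sub ((memLp_const M).add hVn)
  have hB : MemLp (fun ω => V n ω - γ n - S n ω) 2 μ := (hVn.sub (memLp_const _)).sub hSn.1
  have hTM : MemLp (fun ω => T n ω - M) 2 μ := hTn.sub (memLp_const _)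
  have hTc : MemLp (fun ω => T n ω - M - γ n) 2 μ := hTM.sub (memLp_const _)
  set U : Ω → ℝ := fun ω => T n ω - M - γ n - S n ω with hU
  have hUL : MemLp U 2 μ := hTc.sub hSn.1
  have hEU : ∫ ω, U ω ∂μ = (∫ ω, T n ω ∂μ) - M - γ n := by
    rw [hU, integral_sub (hTc.integrable one_le_two) (hSn.1.integrable one_le_two),
      integral_sub (hTM.integrable one_le_two) (integrable_const _),
      integral_sub (hTn.integrable one_le_two) (integrable_const _), hSn.2]
    simp
  -- `S` has mean zero, so centering `T` at its mean turns the mean square into the variance of `U`.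
  -- Variance is at most the second moment, so the arbitrary center costs nothing.
  have h3 : ∫ ω, (T n ω - (∫ ω', T n ω' ∂μ) - S n ω) ^ 2 ∂μ = Var[U; μ] := by
    rw [variance_eq_integral hUL.aemeasurable, hEU]
    refine integral_congr_ae (ae_of_all _ fun ω => ?_)
    simp only [hU]; ring
  have h4 : ∫ ω, U ω ^ 2 ∂μ ≤ 2 * ((∫ ω, (T n ω - (M + V n ω)) ^ 2 ∂μ) +
      ∫ ω, (V n ω - γ n - S n ω) ^ 2 ∂μ) := by
    rw [← integral_add hA.integrable_sq hB.integrable_sq, ← integral_const_mul]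
    refine integral_mono hUL.integrable_sq
      ((hA.integrable_sq.add hB.integrable_sq).const_mul 2) fun ω => ?_
    have := add_sq_le (a := T n ω - (M + V n ω)) (b := V n ω - γ n - S n ω)
    refine le_trans (le_of_eq ?_) this
    simp only [hU]; ring
  have h5 : Var[U; μ] ≤ ∫ ω, U ω ^ 2 ∂μ := variance_le_expectation_sq hUL.aestronglyMeasurable
  rw [h3]
  have h6 := mul_le_mul_of_nonneg_left (h5.trans h4) (hs n)
  linarith

/-- Two estimators that are close in mean square have the same asymptotic bias. -/
theorem tendsto_bias_of_tendsto {T V : ℕ → Ω → ℝ} {b : ℕ → ℝ} {M L : ℝ} (hb : ∀ n, b n ≠ 0)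
    (hT : ∀ᶠ n in atTop, MemLp (T n) 2 μ) (hV : ∀ᶠ n in atTop, MemLp (V n) 2 μ)
    (hTV : Tendsto (fun n => (1 / b n) ^ 4 * ∫ ω, (T n ω - (M + V n ω)) ^ 2 ∂μ) atTop (𝓝 0))
    (hL : Tendsto (fun n => (∫ ω, V n ω ∂μ) / b n ^ 2) atTop (𝓝 L)) :
    Tendsto (fun n => ((∫ ω, T n ω ∂μ) - M) / b n ^ 2) atTop (𝓝 L) := by
  have h2 := (Real.continuous_sqrt.tendsto 0).comp hTV
  rw [Real.sqrt_zero] at h2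
  refine tendsto_of_tendsto_of_dist hL (squeeze_zero' (Eventually.of_forall fun n => dist_nonneg)
    ?_ h2)
  filter_upwards [hT, hV] with n hTn hVn
  have hbn := hb n
  have hA : MemLp (fun ω => T n ω - (M + V n ω)) 2 μ :=
    hTn.sub ((memLp_const M).add hVn)
  -- The squared mean of the difference is at most its mean square.
  have h3 := variance_nonneg (fun ω => T n ω - (M + V n ω)) μ
  rw [variance_eq_sub hA] at h3
  have h4 : ∫ ω, (T n ω - (M + V n ω)) ∂μ = (∫ ω, T n ω ∂μ) - M - ∫ ω, V n ω ∂μ := by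
    have hV1 := hVn.integrable one_le_two
    have hMV : Integrable (fun ω => M + V n ω) μ := (integrable_const M).add hV1
    rw [integral_sub (hTn.integrable one_le_two) hMV,
      integral_add (integrable_const _) hV1]
    simp; ring
  rw [dist_comm, Real.dist_eq, ← sub_div, ← h4]
  refine Real.abs_le_sqrt ?_
  have h5 : ∀ y : ℝ, (y / b n ^ 2) ^ 2 = (1 / b n) ^ 4 * y ^ 2 := fun y => by
    rw [div_pow, one_div_pow, ← pow_mul]; ring
  rw [h5]
  exact mul_le_mul_of_nonneg_left (sub_nonneg.1 h3) (by positivity)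

namespace IsRegularDesign

/-- The effect of the truncation is negligible at every polynomial rate. -/
theorem tendsto_mul_integral_sq_anw_sub_truncated (H : IsRegularDesign ν K m f σ2 h x)
    (h_top : Tendsto (fun n : ℕ => n * h n) atTop atTop)
    (hZ : ∀ n, IsIIDSample μ Z ν (Finset.range n \ C))
    (hC : ∀ i ∈ C, ∀ ω, Z i ω = (t i, m (t i))) (hl : ∀ᶠ n in atTop, 0 ≤ l n)
    {s : ℕ → ℝ} {k : ℕ} (hs0 : ∀ n, 0 ≤ s n) (hs : ∀ᶠ n : ℕ in atTop, s n * n ≤ (n * h n) ^ k) :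
    Tendsto (fun n : ℕ => s n * ∫ ω,
      (anw K (h n) (l n) C n (fun i => (Z i ω).1) (fun i => (Z i ω).2) x -
        (m x + truncatedEstimator Z C t K m f h l x n ω)) ^ 2 ∂μ) atTop (𝓝 0) := by
  obtain ⟨B, q, hq, hev⟩ := H.eventually_integral_sq_anw_sub_truncated_le hZ hC hl
  have h1 := ((Real.tendsto_pow_mul_exp_neg_atTop_nhds_zero k).comp
    (h_top.const_mul_atTop hq)).const_mul (|B| / q ^ k)
  rw [mul_zero] at h1
  refine squeeze_zero' (Eventually.of_forall fun n => mul_nonneg (hs0 n)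
    (integral_nonneg fun ω => sq_nonneg _)) ?_ h1
  filter_upwards [hev, hs] with n hn hsn
  have hqk : q ^ k ≠ 0 := (pow_pos hq k).ne'
  calc _ ≤ s n * (n * (B * Real.exp (-(q * (n * h n))))) :=
        mul_le_mul_of_nonneg_left hn (hs0 n)
    _ ≤ s n * (n * (|B| * Real.exp (-(q * (n * h n))))) := by
        have := hs0 n
        gcongr
        exact le_abs_self B
    _ = s n * n * (|B| * Real.exp (-(q * (n * h n)))) := by ring
    _ ≤ (n * h n) ^ k * (|B| * Real.exp (-(q * (n * h n)))) := by gcongr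
    _ = _ := by
        simp only [Function.comp_apply, mul_pow q]
        field_simp

/-- For `h < 1`, `n h⁴ ≥ 1` implies `n h² ≥ 1`, and both bounds are rearrangements of this. Powers
of `n` and `1 / h` thus become powers of `n h`, the variable of the exponential bound. -/
theorem eventually_one_div_le (H : IsRegularDesign ν K m f σ2 h x)
    (hn4 : Tendsto (fun n : ℕ => n * h n ^ 4) atTop atTop) :
    ∀ᶠ n : ℕ in atTop, 1 / h n ≤ n * h n ∧ (n : ℝ) ≤ (n * h n) ^ 2 := by
  filter_upwards [hn4.eventually_ge_atTop 1, H.h_zero.eventually_lt_const one_pos] with n h1 h2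
  have hh := H.h_pos n
  have hn : (0 : ℝ) ≤ n := Nat.cast_nonneg n
  have h3 : h n ^ 4 ≤ h n ^ 2 := pow_le_pow_of_le_one hh.le h2.le (by norm_num)
  have h4 : 1 ≤ n * h n ^ 2 := h1.trans (mul_le_mul_of_nonneg_left h3 hn)
  constructor
  · rw [div_le_iff₀ hh]
    linarith
  · have := mul_le_mul_of_nonneg_left h4 hn
    linarith

/-- Interior asymptotics of the adaptive estimator, and its linearization. -/
theorem hasInteriorAsymptotics_anw (H : IsRegularDesign ν K m f σ2 h x)
    (h_top : Tendsto (fun n : ℕ => n * h n) atTop atTop)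
    (hn4 : Tendsto (fun n : ℕ => n * h n ^ 4) atTop atTop)
    (hZ : ∀ n, IsIIDSample μ Z ν (Finset.range n \ C))
    (hC : ∀ i ∈ C, ∀ ω, Z i ω = (t i, m (t i))) (hl : ∀ᶠ n in atTop, 0 ≤ l n)
    (hls : Tendsto (fun n : ℕ => l n / (n * h n ^ 4)) atTop (𝓝 0)) (hx : ∀ j ∈ C, x ≠ t j)
    {T : ℕ → Ω → ℝ} (hT : T = fun n ω =>
      anw K (h n) (l n) C n (fun i => (Z i ω).1) (fun i => (Z i ω).2) x) :
    HasInteriorAsymptotics μ T h K m f σ2 x ∧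
    Tendsto (fun n : ℕ => n * h n * ∫ ω, (T n ω - (∫ ω', T n ω' ∂μ) -
      noiseAverage Z C K m h x n ω * (1 / f x)) ^ 2 ∂μ) atTop (𝓝 0) := by
  set δ := waypointAverage C t K h l x (fun _ => 1) with hδdef
  set η := waypointAverage C t K h l x (fun j => m (t j) - m x) with hηdef
  have hδ : Tendsto δ atTop (𝓝 0) := H.tendsto_waypointAverage_zero hls hx _
  have hη : Tendsto (fun n => η n / h n ^ 2) atTop (𝓝 0) := H.tendsto_waypointAverage hls hx _
  set V : ℕ → Ω → ℝ := truncatedEstimator Z C t K m f h l x with hVdef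
  have hTm : ∀ n, AEMeasurable (T n) μ := fun n => by
    rw [hT]; exact aemeasurable_anw H.kernel (hZ n) _ _ n
  have hT2 : ∀ᶠ n in atTop, MemLp (T n) 2 μ := by
    filter_upwards [hl] with n hn
    rw [hT]; exact memLp_anw H.kernel H.law.memLp_snd (hZ n) hC (H.h_pos n) hn
  have hV2 : ∀ᶠ n in atTop, MemLp (V n) 2 μ := H.eventually_memLp_truncated hZ
  have hnh : ∀ n : ℕ, 0 ≤ n * h n := fun n => mul_nonneg (Nat.cast_nonneg n) (H.h_pos n).le
  have hrate1 : Tendsto (fun n : ℕ => n * h n * ∫ ω, (T n ω - (m x + V n ω)) ^ 2 ∂μ) atTop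
      (𝓝 0) := by
    rw [hT]
    refine H.tendsto_mul_integral_sq_anw_sub_truncated (k := 3) h_top hZ hC hl hnh ?_
    filter_upwards [H.eventually_one_div_le hn4] with n hn
    have := mul_le_mul_of_nonneg_left hn.2 (hnh n)
    rwa [← pow_succ'] at this
  -- The bias lives on the scale `h²`, and its error is bounded through a mean square, hence the
  -- fourth power.
  have hrate2 : Tendsto (fun n : ℕ => (1 / h n) ^ 4 * ∫ ω, (T n ω - (m x + V n ω)) ^ 2 ∂μ) atTop
      (𝓝 0) := by
    rw [hT]
    refine H.tendsto_mul_integral_sq_anw_sub_truncated (k := 6) h_top hZ hC hl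
      (fun n => by have := H.h_pos n; positivity) ?_
    filter_upwards [H.eventually_one_div_le hn4] with n hn
    have hh := H.h_pos n
    calc (1 / h n) ^ 4 * n ≤ (n * h n) ^ 4 * (n * h n) ^ 2 := by
          gcongr
          · exact hn.1
          · exact hn.2
      _ = (n * h n) ^ 6 := by ring
  have hlin : Tendsto (fun n : ℕ => n * h n * ∫ ω, (T n ω - (∫ ω', T n ω' ∂μ) -
      noiseAverage Z C K m h x n ω * (1 / f x)) ^ 2 ∂μ) atTop (𝓝 0) := by
    set γψ : ℕ → ℝ := fun n => (η n + ((Finset.range n \ C).card : ℝ) / n *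
        ∫ p, kernelWeight K (h n) x p.1 * (m p.1 - m x) ∂ν) *
        truncInv (f x / 2) (δ n + ((Finset.range n \ C).card : ℝ) / n *
          ∫ p, kernelWeight K (h n) x p.1 ∂ν) with hγψ
    have h1 : Tendsto (fun n : ℕ => n * h n * ∫ ω, (V n ω - γψ n -
        noiseAverage Z C K m h x n ω * (1 / f x)) ^ 2 ∂μ) atTop (𝓝 0) :=
      H.tendsto_truncated_linear h_top hZ hδ hη
    refine tendsto_centered_of_tendsto hnh hT2 hV2 ?_ hrate1 h1
    filter_upwards [H.eventually_memLp_noiseAverage hZ] with n hSn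
    exact ⟨hSn.1.mul_const _, by rw [integral_mul_const, hSn.2, zero_mul]⟩
  refine ⟨H.hasInteriorAsymptotics h_top hZ hTm hT2 ?_ hlin, hlin⟩
  have h1 : Tendsto (fun n : ℕ => (∫ ω, V n ω ∂μ) / h n ^ 2) atTop
      (𝓝 (1 / 2 * kernelSecondMoment K *
        (deriv (deriv m) x + 2 * deriv m x * deriv f x / f x))) :=
    H.tendsto_truncated_mean hn4 hZ hδ hη
  exact tendsto_bias_of_tendsto (fun n => (H.h_pos n).ne') hT2 hV2 hrate2 h1

end IsRegularDesign

end Asymptotics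

/-! ### Asymptotic equivalence through a common linear term. -/

section Equivalence

variable {Ω : Type*} [MeasurableSpace Ω] {μ : Measure Ω} [IsProbabilityMeasure μ]

/-- Two estimators with a common linearization are asymptotically equivalent. -/
theorem tendstoInMeasure_centered_sub {T T' S : ℕ → Ω → ℝ} {s : ℕ → ℝ} (hs : ∀ n, 0 ≤ s n)
    (hT : ∀ᶠ n in atTop, MemLp (T n) 2 μ) (hT' : ∀ᶠ n in atTop, MemLp (T' n) 2 μ)
    (hS : ∀ᶠ n in atTop, MemLp (S n) 2 μ)
    (hTS : Tendsto (fun n => s n * ∫ ω, (T n ω - (∫ ω', T n ω' ∂μ) - S n ω) ^ 2 ∂μ) atTop (𝓝 0))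
    (hTS' : Tendsto (fun n => s n * ∫ ω, (T' n ω - (∫ ω', T' n ω' ∂μ) - S n ω) ^ 2 ∂μ) atTop
      (𝓝 0)) :
    TendstoInMeasure μ (fun n ω => √(s n) * ((T n ω - ∫ ω', T n ω' ∂μ) -
      (T' n ω - ∫ ω', T' n ω' ∂μ))) atTop (fun _ => 0) := by
  have hTc : ∀ᶠ n in atTop, MemLp (fun ω => T n ω - ∫ ω', T n ω' ∂μ) 2 μ :=
    hT.mono fun n hn => hn.sub (memLp_const _)
  have hTc' : ∀ᶠ n in atTop, MemLp (fun ω => T' n ω - ∫ ω', T' n ω' ∂μ) 2 μ :=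
    hT'.mono fun n hn => hn.sub (memLp_const _)
  refine tendstoInMeasure_of_tendsto_integral_sq hs ?_ ?_
  · filter_upwards [hTc, hTc'] with n hn hn'
    exact hn.sub hn'
  · have h1 := (hTS.add hTS').const_mul 2
    rw [add_zero, mul_zero] at h1
    refine squeeze_zero' (Eventually.of_forall fun n => mul_nonneg (hs n)
      (integral_nonneg fun ω => sq_nonneg _)) ?_ h1
    filter_upwards [hTc, hTc', hS] with n hn hn' hSn
    have hA : MemLp (fun ω => T n ω - (∫ ω', T n ω' ∂μ) - S n ω) 2 μ := hn.sub hSn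
    have hB : MemLp (fun ω => T' n ω - (∫ ω', T' n ω' ∂μ) - S n ω) 2 μ := hn'.sub hSn
    have hD : MemLp (fun ω => (T n ω - ∫ ω', T n ω' ∂μ) - (T' n ω - ∫ ω', T' n ω' ∂μ)) 2 μ :=
      hn.sub hn'
    rw [← mul_add, mul_left_comm]
    refine mul_le_mul_of_nonneg_left ?_ (hs n)
    rw [← integral_add hA.integrable_sq hB.integrable_sq, ← integral_const_mul]
    refine integral_mono hD.integrable_sq
      ((hA.integrable_sq.add hB.integrable_sq).const_mul 2) fun ω => ?_
    have := add_sq_le (a := T n ω - (∫ ω', T n ω' ∂μ) - S n ω)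
      (b := -(T' n ω - (∫ ω', T' n ω' ∂μ) - S n ω))
    rw [neg_sq] at this
    refine le_trans (le_of_eq ?_) this
    ring

end Equivalence

theorem IsWaypointSample.isIIDSample {Ω : Type*} [MeasurableSpace Ω] {μ : Measure Ω}
    {X Y : ℕ → Ω → ℝ} {ν : Measure (ℝ × ℝ)} {m : ℝ → ℝ} {C : Finset ℕ} {t : ℕ → ℝ}
    (h : IsWaypointSample μ X Y ν m C t) (n : ℕ) :
    IsIIDSample μ (fun i ω => (X i ω, Y i ω)) ν (Finset.range n \ C) where
  indep := h.indep
  aemeasurable i := by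
    by_cases hi : i ∈ C
    · simp only [h.waypoint i hi]
      exact aemeasurable_const
    · exact (h.hasLaw i hi).aemeasurable
  hasLaw i hi := h.hasLaw i (Finset.mem_sdiff.1 hi).2

end WaypointRegression

theorem theorem2 {Ω : Type*} [MeasurableSpace Ω] (μ : Measure Ω) [IsProbabilityMeasure μ]
    (X Y : ℕ → Ω → ℝ) (ν : Measure (ℝ × ℝ)) [IsProbabilityMeasure ν]
    (K m f σ2 : ℝ → ℝ) (C : Finset ℕ) (t : ℕ → ℝ) (h lam : ℕ → ℝ) (x : ℝ)
    -- the data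
    (hν : WaypointRegression.IsRegressionLaw ν m f σ2)
    (hsample : WaypointRegression.IsWaypointSample μ X Y ν m C t)
    -- bandwidth
    (h_pos : ∀ n, 0 < h n)
    (h_zero : Tendsto h atTop (𝓝 0))
    (h_top : Tendsto (fun n : ℕ => n * h n) atTop atTop)
    -- kernel
    (hK : WaypointRegression.IsSmoothingKernel K)
    -- smoothness near the interior point `x`
    (hm : ContDiffAt ℝ 2 m x)
    (hf : ContDiffAt ℝ 2 f x)
    (hfx : 0 < f x)
    -- errors
    (hσ2 : ∀ᶠ u in 𝓝 x, ContinuousAt σ2 u)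
    (herr : WaypointRegression.LocallyUniformlyIntegrableErrors ν m x)
    -- tuning parameter
    (lam_top : Tendsto lam atTop atTop)
    (lam_small : Tendsto (fun n : ℕ => lam n / (n * h n ^ 4)) atTop (𝓝 0))
    -- `x` is not a waypoint
    (hx : ∀ j ∈ C, x ≠ t j) :
    -- interior asymptotics of the adaptive estimator
    WaypointRegression.HasInteriorAsymptotics μ
      (fun n ω => WaypointRegression.anw K (h n) (lam n) C n (fun i => X i ω) (fun i => Y i ω) x)
      h K m f σ2 x ∧
    -- the Nadaraya-Watson estimator has the same interior asymptotics,
    WaypointRegression.HasInteriorAsymptotics μ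
      (fun n ω => WaypointRegression.nw K (h n) n (fun i => X i ω) (fun i => Y i ω) x)
      h K m f σ2 x ∧
    -- and the two centered and scaled estimators differ by a term that tends to 0 in probability
    TendstoInMeasure μ
      (fun (n : ℕ) ω => √(n * h n) *
        ((WaypointRegression.anw K (h n) (lam n) C n (fun i => X i ω) (fun i => Y i ω) x
            - ∫ ω', WaypointRegression.anw K (h n) (lam n) C n
                (fun i => X i ω') (fun i => Y i ω') x ∂μ)
          - (WaypointRegression.nw K (h n) n (fun i => X i ω) (fun i => Y i ω) x
            - ∫ ω', WaypointRegression.nw K (h n) n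
                (fun i => X i ω') (fun i => Y i ω') x ∂μ)))
      atTop (fun _ => 0) := by
  have H : WaypointRegression.IsRegularDesign ν K m f σ2 h x :=
    ⟨hν, hK, h_pos, h_zero, hm, hf, hfx, hσ2.self_of_nhds, herr⟩
  have hC : ∀ i ∈ C, ∀ ω, (X i ω, Y i ω) = (t i, m (t i)) := fun i hi ω =>
    Prod.ext (hsample.waypoint i hi ω).1 (hsample.waypoint i hi ω).2
  have hlam1 : ∀ᶠ n in atTop, 1 ≤ lam n := lam_top.eventually_ge_atTop 1
  have hn4pos : ∀ᶠ n : ℕ in atTop, 0 < (n : ℝ) * h n ^ 4 := by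
    filter_upwards [eventually_gt_atTop 0] with n hn
    have := h_pos n
    positivity
  -- Eventually `λ ≥ 1`, so `1 / (n h⁴)` is squeezed to zero. This yields `n h⁴ → ∞`, and it is also
  -- the smallness condition for the constant tuning parameter 1.
  have one_small : Tendsto (fun n : ℕ => (1 : ℝ) / (n * h n ^ 4)) atTop (𝓝 0) := by
    refine squeeze_zero' (hn4pos.mono fun n hn => by positivity) ?_ lam_small
    filter_upwards [hlam1, hn4pos] with n hn hpos
    gcongr
  have hn4 : Tendsto (fun n : ℕ => (n : ℝ) * h n ^ 4) atTop atTop := by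
    have h1 : Tendsto (fun n : ℕ => (1 : ℝ) / (n * h n ^ 4)) atTop (𝓝[>] 0) :=
      tendsto_nhdsWithin_iff.2 ⟨one_small, hn4pos.mono fun n hn => by
        simp only [Set.mem_Ioi]; positivity⟩
    refine h1.inv_tendsto_nhdsGT_zero.congr fun n => ?_
    simp
  obtain ⟨hA, hAlin⟩ := H.hasInteriorAsymptotics_anw h_top hn4 hsample.isIIDSample hC
    (hlam1.mono fun n hn => zero_le_one.trans hn) lam_small hx rfl
  -- Nadaraya-Watson is the adaptive estimator with tuning parameter 1, so the same result applies
  -- and produces the same linear term.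
  obtain ⟨hN, hNlin⟩ := H.hasInteriorAsymptotics_anw (l := fun _ => 1) h_top hn4
    hsample.isIIDSample hC (Eventually.of_forall fun _ => zero_le_one) one_small hx rfl
  simp only [WaypointRegression.anw_one] at hN hNlin
  refine ⟨hA, hN, WaypointRegression.tendstoInMeasure_centered_sub
    (fun n => mul_nonneg (Nat.cast_nonneg n) (h_pos n).le) hA.memLp hN.memLp ?_ hAlin hNlin⟩
  filter_upwards [H.eventually_memLp_noiseAverage hsample.isIIDSample] with n hn
  exact hn.1.mul_const _
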